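/- **Theorem 3.** Let $(M,g)$ and $(\overline M,\bar g)$ be smooth pseudo-Riemannian manifolds of dimension $n$, let $M$ have signature $(s,n-s)$ with $s\ge 2$ and $n-s\ge 2$, and let $M$ be nowhere conformally flat, i.e. no nonempty open subset of $M$ is conformally flat (an open set $U$ is conformally flat if each of its points has an open neighbourhood $V\subseteq U$ and a smooth function $\sigma$ on $V$ such that the metric $e^{2\sigma}g$ on $V$ is flat). A plane is a 2-dimensional subspace $\alpha$ of a tangent space; it is nondegenerate if the restriction of the metric to $\alpha$ has rank 2, and strongly degenerate if this restriction has rank 0. For a nondegenerate plane $\alpha$ with basis $\{x,y\}$ let $$K(\alpha)=\frac{R(x,y,y,x)}{g(x,x)g(y,y)-g(x,y)^2}$$ be its sectional curvature, where $R$ is the curvature tensor, and let $\overline K$ be the sectional curvature of $\overline M$. Let $f$ be a diffeomorphism of $M$ onto $\overline M$ such that for every point $p\in M$ and every strongly degenerate plane $\alpha_0\subset T_pM$ $$\lim_{\alpha\to\alpha_0}\frac{\overline K(f_*\alpha)}{K(\alpha)}=1, \qquad (2.1)$$ where the limit is taken in the Grassmannian of planes of $T_pM$, over those nondegenerate planes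 $\alpha$ for which $f_*\alpha$ is nondegenerate and the quotient is defined (that is, $K(\alpha)\neq0$). Then $f$ is an isometry: $f^*\bar g=g$. -/

import Mathlib

open scoped Manifold ContDiff Topology

noncomputable section

namespace PseudoRiem

/-! ### Planes in a real vector space, with the Grassmannian topology -/

section Planes

/-- A plane: a 2-dimensional linear subspace. -/
structure Plane (V : Type*) [AddCommGroup V] [Module ℝ V] where
  toSubmodule : Submodule ℝ V
  finrank_eq : Module.finrank ℝ toSubmodule = 2

variable {V W : Type*} [AddCommGroup V] [Module ℝ V] [AddCommGroup W] [Module ℝ W]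

/-- The plane spanned by a linearly independent pair. -/
def Plane.ofFrame (v : {v : Fin 2 → V // LinearIndependent ℝ v}) : Plane V where
  toSubmodule := Submodule.span ℝ (Set.range v.1)
  finrank_eq := by simpa using finrank_span_eq_card v.2

/-- The usual topology of the Grassmannian of planes: the quotient topology from the space of
linearly independent pairs of vectors. -/
instance [TopologicalSpace V] : TopologicalSpace (Plane V) :=
  TopologicalSpace.coinduced Plane.ofFrame inferInstance

/-- A basis of a plane. -/
def Plane.basis (α : Plane V) : Module.Basis (Fin 2) ℝ α.toSubmodule :=
  haveI : FiniteDimensional ℝ α.toSubmodule :=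
    Module.finite_of_finrank_pos (by rw [α.finrank_eq]; norm_num)
  Module.finBasisOfFinrankEq ℝ α.toSubmodule α.finrank_eq

/-- The image of a plane under a linear isomorphism. -/
def Plane.map (L : V ≃ₗ[ℝ] W) (α : Plane V) : Plane W where
  toSubmodule := α.toSubmodule.map (L : V →ₗ[ℝ] W)
  finrank_eq := by rw [LinearEquiv.finrank_map_eq, α.finrank_eq]

/-- The rank of the restriction to a plane `α` of a bilinear form `B`. -/
def Plane.formRank (B : LinearMap.BilinForm ℝ V) (α : Plane V) : ℕ :=
  Module.finrank ℝ (LinearMap.range (B.restrict α.toSubmodule))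

/-- `α` is nondegenerate: the restriction of the form to `α` has rank 2. -/
def Plane.IsNondegenerate (B : LinearMap.BilinForm ℝ V) (α : Plane V) : Prop :=
  α.formRank B = 2

/-- `α` is strongly degenerate: the restriction of the form to `α` has rank 0. -/
def Plane.IsStronglyDegenerate (B : LinearMap.BilinForm ℝ V) (α : Plane V) : Prop :=
  α.formRank B = 0

end Planes

/-! ### Curvature of a metric on an open subset of a vector space -/

section Local

variable {E : Type*} [NormedAddCommGroup E] [NormedSpace ℝ E]

/-- The Christoffel symbol of the second kind `Γ(u, v)` at `y` of the metric `G`: the vector with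
`G(Γ(u, v), w) = ½ (∂_u G(v, w) + ∂_v G(u, w) - ∂_w G(u, v))` for all `w`. -/
def christoffel (G : E → E →L[ℝ] E →L[ℝ] ℝ) (y u v : E) : E :=
  (G y).inverse ((1 / 2 : ℝ) •
    (fderiv ℝ G y u v + fderiv ℝ G y v u - ((fderiv ℝ G y).flip u).flip v))

/-- The curvature operator `R(u, v) w = ∇_u ∇_v w - ∇_v ∇_u w` at `y`, for constant vector
fields `u, v, w`. -/
def localCurvature (G : E → E →L[ℝ] E →L[ℝ] ℝ) (y u v w : E) : E :=
  fderiv ℝ (fun t => christoffel G t v w) y u - fderiv ℝ (fun t => christoffel G t u w) y v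
    + christoffel G y u (christoffel G y v w) - christoffel G y v (christoffel G y u w)

end Local

/-! ### Pseudo-Riemannian metrics on manifolds -/

section Manifold

variable {E : Type*} [NormedAddCommGroup E] [NormedSpace ℝ E]
  {M : Type*} [TopologicalSpace M] [ChartedSpace E M]

/-- A field of bilinear forms on the tangent spaces, with no condition imposed. -/
abbrev FormField (E : Type*) [NormedAddCommGroup E] [NormedSpace ℝ E]
    (M : Type*) [TopologicalSpace M] [ChartedSpace E M] : Type _ :=
  (p : M) → TangentSpace 𝓘(ℝ, E) p →L[ℝ] TangentSpace 𝓘(ℝ, E) p →L[ℝ] ℝ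

/-- A smooth pseudo-Riemannian metric: a smooth field of nondegenerate symmetric bilinear forms
on the tangent spaces. -/
structure PseudoRiemannianMetric (E : Type*) [NormedAddCommGroup E] [NormedSpace ℝ E]
    (M : Type*) [TopologicalSpace M] [ChartedSpace E M] [IsManifold 𝓘(ℝ, E) ∞ M] where
  val : FormField E M
  symm (p : M) (x y : TangentSpace 𝓘(ℝ, E) p) : val p x y = val p y x
  nondegenerate (p : M) (x : TangentSpace 𝓘(ℝ, E) p) (hx : ∀ y, val p x y = 0) : x = 0
  contMDiff : ContMDiff 𝓘(ℝ, E) (𝓘(ℝ, E).prod 𝓘(ℝ, E →L[ℝ] E →L[ℝ] ℝ)) ∞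
    (fun p ↦ Bundle.TotalSpace.mk' (E →L[ℝ] E →L[ℝ] ℝ)
      (E := fun p : M ↦ TangentSpace 𝓘(ℝ, E) p →L[ℝ] TangentSpace 𝓘(ℝ, E) p →L[ℝ] ℝ) p (val p))

/-- The form at `p` as an algebraic bilinear form. -/
def formAt (g : FormField E M) (p : M) : LinearMap.BilinForm ℝ (TangentSpace 𝓘(ℝ, E) p) :=
  LinearMap.mk₂ ℝ (fun x y => g p x y) (by simp) (by simp) (by simp) (by simp)

/-- The metric has signature `(s, r)`: at every point it is negative definite on a space of maximal
dimension `s` and positive definite on a space of maximal dimension `r`. -/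
def HasSignature (g : FormField E M) (s r : ℕ) : Prop :=
  ∀ p, sigNeg (formAt g p).toQuadraticMap = s ∧
    sigPos (formAt g p).toQuadraticMap = r

/-- The expression of `g` in the chart `φ` around `p`: the pullback of `g` along `φ⁻¹`. -/
def inChart (g : FormField E M) (p : M) (y : E) : E →L[ℝ] E →L[ℝ] ℝ :=
  let q : M := (extChartAt 𝓘(ℝ, E) p).symm y
  let A : E →L[ℝ] E := mfderiv 𝓘(ℝ, E) 𝓘(ℝ, E) (extChartAt 𝓘(ℝ, E) p).symm y
  let B : E →L[ℝ] E →L[ℝ] ℝ := g q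
  B.bilinearComp A A

/-- The curvature tensor of type (0,4) at `p`, `R(x, y, z, w) = g(R(x, y) z, w)`, computed in the
chart around `p`. -/
def curvature (g : FormField E M) (p : M) (x y z w : TangentSpace 𝓘(ℝ, E) p) : ℝ :=
  let φ := extChartAt 𝓘(ℝ, E) p
  let D : TangentSpace 𝓘(ℝ, E) p →L[ℝ] E := mfderiv 𝓘(ℝ, E) 𝓘(ℝ, E) φ p
  inChart g p (φ p) (localCurvature (inChart g p) (φ p) (D x) (D y) (D z)) (D w)

/-- `π₁(z, u, v, w) = g(z, w) g(u, v) - g(z, v) g(u, w)`. -/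
def piOne (g : FormField E M) (p : M) (z u v w : TangentSpace 𝓘(ℝ, E) p) : ℝ :=
  g p z w * g p u v - g p z v * g p u w

/-- The sectional curvature `K(α) = R(x, y, y, x) / π₁(x, y, y, x)`, with `{x, y}` a basis of `α`;
meaningful for nondegenerate planes. -/
def sectionalCurvature (g : FormField E M) (p : M) (α : Plane (TangentSpace 𝓘(ℝ, E) p)) : ℝ :=
  let x : TangentSpace 𝓘(ℝ, E) p := α.basis 0
  let y : TangentSpace 𝓘(ℝ, E) p := α.basis 1
  curvature g p x y y x / piOne g p x y y x

/-- The open set `U` is conformally flat: around each of its points some conformally related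
metric `e^{2σ} g` with `σ` smooth is flat, i.e. has vanishing curvature tensor. -/
def IsConformallyFlatOn (g : FormField E M) (U : Set M) : Prop :=
  ∀ p ∈ U, ∃ V : Set M, IsOpen V ∧ p ∈ V ∧ V ⊆ U ∧ ∃ σ : M → ℝ,
    ContMDiffOn 𝓘(ℝ, E) 𝓘(ℝ, ℝ) ∞ σ V ∧
    ∀ q ∈ V, ∀ x y z w : TangentSpace 𝓘(ℝ, E) q,
      curvature (fun m => Real.exp (2 * σ m) • g m) q x y z w = 0

/-- No nonempty open subset is conformally flat. -/
def NowhereConformallyFlat (g : FormField E M) : Prop :=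
  ∀ U : Set M, IsOpen U → U.Nonempty → ¬ IsConformallyFlatOn g U

variable {E' : Type*} [NormedAddCommGroup E'] [NormedSpace ℝ E']
  {M' : Type*} [TopologicalSpace M'] [ChartedSpace E' M']

/-- The image `f_* α` of a plane under the differential of a diffeomorphism. -/
def pushPlane [IsManifold 𝓘(ℝ, E) ∞ M] [IsManifold 𝓘(ℝ, E') ∞ M']
    (f : M ≃ₘ⟮𝓘(ℝ, E), 𝓘(ℝ, E')⟯ M') (p : M)
    (α : Plane (TangentSpace 𝓘(ℝ, E) p)) : Plane (TangentSpace 𝓘(ℝ, E') (f p)) :=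
  α.map (f.mfderivToContinuousLinearEquiv (by simp) p).toLinearEquiv

/-- The condition `K'(f_* α) / K(α) → 1` as `α → α₀`, where `α` runs through the nondegenerate
planes of the tangent space at `p` whose images are nondegenerate and for which the quotient is
defined, i.e. `K(α) ≠ 0`. -/
def CurvatureRatioTendsToOne [IsManifold 𝓘(ℝ, E) ∞ M] [IsManifold 𝓘(ℝ, E') ∞ M']
    (g : FormField E M) (g' : FormField E' M') (f : M ≃ₘ⟮𝓘(ℝ, E), 𝓘(ℝ, E')⟯ M')
    (p : M) (α₀ : Plane (TangentSpace 𝓘(ℝ, E) p)) : Prop :=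
  Filter.Tendsto
    (fun α => sectionalCurvature g' (f p) (pushPlane f p α) / sectionalCurvature g p α)
    (𝓝[{α | α.IsNondegenerate (formAt g p) ∧
        (pushPlane f p α).IsNondegenerate (formAt g' (f p)) ∧
        sectionalCurvature g p α ≠ 0}] α₀)
    (𝓝 1)

/-- `f` is an isometry: it pulls the metric of the target back to the metric of the source. -/
def IsIsometry (g : FormField E M) (g' : FormField E' M')
    (f : M ≃ₘ⟮𝓘(ℝ, E), 𝓘(ℝ, E')⟯ M') : Prop :=
  ∀ (p : M) (x y : TangentSpace 𝓘(ℝ, E) p),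
    g' (f p) (mfderiv 𝓘(ℝ, E) 𝓘(ℝ, E') f p x) (mfderiv 𝓘(ℝ, E) 𝓘(ℝ, E') f p y) = g p x y

end Manifold

end PseudoRiem

end

/-! Write h for the pullback of the target metric, and call a plane isotropic if g vanishes on it.
Suppose that g(R(x,y)y,x) ≠ 0 for a basis {x,y} of an isotropic plane. Along a pencil span{x+tu,
y+tv} the curvature numerators converge, so the hypothesis on sectional curvatures becomes a
statement about Gram determinants: their quotient, h over g, tends to h(R'(x,y)y,x)/g(R(x,y)y,x).
The Gram determinant of g is of order t² for generic u, v. Comparing powers of t shows that the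
plane is h-isotropic and that h(x,·) = c g(x,·), h(y,·) = c g(y,·), where c² is that limit
(`exists_eq_smul_of_gram_ratio`). Nonvanishing of the curvature is an open condition, so nearby null
vectors are eigenvectors as well, which forces h = c g on the whole tangent space
(`exists_eq_smul_of_null_eigen`).

The same holds at neighbouring points, so h = l g near the point with a smooth function l. On
isotropic planes the (0,4) curvature of l g is l times that of g, whereas the limit gives the factor
l². Hence l = 1 (`IsMetricOn.eq_of_proportional`): h = g wherever some isotropic plane has nonzero
curvature.

It remains to see that such points are dense. If the curvature vanishes on all isotropic planes, its
Weyl part vanishes and R is the Kulkarni–Nomizu product of g with the Schouten endomorphism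
(`IsCurvatureLike.eq_kulkarniNomizu`); this uses that every hyperplane x^⊥ contains vectors of both
signs, a consequence of the signature. If this happens on an open set, then in dimension at least
four the second Bianchi identity kills the Cotton tensor (`IsMetricOn.cotton`). The linear system
for triples (τ, m, ρ) is then flat (`IsMetricOn.prolongation_flat`), and a solution, given by a
Frobenius theorem (`exists_parallel`), makes τ⁻² g flat. An open set on which h differs from g
everywhere would therefore be conformally flat, which is excluded. So h = g on a dense set, and
everywhere by continuity. -/

noncomputable section

set_option maxSynthPendingDepth 3
set_option linter.unusedSectionVars false
set_option linter.unusedSimpArgs false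

namespace PseudoRiem

/-! ### Differentiation under the integral sign over [0,1]. -/

section ParametricIntegral

open scoped Interval

open MeasureTheory Set

variable {E Y : Type*} [NormedAddCommGroup E] [NormedSpace ℝ E] [FiniteDimensional ℝ E]
  [NormedAddCommGroup Y] [NormedSpace ℝ Y]

/-- Compactness of a closed ball times [0,1] gives the locally uniform bound that dominated
convergence needs. -/
lemma exists_nhds_bound {U : Set E} (hU : IsOpen U) {Ψ : E × ℝ → Y}
    (hΨ : ContinuousOn Ψ (U ×ˢ Icc 0 1)) {x : E} (hx : x ∈ U) :
    ∃ s ∈ 𝓝 x, s ⊆ U ∧ ∃ C, ∀ z ∈ s, ∀ t ∈ Icc (0 : ℝ) 1, ‖Ψ (z, t)‖ ≤ C := by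
  have : ProperSpace E := FiniteDimensional.proper ℝ E
  obtain ⟨ε, hε, hsub⟩ := Metric.nhds_basis_closedBall.mem_iff.1 (hU.mem_nhds hx)
  obtain ⟨C, hC⟩ := ((isCompact_closedBall x ε).prod isCompact_Icc).exists_bound_of_continuousOn
    (hΨ.mono (prod_mono_left hsub))
  exact ⟨_, Metric.closedBall_mem_nhds x hε, hsub, C, fun z hz t ht => hC (z, t) ⟨hz, ht⟩⟩

lemma continuousOn_slice {U : Set E} {Ψ : E × ℝ → Y}
    (hΨ : ContinuousOn Ψ (U ×ˢ Icc 0 1)) {x : E} (hx : x ∈ U) :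
    ContinuousOn (fun t => Ψ (x, t)) (Icc 0 1) :=
  hΨ.comp (by fun_prop) fun _ ht => ⟨hx, ht⟩

lemma uIoc_subset_Icc : Ι (0 : ℝ) 1 ⊆ Icc 0 1 := by
  rw [uIoc_of_le zero_le_one]; exact Ioc_subset_Icc_self

lemma aestronglyMeasurable_slice {U : Set E} {Ψ : E × ℝ → Y}
    (hΨ : ContinuousOn Ψ (U ×ˢ Icc 0 1)) {x : E} (hx : x ∈ U) :
    AEStronglyMeasurable (fun t => Ψ (x, t)) (volume.restrict (Ι (0 : ℝ) 1)) :=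
  ((continuousOn_slice hΨ hx).mono uIoc_subset_Icc).aestronglyMeasurable measurableSet_uIoc

lemma intervalIntegrable_slice {U : Set E} {Ψ : E × ℝ → Y}
    (hΨ : ContinuousOn Ψ (U ×ˢ Icc 0 1)) {x : E} (hx : x ∈ U) :
    IntervalIntegrable (fun t => Ψ (x, t)) volume 0 1 :=
  ContinuousOn.intervalIntegrable (by
    rw [uIcc_of_le zero_le_one]; exact continuousOn_slice hΨ hx)

lemma continuousOn_intervalIntegral {U : Set E} (hU : IsOpen U) {Ψ : E × ℝ → Y}
    (hΨ : ContinuousOn Ψ (U ×ˢ Icc 0 1)) :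
    ContinuousOn (fun x => ∫ t in (0 : ℝ)..1, Ψ (x, t)) U := by
  intro x hx
  refine ContinuousAt.continuousWithinAt ?_
  obtain ⟨s, hs, -, C, hC⟩ := exists_nhds_bound hU hΨ hx
  refine intervalIntegral.continuousAt_of_dominated_interval (bound := fun _ => C) ?_ ?_ (by simp) ?_
  · filter_upwards [hU.mem_nhds hx] with z hz using aestronglyMeasurable_slice hΨ hz
  · filter_upwards [hs] with z hz
    exact Filter.Eventually.of_forall fun t ht => hC z hz t (uIoc_subset_Icc ht)
  · refine Filter.Eventually.of_forall fun t ht => ?_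
    have : ContinuousOn (fun z => Ψ (z, t)) U :=
      hΨ.comp (by fun_prop) fun _ hz => ⟨hz, uIoc_subset_Icc ht⟩
    exact this.continuousAt (hU.mem_nhds hx)

lemma hasFDerivAt_intervalIntegral {U : Set E} (hU : IsOpen U) {Φ : E × ℝ → Y}
    {Φ' : E × ℝ → E →L[ℝ] Y} (hΦ : ContinuousOn Φ (U ×ˢ Icc 0 1))
    (hΦ' : ContinuousOn Φ' (U ×ˢ Icc 0 1))
    (hd : ∀ t ∈ Icc (0 : ℝ) 1, ∀ x ∈ U, HasFDerivAt (fun z => Φ (z, t)) (Φ' (x, t)) x)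
    {x : E} (hx : x ∈ U) :
    HasFDerivAt (fun z => ∫ t in (0 : ℝ)..1, Φ (z, t)) (∫ t in (0 : ℝ)..1, Φ' (x, t)) x := by
  obtain ⟨s, hs, hsU, C, hC⟩ := exists_nhds_bound hU hΦ' hx
  refine intervalIntegral.hasFDerivAt_integral_of_dominated_of_fderiv_le (bound := fun _ => C)
    (F' := fun z t => Φ' (z, t)) hs ?_ (intervalIntegrable_slice hΦ hx)
    (aestronglyMeasurable_slice hΦ' hx) ?_ (by simp) ?_
  · filter_upwards [hU.mem_nhds hx] with z hz using aestronglyMeasurable_slice hΦ hz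
  · exact Filter.Eventually.of_forall fun t ht z hz => hC z hz t (uIoc_subset_Icc ht)
  · exact Filter.Eventually.of_forall fun t ht z hz => hd t (uIoc_subset_Icc ht) z (hsU hz)

end ParametricIntegral

/-! ### Radial primitives of one-forms. -/

section Radial

open MeasureTheory Set Metric

variable {E Y : Type*} [NormedAddCommGroup E] [NormedSpace ℝ E] [FiniteDimensional ℝ E]
  [NormedAddCommGroup Y] [NormedSpace ℝ Y] [CompleteSpace Y]

lemma smul_mem_ball_zero {r : ℝ} {x : E} (hx : x ∈ ball (0 : E) r) {t : ℝ}
    (ht : t ∈ Icc (0 : ℝ) 1) : t • x ∈ ball (0 : E) r := by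
  rw [mem_ball_zero_iff] at *
  rw [norm_smul, Real.norm_eq_abs, abs_of_nonneg ht.1]
  nlinarith [norm_nonneg x, ht.2]

/-- The radial primitive of a 1-form `η` is differentiable, and its derivative differs from `η` by
the radial integral of the exterior derivative of `η`. -/
lemma hasFDerivAt_radial {r : ℝ} {η : E → E →L[ℝ] Y} {η' : E → E →L[ℝ] E →L[ℝ] Y}
    (hη : ∀ x ∈ ball (0 : E) r, HasFDerivAt η (η' x) x) (hη' : ContinuousOn η' (ball 0 r))
    {x : E} (hx : x ∈ ball (0 : E) r) :
    HasFDerivAt (fun z => ∫ t in (0 : ℝ)..1, η (t • z) z)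
      (η x + ∫ t in (0 : ℝ)..1, t • ((η' (t • x)).flip x - η' (t • x) x)) x := by
  have hηc : ContinuousOn η (ball 0 r) := fun z hz => (hη z hz).continuousAt.continuousWithinAt
  have hm : MapsTo (fun p : E × ℝ => p.2 • p.1) (ball (0 : E) r ×ˢ Icc 0 1) (ball 0 r) :=
    fun p hp => smul_mem_ball_zero hp.1 hp.2
  have hmc : ContinuousOn (fun p : E × ℝ => p.2 • p.1) (ball (0 : E) r ×ˢ Icc 0 1) := by fun_prop
  have c1 : ContinuousOn (fun p : E × ℝ => η (p.2 • p.1)) (ball (0 : E) r ×ˢ Icc 0 1) :=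
    hηc.comp hmc hm
  have c2 : ContinuousOn (fun p : E × ℝ => η' (p.2 • p.1)) (ball (0 : E) r ×ˢ Icc 0 1) :=
    hη'.comp hmc hm
  have c3 : ContinuousOn (fun p : E × ℝ => (η' (p.2 • p.1)).flip p.1)
      (ball (0 : E) r ×ˢ Icc 0 1) := by
    have : ContinuousOn (fun p : E × ℝ => (η' (p.2 • p.1)).flip) (ball (0 : E) r ×ˢ Icc 0 1) :=
      (ContinuousLinearMap.flipₗᵢ ℝ E E Y).continuous.comp_continuousOn c2
    exact this.clm_apply continuousOn_fst
  have c4 : ContinuousOn (fun p : E × ℝ => η' (p.2 • p.1) p.1)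
      (ball (0 : E) r ×ˢ Icc 0 1) := c2.clm_apply continuousOn_fst
  have c5 : ContinuousOn (fun p : E × ℝ => p.2 • ((η' (p.2 • p.1)).flip p.1 - η' (p.2 • p.1) p.1))
      (ball (0 : E) r ×ˢ Icc 0 1) := continuousOn_snd.smul (c3.sub c4)
  have c6 : ContinuousOn (fun p : E × ℝ => η (p.2 • p.1) + p.2 • η' (p.2 • p.1) p.1)
      (ball (0 : E) r ×ˢ Icc 0 1) := c1.add (continuousOn_snd.smul c4)
  have key := hasFDerivAt_intervalIntegral isOpen_ball (U := ball (0 : E) r)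
    (Φ := fun p : E × ℝ => η (p.2 • p.1) p.1)
    (Φ' := fun p => η (p.2 • p.1) + p.2 • (η' (p.2 • p.1)).flip p.1)
    (c1.clm_apply continuousOn_fst) (c1.add (continuousOn_snd.smul c3)) (by
      intro t ht z hz
      have h1 : HasFDerivAt (fun z : E => t • z) (t • ContinuousLinearMap.id ℝ E) z :=
        (hasFDerivAt_id z).const_smul t
      have h2 := ((hη _ (smul_mem_ball_zero hz ht)).comp z h1).clm_apply (hasFDerivAt_id z)
      exact h2.congr_fderiv (ContinuousLinearMap.ext fun h => by simp)) hx
  convert key using 1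
  -- The function t ↦ t η(tx) runs from 0 to η(x). Writing η(x) as the integral of its derivative
  -- leaves exactly the antisymmetric part of η' under the integral.
  have ftc : ∫ t in (0 : ℝ)..1, (η (t • x) + t • η' (t • x) x) = η x := by
    have := intervalIntegral.integral_eq_sub_of_hasDerivAt (a := (0:ℝ)) (b := 1)
      (f := fun t : ℝ => t • η (t • x)) (f' := fun t => η (t • x) + t • η' (t • x) x) (by
        intro t ht
        rw [uIcc_of_le zero_le_one] at ht
        have h1 : HasDerivAt (fun t : ℝ => t • x) x t := by
          simpa using (hasDerivAt_id t).smul_const x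
        have h2 := (hη _ (smul_mem_ball_zero hx ht)).comp_hasDerivAt t h1
        have h3 := (hasDerivAt_id t).smul h2
        refine h3.congr_deriv ?_
        simp [add_comm]) (intervalIntegrable_slice c6 hx)
    simpa using this
  rw [← ftc, ← intervalIntegral.integral_add (intervalIntegrable_slice c6 hx)
    (intervalIntegrable_slice c5 hx)]
  refine intervalIntegral.integral_congr fun t _ => ?_
  dsimp only
  module

/-- Keeps the Picard iterates continuously differentiable, so that `hasFDerivAt_radial` applies
again at the next step. -/
lemma continuousOn_radial_remainder {r : ℝ} {η' : E → E →L[ℝ] E →L[ℝ] Y}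
    (hη' : ContinuousOn η' (ball 0 r)) :
    ContinuousOn (fun x => ∫ t in (0 : ℝ)..1, t • ((η' (t • x)).flip x - η' (t • x) x))
      (ball 0 r) := by
  have hm : MapsTo (fun p : E × ℝ => p.2 • p.1) (ball (0 : E) r ×ˢ Icc 0 1) (ball 0 r) :=
    fun p hp => smul_mem_ball_zero hp.1 hp.2
  have hmc : ContinuousOn (fun p : E × ℝ => p.2 • p.1) (ball (0 : E) r ×ˢ Icc 0 1) := by fun_prop
  have c2 : ContinuousOn (fun p : E × ℝ => η' (p.2 • p.1)) (ball (0 : E) r ×ˢ Icc 0 1) :=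
    hη'.comp hmc hm
  have c3 : ContinuousOn (fun p : E × ℝ => (η' (p.2 • p.1)).flip p.1)
      (ball (0 : E) r ×ˢ Icc 0 1) := by
    have : ContinuousOn (fun p : E × ℝ => (η' (p.2 • p.1)).flip) (ball (0 : E) r ×ˢ Icc 0 1) :=
      (ContinuousLinearMap.flipₗᵢ ℝ E E Y).continuous.comp_continuousOn c2
    exact this.clm_apply continuousOn_fst
  exact continuousOn_intervalIntegral isOpen_ball
    (Ψ := fun p : E × ℝ => p.2 • ((η' (p.2 • p.1)).flip p.1 - η' (p.2 • p.1) p.1))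
    (continuousOn_snd.smul (c3.sub (c2.clm_apply continuousOn_fst)))

end Radial

/-! ### Frobenius theorem for flat linear systems, by Picard iteration along rays. -/

section FlatSystem

open MeasureTheory Set Metric Filter

variable {E X : Type*} [NormedAddCommGroup E] [NormedSpace ℝ E] [FiniteDimensional ℝ E]
  [NormedAddCommGroup X] [NormedSpace ℝ X] [CompleteSpace X]

/-- Exchange of arguments, as a continuous linear map. -/
def flipCLM (E X : Type*) [NormedAddCommGroup E] [NormedSpace ℝ E] [NormedAddCommGroup X]
    [NormedSpace ℝ X] : (E →L[ℝ] X →L[ℝ] X) →L[ℝ] (X →L[ℝ] E →L[ℝ] X) :=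
  (ContinuousLinearMap.flipₗᵢ ℝ E X X).toContinuousLinearEquiv.toContinuousLinearMap

lemma flipCLM_apply (B : E →L[ℝ] X →L[ℝ] X) : flipCLM E X B = B.flip := rfl

/-- The 1-form `h ↦ A(h) F` is differentiable, with the expected derivative. -/
lemma hasFDerivAt_flip_apply {A : E → E →L[ℝ] X →L[ℝ] X} {A' : E →L[ℝ] E →L[ℝ] X →L[ℝ] X}
    {F : E → X} {F' : E →L[ℝ] X} {x : E} (hA : HasFDerivAt A A' x) (hF : HasFDerivAt F F' x) :
    HasFDerivAt (fun z => (A z).flip (F z)) ((A x).flip.comp F' +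
      (((flipCLM E X).comp A').flip (F x))) x := by
  have h : HasFDerivAt (fun z => (A z).flip) ((flipCLM E X).comp A') x :=
    (flipCLM E X).hasFDerivAt.comp x hA
  exact h.clm_apply hF

/-- One step of the Picard iteration along rays for the system `dF = A F`. -/
lemma picard_step {r C : ℝ} (hC : 0 ≤ C) (hCr : C * r ≤ 1 / 8)
    {A : E → E →L[ℝ] X →L[ℝ] X} {A' : E → E →L[ℝ] E →L[ℝ] X →L[ℝ] X}
    (hA : ∀ x ∈ ball (0 : E) r, HasFDerivAt A (A' x) x) (hA' : ContinuousOn A' (ball 0 r))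
    (hAC : ∀ x ∈ ball (0 : E) r, ‖A x‖ ≤ C)
    (hflat : ∀ x ∈ ball (0 : E) r, ∀ u v w,
      A' x u v w + A x v (A x u w) = A' x v u w + A x u (A x v w)) (F₀ : X)
    {F : E → X} {F' : E → E →L[ℝ] X}
    (hF : ∀ x ∈ ball (0 : E) r, HasFDerivAt F (F' x) x) (hF' : ContinuousOn F' (ball 0 r))
    {N : ℝ} (hN : ∀ x ∈ ball (0 : E) r, ‖F' x - (A x).flip (F x)‖ ≤ N) :
    ∃ G' : E → E →L[ℝ] X,
      (∀ x ∈ ball (0 : E) r, HasFDerivAt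
        (fun x => F₀ + ∫ t in (0 : ℝ)..1, A (t • x) x (F (t • x))) (G' x) x) ∧
      ContinuousOn G' (ball 0 r) ∧
      ∀ x ∈ ball (0 : E) r, ‖G' x - (A x).flip (F x)‖ ≤ N / 4 := by
  set η : E → E →L[ℝ] X := fun x => (A x).flip (F x) with hηdef
  set η' : E → E →L[ℝ] E →L[ℝ] X := fun x => (A x).flip.comp (F' x) + (((flipCLM E X).comp (A' x)).flip (F x))
    with hη'def
  have hη : ∀ x ∈ ball (0 : E) r, HasFDerivAt η (η' x) x := fun x hx =>
    hasFDerivAt_flip_apply (hA x hx) (hF x hx)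
  have hAc : ContinuousOn A (ball 0 r) := fun z hz => (hA z hz).continuousAt.continuousWithinAt
  have hFc : ContinuousOn F (ball 0 r) := fun z hz => (hF z hz).continuousAt.continuousWithinAt
  have hη'c : ContinuousOn η' (ball 0 r) := by
    have h1 : ContinuousOn (fun x => (A x).flip) (ball 0 r) :=
      (ContinuousLinearMap.flipₗᵢ ℝ E X X).continuous.comp_continuousOn hAc
    have h2 : ContinuousOn (fun x => (flipCLM E X).comp (A' x)) (ball 0 r) :=
      continuousOn_const.clm_comp hA'
    have h3 : ContinuousOn (fun x => ((flipCLM E X).comp (A' x)).flip) (ball 0 r) :=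
      (ContinuousLinearMap.flipₗᵢ ℝ E X (E →L[ℝ] X)).continuous.comp_continuousOn h2
    exact (h1.clm_comp hF').add (h3.clm_apply hFc)
  refine ⟨fun x => η x + ∫ t in (0 : ℝ)..1, t • ((η' (t • x)).flip x - η' (t • x) x),
    fun x hx => ?_, ?_, fun x hx => ?_⟩
  · exact (hasFDerivAt_radial hη hη'c hx).const_add F₀
  · exact ContinuousOn.add (fun z hz => (hη z hz).continuousAt.continuousWithinAt)
      (continuousOn_radial_remainder hη'c)
  · have hr : ‖x‖ ≤ r := (mem_ball_zero_iff.1 hx).le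
    have hN0 : 0 ≤ N := (norm_nonneg _).trans (hN x hx)
    rw [add_sub_cancel_left]
    refine (intervalIntegral.norm_integral_le_of_norm_le_const (C := N / 4) ?_).trans (by simp)
    intro t ht
    have ht' := uIoc_subset_Icc ht
    have hy := smul_mem_ball_zero hx ht'
    set y := t • x with hydef
    rw [norm_smul, Real.norm_eq_abs, abs_of_nonneg ht'.1]
    refine (mul_le_of_le_one_left (norm_nonneg _) ht'.2).trans ?_
    refine ContinuousLinearMap.opNorm_le_bound _ (by positivity) fun h => ?_
    -- Flatness turns the antisymmetrized derivative of A into a commutator of values of A, so the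
    -- exterior derivative of η depends on F only through the defect F' - A F.
    have e : ((η' y).flip x - η' y x) h =
        A y x ((F' y - (A y).flip (F y)) h) - A y h ((F' y - (A y).flip (F y)) x) := by
      have := hflat y hy h x (F y)
      simp only [η', sub_apply, add_apply, ContinuousLinearMap.flip_apply,
        ContinuousLinearMap.comp_apply, map_sub, flipCLM_apply]
      have h2 : A' y h x (F y) = A' y x h (F y) + A y h (A y x (F y)) - A y x (A y h (F y)) := by
        rw [← this]; abel
      rw [h2]
      abel
    rw [e]
    have b : ∀ u v : E, ‖A y u ((F' y - (A y).flip (F y)) v)‖ ≤ C * ‖u‖ * (N * ‖v‖) := fun u v => by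
      refine ((A y u).le_opNorm _).trans ?_
      gcongr
      · exact ((A y).le_opNorm u).trans (by gcongr; exact hAC y hy)
      · exact ((F' y - (A y).flip (F y)).le_opNorm v).trans (by gcongr; exact hN y hy)
    refine (norm_sub_le _ _).trans ((add_le_add (b x h) (b h x)).trans ?_)
    -- Each of the two terms is at most (1/8) N ‖h‖; together they give the factor 1/4.
    have : C * ‖x‖ ≤ 1 / 8 := (mul_le_mul_of_nonneg_left hr hC).trans hCr
    have h0 : 0 ≤ N * ‖h‖ := by positivity
    nlinarith [mul_le_mul_of_nonneg_right this h0]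

/-- Integrating along rays alone only solves the radial part of the system. The solution in all
directions comes from the defects of the iterates, which tend to zero geometrically by
`picard_step`. -/
lemma exists_parallel_ball {r C : ℝ} (hr0 : 0 < r) (hC : 0 ≤ C) (hCr : C * r ≤ 1 / 8)
    {A : E → E →L[ℝ] X →L[ℝ] X} {A' : E → E →L[ℝ] E →L[ℝ] X →L[ℝ] X}
    (hA : ∀ x ∈ ball (0 : E) r, HasFDerivAt A (A' x) x) (hA' : ContinuousOn A' (ball 0 r))
    (hAC : ∀ x ∈ ball (0 : E) r, ‖A x‖ ≤ C)
    (hflat : ∀ x ∈ ball (0 : E) r, ∀ u v w,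
      A' x u v w + A x v (A x u w) = A' x v u w + A x u (A x v w)) (F₀ : X) :
    ∃ F : E → X, F 0 = F₀ ∧ ∀ x ∈ ball (0 : E) r, HasFDerivAt F ((A x).flip (F x)) x := by
  have hAc : ContinuousOn A (ball 0 r) := fun z hz => (hA z hz).continuousAt.continuousWithinAt
  let step : (E → X) → (E → X) := fun F x => F₀ + ∫ t in (0 : ℝ)..1, A (t • x) x (F (t • x))
  let f : ℕ → E → X := fun k => step^[k] fun _ => F₀
  have fsucc : ∀ k, f (k + 1) = step (f k) := fun k => Function.iterate_succ_apply' _ _ _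
  have hflip : ∀ x ∈ ball (0 : E) r, ∀ w : X, ‖(A x).flip w‖ ≤ C * ‖w‖ := fun x hx w => by
    refine ((A x).flip.le_opNorm w).trans ?_
    rw [ContinuousLinearMap.opNorm_flip]
    gcongr
    exact hAC x hx
  have hstep : ∀ k (K : ℝ), 0 ≤ K → ContinuousOn (f k) (ball 0 r) →
      ContinuousOn (f (k + 1)) (ball 0 r) →
      (∀ x ∈ ball (0 : E) r, ‖f (k + 1) x - f k x‖ ≤ K) →
      ∀ x ∈ ball (0 : E) r, ‖f (k + 2) x - f (k + 1) x‖ ≤ K / 4 := by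
    intro k K hK hc0 hc1 hb x hx
    have hm : MapsTo (fun t : ℝ => t • x) (Icc 0 1) (ball (0 : E) r) :=
      fun t ht => smul_mem_ball_zero hx ht
    have hmc : ContinuousOn (fun t : ℝ => t • x) (Icc 0 1) := by fun_prop
    have hi : ∀ g : E → X, ContinuousOn g (ball 0 r) →
        IntervalIntegrable (fun t : ℝ => A (t • x) x (g (t • x))) volume 0 1 := fun g hg => by
      apply ContinuousOn.intervalIntegrable
      rw [uIcc_of_le zero_le_one]
      exact ((hAc.comp hmc hm).clm_apply continuousOn_const).clm_apply (hg.comp hmc hm)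
    rw [show f (k + 2) = step (f (k + 1)) from fsucc _, fsucc k]
    rw [fsucc k] at hc1
    change ‖F₀ + (∫ t in (0 : ℝ)..1, A (t • x) x (step (f k) (t • x))) -
      (F₀ + ∫ t in (0 : ℝ)..1, A (t • x) x (f k (t • x)))‖ ≤ _
    rw [add_sub_add_left_eq_sub, ← intervalIntegral.integral_sub (hi _ hc1) (hi _ hc0)]
    refine (intervalIntegral.norm_integral_le_of_norm_le_const (C := K / 4) ?_).trans (by simp)
    intro t ht
    have hy := smul_mem_ball_zero hx (uIoc_subset_Icc ht)
    rw [← map_sub]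
    have h1 : ‖A (t • x) x‖ ≤ 1 / 8 := by
      refine ((A (t • x)).le_opNorm x).trans (le_trans ?_ hCr)
      gcongr
      · exact hAC _ hy
      · exact (mem_ball_zero_iff.1 hx).le
    refine ((A (t • x) x).le_opNorm _).trans ?_
    have h2 := hb _ hy
    rw [fsucc k] at h2
    calc _ ≤ 1 / 8 * K := by gcongr
      _ ≤ K / 4 := by linarith
  set M := ‖F₀‖
  -- The defect at k+1 is at most a quarter of the one at k plus C times the increment, that is C M
  -- 2⁻ᵏ + C M 4⁻ᵏ ≤ 4 C M 2⁻⁽ᵏ⁺¹⁾; this dictates the constant 4 and the rate 1/2.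
  have main : ∀ k, ∃ f' : E → E →L[ℝ] X, (∀ x ∈ ball (0 : E) r, HasFDerivAt (f k) (f' x) x) ∧
      ContinuousOn f' (ball 0 r) ∧
      (∀ x ∈ ball (0 : E) r, ‖f' x - (A x).flip (f k x)‖ ≤ 4 * C * M * (1 / 2) ^ k) ∧
      ContinuousOn (f (k + 1)) (ball 0 r) ∧
      (∀ x ∈ ball (0 : E) r, ‖f (k + 1) x - f k x‖ ≤ M * (1 / 4) ^ k) := by
    intro k
    induction k with
    | zero =>
      have h0 : ∀ x ∈ ball (0 : E) r, HasFDerivAt (f 0) (0 : E →L[ℝ] X) x := fun x _ =>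
        hasFDerivAt_const F₀ x
      have hb : ∀ x ∈ ball (0 : E) r, ‖(0 : E →L[ℝ] X) - (A x).flip (f 0 x)‖ ≤ 4 * C * M := by
        intro x hx
        rw [zero_sub, norm_neg]
        refine (hflip x hx _).trans ?_
        have : 0 ≤ C * M := by positivity
        change C * M ≤ _
        linarith
      obtain ⟨G', hG, -, -⟩ := picard_step hC hCr hA hA' hAC hflat F₀ h0 continuousOn_const hb
      refine ⟨fun _ => 0, h0, continuousOn_const, by simpa using hb, ?_, fun x hx => ?_⟩
      · rw [fsucc]
        exact fun z hz => (hG z hz).continuousAt.continuousWithinAt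
      · rw [fsucc]
        change ‖F₀ + (∫ t in (0 : ℝ)..1, A (t • x) x F₀) - F₀‖ ≤ _
        rw [add_sub_cancel_left]
        refine (intervalIntegral.norm_integral_le_of_norm_le_const (C := M) ?_).trans (by simp)
        intro t ht
        have hy := smul_mem_ball_zero hx (uIoc_subset_Icc ht)
        have h1 : ‖A (t • x) x‖ ≤ 1 / 8 := by
          refine ((A (t • x)).le_opNorm x).trans (le_trans ?_ hCr)
          gcongr
          · exact hAC _ hy
          · exact (mem_ball_zero_iff.1 hx).le
        refine ((A (t • x) x).le_opNorm _).trans ?_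
        have : 0 ≤ M := norm_nonneg _
        calc _ ≤ 1 / 8 * M := by gcongr
          _ ≤ M := by linarith
    | succ k ih =>
      obtain ⟨f', hf, hf'c, hN, hc, hb⟩ := ih
      obtain ⟨G', hG, hG'c, hGN⟩ := picard_step hC hCr hA hA' hAC hflat F₀ hf hf'c hN
      have hG1 : ∀ x ∈ ball (0 : E) r, HasFDerivAt (f (k + 1)) (G' x) x := by
        rw [fsucc]; exact hG
      have hGb : ∀ x ∈ ball (0 : E) r,
          ‖G' x - (A x).flip (f (k + 1) x)‖ ≤ 4 * C * M * (1 / 2) ^ (k + 1) := by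
        intro x hx
        have e : G' x - (A x).flip (f (k + 1) x) =
            (G' x - (A x).flip (f k x)) - (A x).flip (f (k + 1) x - f k x) := by
          rw [map_sub]; abel
        rw [e]
        refine (norm_sub_le _ _).trans ((add_le_add (hGN x hx) ((hflip x hx _).trans
          (mul_le_mul_of_nonneg_left (hb x hx) hC))).trans ?_)
        have h4 : ((1 : ℝ) / 4) ^ k ≤ (1 / 2) ^ k := by gcongr; norm_num
        have h0 : 0 ≤ C * M := by positivity
        rw [pow_succ]
        nlinarith [mul_le_mul_of_nonneg_left h4 h0]
      obtain ⟨H', hH, -, -⟩ := picard_step hC hCr hA hA' hAC hflat F₀ hG1 hG'c hGb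
      have hc2 : ContinuousOn (f (k + 1 + 1)) (ball 0 r) := by
        rw [fsucc]
        exact fun z hz => (hH z hz).continuousAt.continuousWithinAt
      refine ⟨G', hG1, hG'c, hGb, hc2, fun x hx => ?_⟩
      refine (hstep k (M * (1 / 4) ^ k) (by positivity)
        (fun z hz => (hf z hz).continuousAt.continuousWithinAt) hc hb x hx).trans_eq ?_
      rw [pow_succ]; ring
  choose f' hf hf'c hN hc hb using main
  have hb' : ∀ x ∈ ball (0 : E) r, ∀ k, dist (f k x) (f (k + 1) x) ≤ M * (1 / 4) ^ k :=
    fun x hx k => by rw [dist_comm, dist_eq_norm]; exact hb k x hx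
  have hlim : ∀ x ∈ ball (0 : E) r,
      Tendsto (fun k => f k x) atTop (𝓝 (limUnder atTop fun k => f k x)) := fun x hx =>
    CauchySeq.tendsto_limUnder (cauchySeq_of_le_geometric (1 / 4) M (by norm_num) (hb' x hx))
  set F : E → X := fun x => limUnder atTop fun k => f k x
  have hfF : ∀ x ∈ ball (0 : E) r, ∀ k, ‖f k x - F x‖ ≤ 2 * M * (1 / 4) ^ k := fun x hx k => by
    rw [← dist_eq_norm]
    refine (dist_le_of_le_geometric_of_tendsto (1 / 4) M (by norm_num) (hb' x hx)
      (hlim x hx) k).trans ?_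
    have : 0 ≤ M * (1 / 4 : ℝ) ^ k := by positivity
    rw [div_le_iff₀ (by norm_num)]
    linarith
  refine ⟨F, ?_, fun x hx => ?_⟩
  · have h0 : ∀ k, f k 0 = F₀ := by
      intro k
      cases k with
      | zero => rfl
      | succ k => rw [fsucc]; simp [step]
    exact tendsto_nhds_unique (hlim 0 (mem_ball_self hr0)) (by simp only [h0, tendsto_const_nhds])
  -- Defect and distance to the limit both go to zero uniformly, hence the derivatives converge
  -- uniformly to A F.
  · refine hasFDerivAt_of_tendstoUniformlyOn (f := f) (f' := f') (l := atTop) (𝕜 := ℝ) isOpen_ball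
      (g' := fun x => (A x).flip (F x)) ?_ hf hlim hx
    have hz : Tendsto (fun k : ℕ => 4 * C * M * (1 / 2 : ℝ) ^ k + C * (2 * M * (1 / 4) ^ k)) atTop
        (𝓝 0) := by
      have h2 := (tendsto_pow_atTop_nhds_zero_of_lt_one (r := (1 / 2 : ℝ)) (by norm_num)
        (by norm_num)).const_mul (4 * C * M)
      have h4 := ((tendsto_pow_atTop_nhds_zero_of_lt_one (r := (1 / 4 : ℝ)) (by norm_num)
        (by norm_num)).const_mul (2 * M)).const_mul C
      simpa using h2.add h4
    rw [Metric.tendstoUniformlyOn_iff]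
    intro ε hε
    filter_upwards [hz.eventually (gt_mem_nhds hε)] with k hk x hx
    refine lt_of_le_of_lt ?_ hk
    rw [dist_comm, dist_eq_norm]
    have e : f' k x - (A x).flip (F x) =
        (f' k x - (A x).flip (f k x)) + (A x).flip (f k x - F x) := by
      rw [map_sub]; abel
    rw [e]
    exact (norm_add_le _ _).trans (add_le_add (hN k x hx) ((hflip x hx _).trans
      (mul_le_mul_of_nonneg_left (hfF x hx k) hC)))

/-- Frobenius theorem for flat linear systems `dF = A F`. -/
theorem exists_parallel {A : E → E →L[ℝ] X →L[ℝ] X} {O : Set E} (hO : IsOpen O)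
    (hA : ContDiffOn ℝ ∞ A O)
    (hflat : ∀ x ∈ O, ∀ u v w, fderiv ℝ A x u v w + A x v (A x u w) =
      fderiv ℝ A x v u w + A x u (A x v w)) {x₀ : E} (hx₀ : x₀ ∈ O) (F₀ : X) :
    ∃ r > 0, ball x₀ r ⊆ O ∧ ∃ F : E → X, F x₀ = F₀ ∧ ContDiffOn ℝ ∞ F (ball x₀ r) ∧
      ∀ x ∈ ball x₀ r, HasFDerivAt F ((A x).flip (F x)) x := by
  have hc : ContinuousAt A x₀ := hA.continuousOn.continuousAt (hO.mem_nhds hx₀)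
  obtain ⟨r₁, hr₁, hb⟩ := Metric.eventually_nhds_iff_ball.1
    ((hc.norm.eventually (Iio_mem_nhds (lt_add_one ‖A x₀‖))).and (hO.eventually_mem hx₀))
  set C := ‖A x₀‖ + 1
  have hC : 0 < C := by positivity
  set r := min r₁ (1 / (8 * C))
  have hr : 0 < r := by positivity
  have hCr : C * r ≤ 1 / 8 := by
    calc C * r ≤ C * (1 / (8 * C)) := by gcongr; exact min_le_right _ _
      _ = 1 / 8 := by field_simp
  have hsub : ∀ x ∈ ball x₀ r, ‖A x‖ < C ∧ x ∈ O := fun x hx =>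
    hb x (ball_subset_ball (min_le_left _ _) hx)
  have hshift : ∀ x ∈ ball (0 : E) r, x + x₀ ∈ ball x₀ r := fun x hx => by
    simpa [mem_ball, dist_eq_norm] using hx
  have hfd : ContinuousOn (fderiv ℝ A) O :=
    hA.continuousOn_fderiv_of_isOpen hO (by simp)
  obtain ⟨F, hF0, hF⟩ := exists_parallel_ball (A := fun x => A (x + x₀))
    (A' := fun x => fderiv ℝ A (x + x₀)) hr hC.le hCr (fun x hx => by
      have h := ((hA.differentiableOn (by simp)).differentiableAt
        (hO.mem_nhds (hsub _ (hshift x hx)).2)).hasFDerivAt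
      exact (hasFDerivAt_comp_add_right x₀).2 h)
    (hfd.comp (by fun_prop) fun x hx => (hsub _ (hshift x hx)).2)
    (fun x hx => (hsub _ (hshift x hx)).1.le)
    (fun x hx u v w => hflat _ (hsub _ (hshift x hx)).2 u v w) F₀
  have hG : ∀ x ∈ ball x₀ r,
      HasFDerivAt (fun x => F (x - x₀)) ((A x).flip (F (x - x₀))) x := fun x hx => by
    have := hF (x - x₀) (by simpa [mem_ball, dist_eq_norm] using hx)
    rw [sub_add_cancel] at this
    exact (hasFDerivAt_comp_sub x₀).2 this
  have hAO : ContDiffOn ℝ ∞ A (ball x₀ r) := hA.mono fun x hx => (hsub x hx).2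
  refine ⟨r, hr, fun x hx => (hsub x hx).2, fun x => F (x - x₀), by simpa using hF0, ?_, hG⟩
  -- Bootstrap: the derivative of F is A F, so F has one more derivative than is already known.
  rw [contDiffOn_infty]
  intro n
  induction n with
  | zero =>
    exact contDiffOn_zero.2 fun x hx => (hG x hx).continuousAt.continuousWithinAt
  | succ n ih =>
    have : ((n + 1 : ℕ) : WithTop ℕ∞) = (n : WithTop ℕ∞) + 1 := by norm_cast
    rw [this, contDiffOn_succ_iff_fderiv_of_isOpen isOpen_ball]
    refine ⟨fun x hx => (hG x hx).differentiableAt.differentiableWithinAt, by simp, ?_⟩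
    have h1 : ContDiffOn ℝ n (fun x => (A x).flip) (ball x₀ r) :=
      (ContinuousLinearMap.flipₗᵢ ℝ E X X).toContinuousLinearEquiv.contDiff.comp_contDiffOn
        (hAO.of_le (by exact_mod_cast le_top))
    exact (h1.clm_apply ih).congr fun x hx => (hG x hx).fderiv

end FlatSystem

/-! ### Symmetric forms on the null cone of an indefinite form. -/

section NullCone

variable {V : Type*} [AddCommGroup V] [Module ℝ V]

/-- Every hyperplane `x^⊥` contains a positive and a negative vector. -/
def StronglyIndefinite (g : LinearMap.BilinForm ℝ V) : Prop :=
  ∀ x, (∃ a, g x a = 0 ∧ 0 < g a a) ∧ ∃ b, g x b = 0 ∧ g b b < 0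

/-- On the line a + tb the form is a quadratic polynomial in t with two real roots. The two null
vectors have product 2d²/s ≠ 0, so one of them can be rescaled. -/
lemma exists_hyperbolic_pair {g : LinearMap.BilinForm ℝ V} (hg : ∀ x y, g x y = g y x)
    (W : Submodule ℝ V) {a b : V} (ha : a ∈ W) (hb : b ∈ W) (haa : 0 < g a a) (hbb : g b b < 0) :
    ∃ x ∈ W, ∃ z ∈ W, g x x = 0 ∧ g z z = 0 ∧ g x z = 1 := by
  set p := g a a
  set q := g a b
  set s := -g b b
  have hs : 0 < s := by simpa [s] using hbb
  have hD : 0 < q ^ 2 + p * s := by positivity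
  set d := Real.sqrt (q ^ 2 + p * s)
  have hd : d ^ 2 = q ^ 2 + p * s := Real.sq_sqrt hD.le
  have hd0 : 0 < d := Real.sqrt_pos.2 hD
  -- the roots of `p + 2 t q - t² s` are `(q ± d) / s`
  set t₁ := (q + d) / s
  set t₂ := (q - d) / s
  have e1 : t₁ * s = q + d := div_mul_cancel₀ _ hs.ne'
  have e2 : t₂ * s = q - d := div_mul_cancel₀ _ hs.ne'
  have hbb' : g b b = -s := by simp [s]
  have hba : g b a = q := hg b a
  have hroot : ∀ t e : ℝ, t * s = q + e → e ^ 2 = q ^ 2 + p * s →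
      p + 2 * t * q - t ^ 2 * s = 0 := by
    intro t e h1 h2
    have : s * (p + 2 * t * q - t ^ 2 * s) = 0 := by
      linear_combination (2 * q - (t * s) - (q + e)) * h1 - h2
    exact (mul_eq_zero.1 this).resolve_left hs.ne'
  have hx : g (a + t₁ • b) (a + t₁ • b) = 0 := by
    simp only [map_add, map_smul, LinearMap.add_apply, LinearMap.smul_apply, smul_eq_mul, hbb', hba]
    linear_combination hroot t₁ d e1 hd
  have hz : g (a + t₂ • b) (a + t₂ • b) = 0 := by
    simp only [map_add, map_smul, LinearMap.add_apply, LinearMap.smul_apply, smul_eq_mul, hbb', hba]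
    linear_combination hroot t₂ (-d) (by rw [e2]; ring) (by rw [neg_sq, hd])
  have hxz : s * g (a + t₁ • b) (a + t₂ • b) = 2 * d ^ 2 := by
    simp only [map_add, map_smul, LinearMap.add_apply, LinearMap.smul_apply, smul_eq_mul, hbb', hba]
    linear_combination (q - t₂ * s) * e1 + (q - (q + d)) * e2 - hd
  have hne : g (a + t₁ • b) (a + t₂ • b) ≠ 0 := fun h => by
    rw [h, mul_zero] at hxz
    have := pow_pos hd0 2
    linarith
  refine ⟨a + t₁ • b, W.add_mem ha (W.smul_mem _ hb),
    (g (a + t₁ • b) (a + t₂ • b))⁻¹ • (a + t₂ • b),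
    W.smul_mem _ (W.add_mem ha (W.smul_mem _ hb)), hx, ?_, ?_⟩
  · simp only [map_smul, LinearMap.smul_apply, hz, smul_zero]
  · rw [map_smul, smul_eq_mul, inv_mul_cancel₀ hne]

/-- A symmetric form vanishing on the null vectors of an indefinite form `g` is a multiple of `g`. -/
lemma exists_eq_smul_of_null {g B : LinearMap.BilinForm ℝ V} (hg : ∀ x y, g x y = g y x)
    (hB : ∀ x y, B x y = B y x) (W : Submodule ℝ V) {a b : V} (ha : a ∈ W) (hb : b ∈ W)
    (haa : 0 < g a a) (hbb : g b b < 0) (hnull : ∀ w ∈ W, g w w = 0 → B w w = 0) :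
    ∃ c : ℝ, ∀ w ∈ W, ∀ w' ∈ W, B w w' = c * g w w' := by
  obtain ⟨x, hx, z, hz, hxx, hzz, hxz⟩ := exists_hyperbolic_pair hg W ha hb haa hbb
  have key : ∀ x ∈ W, ∀ z ∈ W, g x x = 0 → g z z = 0 → g x z = 1 → ∀ w ∈ W, g x w = 0 → g z w = 0 →
      B x w = 0 ∧ B w w = B x z * g w w := by
    intro x hx z hz hxx hzz hxz w hw hxw hzw
    -- A curve in the null cone through x with velocity w. The value of B on it is a polynomial in
    -- t, and t = 1, -1, 2 suffice to isolate the coefficients of t and t².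
    have hn : ∀ t : ℝ, B (x + t • w - (t ^ 2 * g w w / 2) • z)
        (x + t • w - (t ^ 2 * g w w / 2) • z) = 0 := by
      intro t
      apply hnull _ (W.sub_mem (W.add_mem hx (W.smul_mem _ hw)) (W.smul_mem _ hz))
      simp only [map_add, map_smul, map_sub, LinearMap.add_apply, LinearMap.smul_apply,
        LinearMap.sub_apply, smul_eq_mul, hxx, hzz, hxz, hxw, hzw, hg w x, hg w z, hg z x]
      ring
    have h1 := hn 1
    have h2 := hn (-1)
    have h3 := hn 2
    have h4 := hnull x hx hxx
    have h5 := hnull z hz hzz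
    simp only [map_add, map_smul, map_sub, LinearMap.add_apply, LinearMap.smul_apply,
      LinearMap.sub_apply, smul_eq_mul, h4, h5, hB w x, hB w z, hB z x] at h1 h2 h3
    constructor <;> linarith
  have key2 : ∀ w ∈ W, B w w = B x z * g w w := by
    intro w hw
    set w₀ := w - g w z • x - g w x • z with hw₀
    have hw₀W : w₀ ∈ W := W.sub_mem (W.sub_mem hw (W.smul_mem _ hx)) (W.smul_mem _ hz)
    have hx0 : g x w₀ = 0 := by
      simp only [hw₀, map_sub, map_smul, smul_eq_mul, hxx, hxz, hg w x]; ring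
    have hz0 : g z w₀ = 0 := by
      simp only [hw₀, map_sub, map_smul, smul_eq_mul, hzz, hg z x, hxz, hg w z]; ring
    obtain ⟨k1, k2⟩ := key x hx z hz hxx hzz hxz w₀ hw₀W hx0 hz0
    obtain ⟨k3, -⟩ := key z hz x hx hzz hxx (hg z x ▸ hxz) w₀ hw₀W hz0 hx0
    have e : w = g w z • x + g w x • z + w₀ := by rw [hw₀]; abel
    have h4 := hnull x hx hxx
    have h5 := hnull z hz hzz
    generalize g w z = α at e
    generalize g w x = β at e
    rw [e]
    simp only [map_add, map_smul, LinearMap.add_apply, LinearMap.smul_apply, smul_eq_mul,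
      h4, h5, hB w₀ x, hB w₀ z, hB z x, k1, k2, k3, hxx, hzz, hxz, hg z x, hg w₀ x, hg w₀ z, hx0,
      hz0]
    ring
  refine ⟨B x z, fun w hw w' hw' => ?_⟩
  have h1 := key2 (w + w') (W.add_mem hw hw')
  have h2 := key2 w hw
  have h3 := key2 w' hw'
  simp only [map_add, LinearMap.add_apply, hB w' w, hg w' w] at h1
  linarith

end NullCone

/-! ### Algebraic curvature operators and the Weyl part. -/

section Weyl

variable {V : Type*} [AddCommGroup V] [Module ℝ V]

/-- The algebraic symmetries of a curvature operator with respect to the form `g`. -/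
structure IsCurvatureLike (g : LinearMap.BilinForm ℝ V) (R : V →ₗ[ℝ] V →ₗ[ℝ] V →ₗ[ℝ] V) : Prop where
  antisymm : ∀ x y z, R x y z = -R y x z
  skew : ∀ x y z w, g (R x y z) w = -g (R x y w) z
  bianchi : ∀ x y z, R x y z + R y z x + R z x y = 0

namespace IsCurvatureLike

variable {g : LinearMap.BilinForm ℝ V} {R : V →ₗ[ℝ] V →ₗ[ℝ] V →ₗ[ℝ] V}

lemma form_antisymm (h : IsCurvatureLike g R) (x y z w : V) :
    g (R x y z) w = -g (R y x z) w := by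
  rw [h.antisymm, map_neg, LinearMap.neg_apply]

lemma form_bianchi (h : IsCurvatureLike g R) (x y z w : V) :
    g (R x y z) w + g (R y z x) w + g (R z x y) w = 0 := by
  rw [← LinearMap.add_apply, ← map_add, ← LinearMap.add_apply, ← map_add, h.bianchi, map_zero,
    LinearMap.zero_apply]

/-- The usual octahedron argument: the Bianchi identities for the four cyclic rotations of (x, y, z,
w) combine with the two skew symmetries. -/
lemma pair_symm (h : IsCurvatureLike g R) (x y z w : V) :
    g (R x y z) w = g (R z w x) y := by
  linarith [h.form_bianchi x y z w, h.form_bianchi y z w x, h.form_bianchi z w x y,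
    h.form_bianchi w x y z, h.skew y z x w, h.form_antisymm z x y w, h.skew x z y w,
    h.skew z w y x, h.form_antisymm w y z x, h.skew y w z x, h.skew w x z y, h.skew x y w z]

lemma self_left (h : IsCurvatureLike g R) (x z w : V) : g (R x x z) w = 0 := by
  linarith [h.form_antisymm x x z w]

lemma self_right (h : IsCurvatureLike g R) (x y z : V) : g (R x y z) z = 0 := by
  linarith [h.skew x y z z]

lemma sect_symm (h : IsCurvatureLike g R) (x y : V) : g (R x y y) x = g (R y x x) y := by
  linarith [h.form_antisymm x y y x, h.skew y x y x]

/-- `R(x, y, z, x)` is symmetric in `y, z`. -/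
lemma jacobi_symm (h : IsCurvatureLike g R) (x y z : V) : g (R x y z) x = g (R x z y) x := by
  linarith [h.pair_symm x y z x, h.form_antisymm z x x y, h.skew x z x y]

/-- `R(u, x, x, v)` is symmetric in `u, v`. -/
lemma jacobi_symm' (h : IsCurvatureLike g R) (x u v : V) : g (R u x x) v = g (R v x x) u := by
  linarith [h.pair_symm u x x v, h.form_antisymm x v u x, h.skew v x u x]

/-- A curvature-like operator is determined by its sectional values. -/
lemma eq_zero_of_sect (h : IsCurvatureLike g R) (hnd : ∀ x, (∀ y, g x y = 0) → x = 0)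
    (h0 : ∀ x y, g (R x y y) x = 0) (x y z : V) : R x y z = 0 := by
  -- Polarization in y, then in x, makes the tensor skew in its outer slots too; total skewness
  -- together with the Bianchi identity leaves only zero.
  have h1 : ∀ x y z, g (R x y z) x = 0 := fun x y z => by
    have := h0 x (y + z)
    simp only [map_add, LinearMap.add_apply, h0] at this
    linarith [h.jacobi_symm x y z]
  have h2 : ∀ x y z w, g (R x y z) w = -g (R w y z) x := fun x y z w => by
    have := h1 (x + w) y z
    simp only [map_add, LinearMap.add_apply, h1] at this
    linarith
  refine hnd _ fun w => ?_
  linarith [h.form_bianchi x y z w, h2 x y z w, h.skew w y z x, h.form_antisymm w y x z,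
    h2 y w x z, h.form_antisymm z w x y, h2 y z x w, h.skew w z x y, h.form_antisymm w z y x,
    h2 z w y x, h.form_antisymm x w y z, h2 z x y w, h.skew w x y z, h.pair_symm x y z w,
    h.pair_symm y z x w, h.pair_symm z x y w, h2 x z y w, h.form_antisymm x z y w,
    h.skew w z y x]

/-- If the curvature vanishes on planes tangent to the null cone, it vanishes on all pairs
`R(x, y, z, x)` with `x` null, except for the constant curvature part. -/
lemma exists_null_const (h : IsCurvatureLike g R) (hg : ∀ x y, g x y = g y x)
    (hsi : StronglyIndefinite g)
    (h0 : ∀ x y, g x x = 0 → g x y = 0 → g (R x y y) x = 0)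
    {x z : V} (hxx : g x x = 0) (hzz : g z z = 0) (hxz : g x z = 1) (y : V) :
    g (R x y y) x = g (R x z z) x * g x y ^ 2 := by
  have hzx : g z x = 1 := hg z x ▸ hxz
  have A : ∀ w, g x w = 0 → g z w = 0 → g w w ≠ 0 → g (R x z w) x = 0 := by
    intro w hxw hzw hww
    have hwx : g w x = 0 := hg w x ▸ hxw
    have hwz : g w z = 0 := hg w z ▸ hzw
    have r1 : g (R x w w) x = 0 := h0 x w hxx hxw
    have r2 : g (R x w z) x = g (R x z w) x := h.jacobi_symm x w z
    have r3 : ∀ u v, g (R w z u) v = -g (R z w u) v := fun u v => h.form_antisymm w z u v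
    have r4 : ∀ u v, g (R u v w) z = -g (R u v z) w := fun u v => h.skew u v w z
    have r5 : g (R z w w) x = -g (R x w z) w := by
      linarith [h.pair_symm z w w x, h.form_antisymm w x z w]
    have r6 : g (R z w z) x = -g (R x z z) w := by
      linarith [h.pair_symm z w z x, h.form_antisymm z x z w]
    have r7 : g (R z w z) w = 0 := by
      linarith [h.skew z w w z, h0 z w hzz hzw]
    -- For every t the first vector is null and the second is orthogonal to it. Comparing
    -- coefficients of the resulting polynomial in t isolates g(w,w) R(x,z,w,x).
    have e := fun t : ℝ => h0 (x + t • w - (t ^ 2 * g w w / 2) • z) (w - (t * g w w) • z) (by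
        simp only [map_add, map_smul, map_sub, LinearMap.add_apply, LinearMap.smul_apply,
          LinearMap.sub_apply, smul_eq_mul, hxx, hzz, hxz, hxw, hzw, hwx, hwz, hzx]
        ring) (by
        simp only [map_add, map_smul, map_sub, LinearMap.add_apply, LinearMap.smul_apply,
          LinearMap.sub_apply, smul_eq_mul, hxx, hzz, hxz, hxw, hzw, hwx, hwz, hzx]
        ring)
    simp only [map_add, map_smul, map_sub, LinearMap.add_apply, LinearMap.smul_apply,
      LinearMap.sub_apply, smul_eq_mul, h.self_left, h.self_right, r1, r2, r3, r4, r5, r6, r7] at e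
    have e1 := e 1
    have e2 := e (-1)
    have e3 := e 2
    have : g w w * g (R x z w) x = 0 := by
      ring_nf at e1 e2 e3
      linarith
    exact (mul_eq_zero.1 this).resolve_left hww
  -- A null w is perturbed by a nonnull vector b orthogonal to x and z: w + b or w - b is nonnull,
  -- and the expression is linear in w.
  have A' : ∀ w, g x w = 0 → g z w = 0 → g (R x z w) x = 0 := by
    intro w hxw hzw
    by_cases hww : g w w = 0
    · obtain ⟨⟨a, hxa, ha⟩, -⟩ := hsi x
      set b := a - g z a • x
      have hb : g b b = g a a := by
        simp only [b, map_smul, map_sub, LinearMap.smul_apply, LinearMap.sub_apply, smul_eq_mul,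
          hxx, hxa, hg a x]
        ring
      have hxb : g x b = 0 := by
        simp only [b, map_smul, map_sub, smul_eq_mul, hxx, hxa]; ring
      have hzb : g z b = 0 := by
        simp only [b, map_smul, map_sub, smul_eq_mul, hzx]; ring
      have hRb := A b hxb hzb (by rw [hb]; exact ha.ne')
      rcases eq_or_ne (g w b) 0 with hwb | hwb
      · have := A (w + b) (by rw [map_add, hxw, hxb, add_zero]) (by rw [map_add, hzw, hzb, add_zero])
          (by simp only [map_add, LinearMap.add_apply, hww, hwb, hg b w, hb]; linarith)
        rwa [map_add, map_add, LinearMap.add_apply, hRb, add_zero] at this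
      · have hne : g (w + b) (w + b) ≠ 0 ∨ g (w - b) (w - b) ≠ 0 := by
          by_contra! hc
          simp only [map_add, map_sub, LinearMap.add_apply, LinearMap.sub_apply, hww, hg b w,
            hb] at hc
          linarith [hc.1, hc.2]
        rcases hne with hne | hne
        · have := A (w + b) (by rw [map_add, hxw, hxb, add_zero])
            (by rw [map_add, hzw, hzb, add_zero]) hne
          rwa [map_add, map_add, LinearMap.add_apply, hRb, add_zero] at this
        · have := A (w - b) (by rw [map_sub, hxw, hxb, sub_zero])
            (by rw [map_sub, hzw, hzb, sub_zero]) hne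
          rwa [map_sub, map_sub, LinearMap.sub_apply, hRb, sub_zero] at this
    · exact A w hxw hzw hww
  set w := y - g x y • z - g z y • x with hw
  have hxw : g x w = 0 := by
    simp only [hw, map_smul, map_sub, smul_eq_mul, hxx, hxz]; ring
  have hzw : g z w = 0 := by
    simp only [hw, map_smul, map_sub, smul_eq_mul, hzz, hzx]; ring
  have e : y = g x y • z + g z y • x + w := by rw [hw]; abel
  generalize g x y = α at e
  generalize g z y = β at e
  rw [e]
  simp only [map_add, map_smul, LinearMap.add_apply, LinearMap.smul_apply, smul_eq_mul,
    h.self_left, h.self_right, h0 x w hxx hxw, A' w hxw hzw, h.jacobi_symm x w z]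
  ring

lemma _root_.PseudoRiem.exists_null_partner {g : LinearMap.BilinForm ℝ V}
    (hg : ∀ x y, g x y = g y x) (hnd : ∀ x, (∀ y, g x y = 0) → x = 0) {x : V} (hx : x ≠ 0)
    (hxx : g x x = 0) : ∃ z, g z z = 0 ∧ g x z = 1 := by
  obtain ⟨v, hv⟩ : ∃ v, g x v ≠ 0 := by
    by_contra! hc
    exact hx (hnd x hc)
  refine ⟨(g x v)⁻¹ • v - ((g x v)⁻¹ ^ 2 * g v v / 2) • x, ?_, ?_⟩
  · simp only [map_smul, map_sub, LinearMap.smul_apply, LinearMap.sub_apply, smul_eq_mul, hxx,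
      hg v x]
    field_simp
    ring
  · simp only [map_smul, map_sub, smul_eq_mul, hxx, inv_mul_cancel₀ hv]
    ring

/-- If the curvature vanishes on planes tangent to the null cone, it has constant sectional
curvature. -/
lemma exists_const (h : IsCurvatureLike g R) (hg : ∀ x y, g x y = g y x)
    (hnd : ∀ x, (∀ y, g x y = 0) → x = 0) (hsi : StronglyIndefinite g)
    (h0 : ∀ x y, g x x = 0 → g x y = 0 → g (R x y y) x = 0) :
    ∃ κ : ℝ, ∀ x y, g (R x y y) x = κ * (g x y ^ 2 - g x x * g y y) := by
  obtain ⟨⟨a, -, ha⟩, b, -, hb⟩ := hsi 0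
  obtain ⟨x₀, -, z₀, -, hx₀, hz₀, hxz₀⟩ := exists_hyperbolic_pair hg ⊤ (Submodule.mem_top (x := a))
    (Submodule.mem_top (x := b)) ha hb
  have hzx₀ : g z₀ x₀ = 1 := hg z₀ x₀ ▸ hxz₀
  have K : ∀ x, g x x = 0 → ∃ k, ∀ y, g (R x y y) x = k * g x y ^ 2 := by
    intro x hxx
    rcases eq_or_ne x 0 with rfl | hx
    · exact ⟨0, fun y => by simp⟩
    · obtain ⟨z, hzz, hxz⟩ := exists_null_partner hg hnd hx hxx
      exact ⟨_, h.exists_null_const hg hsi h0 hxx hzz hxz⟩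
  choose! k hk using K
  -- The sectional value of the pair can be computed from either null vector, and the factor g(x,y)²
  -- is the same.
  have hkk : ∀ x y, g x x = 0 → g y y = 0 → g x y ≠ 0 → k x = k y := by
    intro x y hx hy hxy
    have h1 := hk x hx y
    rw [h.sect_symm, hk y hy x, hg y x] at h1
    exact (mul_right_cancel₀ (pow_ne_zero 2 hxy) h1).symm
  -- Any nonzero null vector is joined to x₀ by a chain of null vectors with nonzero consecutive
  -- products. If x is orthogonal to both x₀ and z₀, the null vector x₀ + u - (g(u,u)/2) z₀ serves
  -- as a link.
  have hk0 : ∀ x, g x x = 0 → x ≠ 0 → k x = k x₀ := by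
    intro x hxx hx
    have hk1 : k z₀ = k x₀ := hkk z₀ x₀ hz₀ hx₀ (by rw [hzx₀]; exact one_ne_zero)
    by_cases h1 : g x x₀ = 0
    swap
    · exact hkk x x₀ hxx hx₀ h1
    by_cases h2 : g x z₀ = 0
    swap
    · exact (hkk x z₀ hxx hz₀ h2).trans hk1
    obtain ⟨v, -, hv⟩ := exists_null_partner hg hnd hx hxx
    set u := v - g v z₀ • x₀ - g v x₀ • z₀ with hu
    have hux : g x₀ u = 0 := by
      simp only [hu, map_smul, map_sub, smul_eq_mul, hx₀, hxz₀, hg v x₀]; ring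
    have huz : g z₀ u = 0 := by
      simp only [hu, map_smul, map_sub, smul_eq_mul, hz₀, hzx₀, hg v z₀]; ring
    have hxu : g x u = 1 := by
      simp only [hu, map_smul, map_sub, smul_eq_mul, h1, h2, hv]; ring
    have n1 : g (x₀ + u - (g u u / 2) • z₀) (x₀ + u - (g u u / 2) • z₀) = 0 := by
      simp only [map_add, map_smul, map_sub, LinearMap.add_apply, LinearMap.smul_apply,
        LinearMap.sub_apply, smul_eq_mul, hx₀, hz₀, hxz₀, hzx₀, hux, huz, hg u x₀, hg u z₀]
      ring
    have n2 : g x (x₀ + u - (g u u / 2) • z₀) = 1 := by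
      simp only [map_add, map_smul, map_sub, smul_eq_mul, h1, h2, hxu]; ring
    have n3 : g (x₀ + u - (g u u / 2) • z₀) z₀ = 1 := by
      simp only [map_add, map_smul, map_sub, LinearMap.add_apply, LinearMap.smul_apply,
        LinearMap.sub_apply, smul_eq_mul, hz₀, hxz₀, huz, hg u z₀]
      ring
    rw [hkk x _ hxx n1 (by rw [n2]; exact one_ne_zero),
      hkk _ z₀ n1 hz₀ (by rw [n3]; exact one_ne_zero), hk1]
  set κ := k x₀
  have hnull : ∀ x y, g x x = 0 → g (R x y y) x = κ * g x y ^ 2 := by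
    intro x y hxx
    rcases eq_or_ne x 0 with rfl | hx
    · simp
    · rw [hk x hxx y, hk0 x hxx hx]
  refine ⟨κ, fun x y => ?_⟩
  by_cases hyy : g y y = 0
  · rw [h.sect_symm, hnull y x hyy, hyy, hg y x]; ring
  -- The subtracted term makes B vanish on null vectors, so B = c g. Evaluation at the pair (y, y)
  -- gives c = -κ g(y,y).
  · let B : LinearMap.BilinForm ℝ V := LinearMap.mk₂ ℝ
      (fun u v => g (R u y y) v - κ * (g u y * g v y))
      (fun u u' v => by simp only [map_add, LinearMap.add_apply]; ring)
      (fun c u v => by simp only [map_smul, LinearMap.smul_apply, smul_eq_mul]; ring)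
      (fun u v v' => by simp only [map_add, LinearMap.add_apply]; ring)
      (fun c u v => by simp only [map_smul, LinearMap.smul_apply, smul_eq_mul]; ring)
    have hBa : ∀ u v, B u v = g (R u y y) v - κ * (g u y * g v y) := fun _ _ => rfl
    obtain ⟨c, hc⟩ := exists_eq_smul_of_null (B := B) hg (fun u v => by
        rw [hBa, hBa, h.jacobi_symm' y u v]; ring) ⊤ (Submodule.mem_top (x := a))
      (Submodule.mem_top (x := b)) ha hb (fun w _ hw => by
        rw [hBa, hnull w y hw]; ring)
    have h1 := hc y trivial y trivial
    have h2 := hc x trivial x trivial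
    rw [hBa, h.self_left] at h1
    rw [hBa] at h2
    have h3 : c = -κ * g y y := by
      apply mul_right_cancel₀ hyy
      linarith
    rw [h3] at h2
    linarith

end IsCurvatureLike

/-- The Kulkarni–Nomizu product of the form `g` with the endomorphism `S`, as an operator. -/
def kulkarniNomizu (g : LinearMap.BilinForm ℝ V) (S : V →ₗ[ℝ] V) :
    V →ₗ[ℝ] V →ₗ[ℝ] V →ₗ[ℝ] V :=
  LinearMap.mk₂ ℝ (fun x y => (g y).smulRight (S x) + (g (S y)).smulRight x -
      (g x).smulRight (S y) - (g (S x)).smulRight y)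
    (fun x x' y => by ext z; simp [add_smul]; abel)
    (fun c x y => by ext z; simp [smul_smul, smul_sub, mul_comm])
    (fun x y y' => by ext z; simp [add_smul]; abel)
    (fun c x y => by ext z; simp [smul_smul, smul_sub, mul_comm])

lemma kulkarniNomizu_apply (g : LinearMap.BilinForm ℝ V) (S : V →ₗ[ℝ] V) (x y z : V) :
    kulkarniNomizu g S x y z = g y z • S x + g (S y) z • x - g x z • S y - g (S x) z • y := rfl

namespace IsCurvatureLike

variable {g : LinearMap.BilinForm ℝ V} {R R' : V →ₗ[ℝ] V →ₗ[ℝ] V →ₗ[ℝ] V}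

lemma sub (h : IsCurvatureLike g R) (h' : IsCurvatureLike g R') : IsCurvatureLike g (R - R') where
  antisymm x y z := by
    simp only [LinearMap.sub_apply, h.antisymm x y z, h'.antisymm x y z]; abel
  skew x y z w := by
    simp only [LinearMap.sub_apply, map_sub, h.skew x y z w, h'.skew x y z w]; ring
  bianchi x y z := by
    simp only [LinearMap.sub_apply]
    rw [show R x y z - R' x y z + (R y z x - R' y z x) + (R z x y - R' z x y) =
      (R x y z + R y z x + R z x y) - (R' x y z + R' y z x + R' z x y) by abel, h.bianchi,
      h'.bianchi, sub_zero]

lemma _root_.PseudoRiem.isCurvatureLike_kulkarniNomizu (hg : ∀ x y, g x y = g y x)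
    {S : V →ₗ[ℝ] V} (hS : ∀ x y, g (S x) y = g (S y) x) :
    IsCurvatureLike g (kulkarniNomizu g S) where
  antisymm x y z := by simp only [kulkarniNomizu_apply]; abel
  skew x y z w := by
    simp only [kulkarniNomizu_apply, map_sub, map_add, map_smul, LinearMap.add_apply,
      LinearMap.sub_apply, LinearMap.smul_apply, smul_eq_mul]
    ring
  bianchi x y z := by
    simp only [kulkarniNomizu_apply, hS x y, hS x z, hS y z, hg x y, hg x z, hg y z]
    abel

/-- This Ricci contraction fixes S: matching it with the Ricci form of R makes the difference
trace-free. -/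
lemma _root_.PseudoRiem.trace_kulkarniNomizu [FiniteDimensional ℝ V]
    (hg : ∀ x y, g x y = g y x) {S : V →ₗ[ℝ] V} (hS : ∀ x y, g (S x) y = g (S y) x) (x : V) :
    LinearMap.trace ℝ V (((kulkarniNomizu g S).flip x).flip x) =
      (Module.finrank ℝ V - 2) * g (S x) x + LinearMap.trace ℝ V S * g x x := by
  have e : ((kulkarniNomizu g S).flip x).flip x = g x x • S + g (S x) x • LinearMap.id -
      (g x).smulRight (S x) - (g (S x)).smulRight x := by
    ext u
    simp only [LinearMap.flip_apply, kulkarniNomizu_apply, LinearMap.sub_apply,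
      LinearMap.add_apply, LinearMap.smul_apply, LinearMap.smulRight_apply, LinearMap.id_apply,
      hg u x, hS u x]
  rw [e]
  simp only [map_sub, map_add, map_smul, LinearMap.trace_smulRight, LinearMap.trace_id, smul_eq_mul,
    hg x (S x)]
  ring

/-- A Weyl-like operator: if the curvature vanishes on isotropic pairs and the Ricci form vanishes,
then the curvature vanishes on planes tangent to the null cone. -/
lemma null_of_trace [FiniteDimensional ℝ V] (h : IsCurvatureLike g R) (hg : ∀ x y, g x y = g y x)
    (hnd : ∀ x, (∀ y, g x y = 0) → x = 0) (hsi : StronglyIndefinite g)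
    (hn : 2 < Module.finrank ℝ V)
    (h0 : ∀ x y, g x x = 0 → g x y = 0 → g y y = 0 → g (R x y y) x = 0)
    (htr : ∀ x, LinearMap.trace ℝ V ((R.flip x).flip x) = 0)
    (x y : V) (hxx : g x x = 0) (hxy : g x y = 0) : g (R x y y) x = 0 := by
  rcases eq_or_ne x 0 with rfl | hx
  · simp
  obtain ⟨⟨a, hxa, ha⟩, b, hxb, hb⟩ := hsi x
  obtain ⟨z, hzz, hxz⟩ := exists_null_partner hg hnd hx hxx
  let J : V →ₗ[ℝ] V := (R.flip x).flip x
  have hJ : ∀ u, J u = R u x x := fun _ => rfl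
  -- The restriction on the signature enters here: x^⊥ contains vectors of both signs, so the Jacobi
  -- form, zero on its null vectors, is a multiple of g there.
  obtain ⟨l, hl⟩ := exists_eq_smul_of_null (B := g ∘ₗ J) hg
    (fun u v => h.jacobi_symm' x u v) (LinearMap.ker (g x)) hxa hxb ha hb
    (fun w hw hww => by
      change g (R w x x) w = 0
      rw [h.sect_symm]; exact h0 x w hxx hw hww)
  have hl' : ∀ u v, g x u = 0 → g x v = 0 → g (J u) v = l * g u v := fun u v hu hv => hl u hu v hv
  have hJs : ∀ u v, g (J u) v = g (J v) u := fun u v => h.jacobi_symm' x u v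
  have hJx : J x = 0 := by
    refine hnd _ fun w => ?_
    rw [hJ]
    exact h.self_left x x w
  set c := J z - l • z
  -- On x^⊥ the form is l g; the remaining freedom is in terms of rank one, whose traces sum to -2l.
  -- The vanishing trace then reads (n - 2) l = 0.
  have e : J = l • LinearMap.id + (g x).smulRight c + (g c).smulRight x -
      (g z c) • (g x).smulRight x := by
    ext u
    rw [← sub_eq_zero]
    refine hnd _ fun v => ?_
    have hu : g x (u - g x u • z) = 0 := by
      simp only [map_sub, map_smul, smul_eq_mul, hxz]; ring
    have hv : g x (v - g x v • z) = 0 := by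
      simp only [map_sub, map_smul, smul_eq_mul, hxz]; ring
    have h1 := hl' _ _ hu hv
    simp only [map_sub, map_smul, LinearMap.sub_apply, LinearMap.smul_apply, smul_eq_mul, hzz,
      hJs z v] at h1
    simp only [map_sub, map_smul, LinearMap.sub_apply, LinearMap.smul_apply, smul_eq_mul, hzz,
      LinearMap.add_apply, LinearMap.smulRight_apply, map_add, c, LinearMap.id_apply, hJs z u,
      hg z (J z), hJs z v]
    rw [hg u z] at h1
    linarith
  have t := htr x
  change LinearMap.trace ℝ V J = 0 at t
  rw [e] at t
  have hcx : g x c = -l := by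
    simp only [c, map_sub, map_smul, hxz, smul_eq_mul, mul_one, hg x (J z), hJs z x, hJx, map_zero,
      LinearMap.zero_apply, zero_sub]
  simp only [map_sub, map_add, map_smul, LinearMap.trace_smulRight, LinearMap.trace_id, smul_eq_mul,
    hxx, hg c x, hcx] at t
  have hl0 : l = 0 := by
    have h2 : l * ((Module.finrank ℝ V : ℝ) - 2) = 0 := by linarith
    have h3 : (2 : ℝ) < Module.finrank ℝ V := by exact_mod_cast hn
    exact (mul_eq_zero.1 h2).resolve_right (by linarith)
  rw [h.sect_symm]
  have := hl' y y hxy hxy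
  rwa [hl0, zero_mul] at this

/-- A curvature operator that vanishes on isotropic planes is the Kulkarni–Nomizu product of the
metric with the Schouten endomorphism. -/
theorem eq_kulkarniNomizu [FiniteDimensional ℝ V] (h : IsCurvatureLike g R)
    (hg : ∀ x y, g x y = g y x) (hnd : ∀ x, (∀ y, g x y = 0) → x = 0) (hsi : StronglyIndefinite g)
    (hn : 2 < Module.finrank ℝ V)
    (h0 : ∀ x y, g x x = 0 → g x y = 0 → g y y = 0 → g (R x y y) x = 0)
    {S : V →ₗ[ℝ] V} (hS : ∀ x y, g (S x) y = g (S y) x)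
    (htr : ∀ x, LinearMap.trace ℝ V ((R.flip x).flip x) =
      (Module.finrank ℝ V - 2) * g (S x) x + LinearMap.trace ℝ V S * g x x) :
    R = kulkarniNomizu g S := by
  have hW : IsCurvatureLike g (R - kulkarniNomizu g S) :=
    h.sub (isCurvatureLike_kulkarniNomizu hg hS)
  have hWt : ∀ x, LinearMap.trace ℝ V
      (((R - kulkarniNomizu g S).flip x).flip x) = 0 := by
    intro x
    have : ((R - kulkarniNomizu g S).flip x).flip x =
      (R.flip x).flip x - ((kulkarniNomizu g S).flip x).flip x := rfl
    rw [this, map_sub, htr, trace_kulkarniNomizu hg hS, sub_self]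
  have hW0 : ∀ x y, g x x = 0 → g x y = 0 → g y y = 0 →
      g ((R - kulkarniNomizu g S) x y y) x = 0 := by
    intro x y hx hxy hy
    simp only [LinearMap.sub_apply, map_sub, h0 x y hx hxy hy, kulkarniNomizu_apply, map_add,
      map_smul, LinearMap.add_apply, LinearMap.smul_apply, smul_eq_mul, hx, hxy, hy, hg y x]
    ring
  obtain ⟨κ, hκ⟩ := hW.exists_const hg hnd hsi (hW.null_of_trace hg hnd hsi hn hW0 hWt)
  -- The product of g with s·id has sectional values 2s (g(x,x)g(y,y) - g(x,y)²), hence s = -κ/2.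
  -- Vanishing of the trace will force κ = 0.
  set S' : V →ₗ[ℝ] V := (-κ / 2) • LinearMap.id
  have hS' : ∀ x y, g (S' x) y = g (S' y) x := fun x y => by
    simp only [S', LinearMap.smul_apply, LinearMap.id_apply, map_smul, smul_eq_mul, hg x y]
  have hWe : ∀ x y z, (R - kulkarniNomizu g S - kulkarniNomizu g S') x y z = 0 := by
    refine (hW.sub (isCurvatureLike_kulkarniNomizu hg hS')).eq_zero_of_sect hnd fun x y => ?_
    rw [LinearMap.sub_apply, LinearMap.sub_apply, LinearMap.sub_apply, map_sub,
      LinearMap.sub_apply, hκ]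
    simp only [kulkarniNomizu_apply, S', LinearMap.smul_apply, LinearMap.id_apply, map_sub, map_add,
      map_smul, LinearMap.add_apply, LinearMap.sub_apply, smul_eq_mul, hg y x]
    ring
  have hWe' : R - kulkarniNomizu g S = kulkarniNomizu g S' := by
    ext x y z
    exact sub_eq_zero.1 (hWe x y z)
  obtain ⟨⟨a, -, ha⟩, -⟩ := hsi 0
  have t := hWt a
  rw [hWe', trace_kulkarniNomizu hg hS'] at t
  simp only [S', map_smul, LinearMap.smul_apply, LinearMap.trace_id, LinearMap.id_apply,
    smul_eq_mul] at t
  have h3 : (2 : ℝ) < Module.finrank ℝ V := by exact_mod_cast hn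
  have h4 : κ * (((Module.finrank ℝ V : ℝ) - 1) * g a a) = 0 := by linarith
  have hκ0 : κ = 0 := (mul_eq_zero.1 h4).resolve_right
    (mul_ne_zero (by linarith) ha.ne')
  rw [sub_eq_iff_eq_add] at hWe'
  rw [hWe']
  ext x y z
  simp [kulkarniNomizu_apply, S', hκ0]

end IsCurvatureLike

/-- The algebraic part of the vanishing of the Cotton tensor in dimension at least four. -/
lemma cotton_eq_zero [FiniteDimensional ℝ V] {g : LinearMap.BilinForm ℝ V}
    (hg : ∀ x y, g x y = g y x) (hnd : ∀ x, (∀ y, g x y = 0) → x = 0)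
    (hn : 3 < Module.finrank ℝ V) {C : V →ₗ[ℝ] V →ₗ[ℝ] V} (hC : ∀ x y, C x y = -C y x)
    (h : ∀ u x y z, (g (C u x) z • y - g y z • C u x) + (g (C x y) z • u - g u z • C x y) +
      (g (C y u) z • x - g x z • C y u) = 0) (u x : V) : C u x = 0 := by
  have h3 : (3 : ℝ) < Module.finrank ℝ V := by exact_mod_cast hn
  set t : V → ℝ := fun x => LinearMap.trace ℝ V (C x) with ht
  -- The trace of the hypothesis over y.
  have key : ∀ u x, ((Module.finrank ℝ V : ℝ) - 3) • C u x = t x • u - t u • x := by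
    intro u x
    rw [← sub_eq_zero]
    refine hnd _ fun z => ?_
    have e : g (C u x) z • LinearMap.id - (g z).smulRight (C u x) +
        (((g z) ∘ₗ C x).smulRight u - g u z • C x) +
        (-((g z) ∘ₗ C u).smulRight x + g x z • C u) = (0 : V →ₗ[ℝ] V) := by
      ext y
      have := h u x y z
      rw [hC y u, hg y z, hg (C x y) z] at this
      simp only [LinearMap.add_apply, LinearMap.sub_apply, LinearMap.smul_apply,
        LinearMap.id_apply, LinearMap.smulRight_apply, LinearMap.comp_apply, LinearMap.neg_apply,
        LinearMap.zero_apply]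
      rw [← this, map_neg, LinearMap.neg_apply, hg (C u y) z]
      module
    have e2 := congrArg (LinearMap.trace ℝ V) e
    simp only [map_sub, map_add, map_smul, map_neg, LinearMap.trace_smulRight, LinearMap.trace_id,
      smul_eq_mul, map_zero, LinearMap.comp_apply, hC x u] at e2
    simp only [map_sub, map_smul, LinearMap.sub_apply, LinearMap.smul_apply, smul_eq_mul, ht]
    rw [hg z (C u x)] at e2
    linarith
  -- A second trace, now over x, gives (2n - 4) t(u) = 0.
  have ht0 : ∀ u, t u = 0 := by
    intro u
    let τ : V →ₗ[ℝ] ℝ := LinearMap.trace ℝ V ∘ₗ C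
    have e : ((Module.finrank ℝ V : ℝ) - 3) • C u = τ.smulRight u - t u • LinearMap.id := by
      ext x
      exact key u x
    have e2 := congrArg (LinearMap.trace ℝ V) e
    simp only [map_sub, map_smul, LinearMap.trace_smulRight, LinearMap.trace_id, smul_eq_mul] at e2
    change (_ - 3) * t u = t u - t u * _ at e2
    have : t u * (2 * (Module.finrank ℝ V : ℝ) - 4) = 0 := by linarith
    exact (mul_eq_zero.1 this).resolve_right (by linarith)
  have := key u x
  rw [ht0, ht0, zero_smul, zero_smul, sub_zero] at this
  exact (smul_eq_zero.1 this).resolve_left (by linarith)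

end Weyl

/-! ### Gram determinants along pencils through an isotropic plane. -/

section Pencil

open Filter

variable {V : Type*} [NormedAddCommGroup V] [NormedSpace ℝ V]

/-- Identity theorem for analytic functions; it supplies generic directions for the pencils. -/
lemma dense_ne_zero_of_contDiff {W : Type*} [NormedAddCommGroup W] [NormedSpace ℝ W] {f : W → ℝ}
    (hf : ContDiff ℝ ω f) {w : W} (hw : f w ≠ 0) : Dense {x | f x ≠ 0} := by
  intro x
  by_contra hx
  rw [mem_closure_iff_frequently, not_frequently] at hx
  have h0 : f =ᶠ[𝓝 x] 0 := hx.mono fun y hy => not_not.1 hy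
  have ha : AnalyticOnNhd ℝ f Set.univ := fun y _ => hf.contDiffAt.analyticAt
  exact hw (ha.eqOn_zero_of_preconnected_of_eventuallyEq_zero isPreconnected_univ trivial h0 trivial)

lemma eventually_quartic_ne_zero {d₀ d₁ d₂ d₃ d₄ : ℝ} (h : d₄ ≠ 0) :
    ∀ᶠ t : ℝ in 𝓝[≠] 0, d₀ + d₁ * t + d₂ * t ^ 2 + d₃ * t ^ 3 + d₄ * t ^ 4 ≠ 0 := by
  open Polynomial in
  set p : ℝ[X] := C d₀ + C d₁ * X + C d₂ * X ^ 2 + C d₃ * X ^ 3 + C d₄ * X ^ 4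
  have hp : p ≠ 0 := fun h0 => h (by
    have := congrArg (fun q => Polynomial.coeff q 4) h0
    simpa [p, Polynomial.coeff_X, Polynomial.coeff_C] using this)
  have hfin : ((p.roots.toFinset : Set ℝ) \ {0}).Finite := p.roots.toFinset.finite_toSet.sdiff
  have : ((p.roots.toFinset : Set ℝ) \ {0})ᶜ ∈ 𝓝 (0 : ℝ) :=
    hfin.isClosed.isOpen_compl.mem_nhds (by simp)
  rw [eventually_nhdsWithin_iff]
  filter_upwards [this] with t ht ht0 hz
  exact ht ⟨by simpa [p, hp] using hz, ht0⟩

/-- Multiplying by t² and by t shows in turn that the two lower coefficients vanish. -/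
lemma quartic_coeff_of_tendsto {d₀ d₁ d₂ d₃ d₄ L : ℝ}
    (h : Tendsto (fun t : ℝ => (d₀ + d₁ * t + d₂ * t ^ 2 + d₃ * t ^ 3 + d₄ * t ^ 4) / t ^ 2)
      (𝓝[≠] 0) (𝓝 L)) : d₀ = 0 ∧ d₁ = 0 ∧ d₂ = L := by
  have hid : Tendsto (fun t : ℝ => t) (𝓝[≠] 0) (𝓝 0) := tendsto_nhdsWithin_of_tendsto_nhds tendsto_id
  have hne : ∀ᶠ t : ℝ in 𝓝[≠] 0, t ≠ 0 := self_mem_nhdsWithin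
  have hpoly : ∀ a b c d e : ℝ, Tendsto (fun t : ℝ => a + b * t + c * t ^ 2 + d * t ^ 3 + e * t ^ 4)
      (𝓝[≠] 0) (𝓝 a) := fun a b c d e => by
    have : Tendsto (fun t : ℝ => a + b * t + c * t ^ 2 + d * t ^ 3 + e * t ^ 4) (𝓝 0)
        (𝓝 (a + b * 0 + c * 0 ^ 2 + d * 0 ^ 3 + e * 0 ^ 4)) :=
      Continuous.tendsto (by fun_prop) 0
    simpa using tendsto_nhdsWithin_of_tendsto_nhds this
  have h0 : d₀ = 0 := by
    have h1 := h.mul (hid.pow 2)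
    have h2 := (hpoly d₀ d₁ d₂ d₃ d₄).congr' (f₂ := fun t =>
      (d₀ + d₁ * t + d₂ * t ^ 2 + d₃ * t ^ 3 + d₄ * t ^ 4) / t ^ 2 * t ^ 2) (by
        filter_upwards [hne] with t ht
        rw [div_mul_cancel₀ _ (pow_ne_zero 2 ht)])
    simpa using tendsto_nhds_unique h2 h1
  subst h0
  have h1 : d₁ = 0 := by
    have h1 := h.mul hid
    have h2 := (hpoly d₁ d₂ d₃ d₄ 0).congr' (f₂ := fun t =>
      (0 + d₁ * t + d₂ * t ^ 2 + d₃ * t ^ 3 + d₄ * t ^ 4) / t ^ 2 * t) (by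
        filter_upwards [hne] with t ht
        field_simp
        ring)
    simpa using tendsto_nhds_unique h2 h1
  subst h1
  refine ⟨rfl, rfl, ?_⟩
  refine tendsto_nhds_unique ((hpoly d₂ d₃ d₄ 0 0).congr' ?_) h
  filter_upwards [hne] with t ht
  field_simp
  ring

/-- The Gram determinant of a pair of vectors. -/
def gram (g : V →L[ℝ] V →L[ℝ] ℝ) (x y : V) : ℝ := g x x * g y y - g x y * g x y

lemma gram_pencil {g : V →L[ℝ] V →L[ℝ] ℝ} (hg : ∀ x y, g x y = g y x) (x y u v : V) (t : ℝ) :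
    gram g (x + t • u) (y + t • v) = gram g x y +
      (2 * g x u * g y y + 2 * g x x * g y v - 2 * g x y * (g x v + g y u)) * t +
      (4 * g x u * g y v - (g x v + g y u) ^ 2 + g x x * g v v + g u u * g y y -
        2 * g x y * g u v) * t ^ 2 +
      (2 * g x u * g v v + 2 * g u u * g y v - 2 * g u v * (g x v + g y u)) * t ^ 3 +
      gram g u v * t ^ 4 := by
  simp only [gram, map_add, map_smul, add_apply, smul_apply,
    smul_eq_mul, hg u x, hg v y, hg u y]
  ring

/-- Otherwise g(x,·) vanishes on the kernel of g(y,·), and nondegeneracy makes x a multiple of y. -/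
lemma exists_dual_pair {g : V →L[ℝ] V →L[ℝ] ℝ} (hnd : ∀ x, (∀ y, g x y = 0) → x = 0) {x y : V}
    (hxy : LinearIndependent ℝ ![x, y]) : ∃ v, g x v = 1 ∧ g y v = 0 := by
  have hpair := LinearIndependent.pair_iff.1 hxy
  have hy : y ≠ 0 := fun h => by simpa using hpair 0 1 (by simp [h])
  obtain ⟨v₁, hv₁⟩ : ∃ v, g y v ≠ 0 := by
    by_contra! hc
    exact hy (hnd y hc)
  by_contra! hc
  have hz : ∀ v, g y v = 0 → g x v = 0 := by
    intro v hv
    by_contra hxv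
    exact hc ((g x v)⁻¹ • v) (by simp [hxv]) (by simp [hv])
  have : x - (g x v₁ / g y v₁) • y = 0 := hnd _ fun v => by
    have := hz (v - (g y v / g y v₁) • v₁) (by
      simp only [map_sub, map_smul, smul_eq_mul]; field_simp; ring)
    simp only [map_sub, map_smul, smul_eq_mul] at this
    simp only [map_sub, map_smul, sub_apply, smul_apply, smul_eq_mul]
    linear_combination this
  simpa using (hpair 1 (-(g x v₁ / g y v₁)) (by rw [one_smul, neg_smul, ← sub_eq_add_neg, this])).1

/-- If all Gram determinants vanish, a nonzero w orthogonal to a nonnull u is null and orthogonal to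
everything. -/
lemma exists_gram_ne_zero {h : V →L[ℝ] V →L[ℝ] ℝ} (hh : ∀ x y, h x y = h y x)
    (hnd : ∀ x, (∀ y, h x y = 0) → x = 0) {x y : V} (hxy : LinearIndependent ℝ ![x, y]) :
    ∃ u v, gram h u v ≠ 0 := by
  have hpair := LinearIndependent.pair_iff.1 hxy
  by_contra! hc
  obtain ⟨u, hu⟩ : ∃ u, h u u ≠ 0 := by
    by_contra! hu
    have : x = 0 := hnd x fun v => by
      have := hu (x + v)
      simp only [map_add, add_apply, hu, hh v x] at this
      linarith
    simpa using hpair 1 0 (by simp [this])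
  obtain ⟨w, hw0, huw⟩ : ∃ w, w ≠ 0 ∧ h u w = 0 := by
    by_cases h1 : h u x = 0
    · exact ⟨x, fun hx => by simpa using hpair 1 0 (by simp [hx]), h1⟩
    · refine ⟨h u y • x + (-h u x) • y, fun h0 => h1 ?_, ?_⟩
      · simpa using (hpair _ _ h0).2
      · simp only [map_add, map_smul, smul_eq_mul]; ring
  have hww : h w w = 0 := by
    have := hc u w
    simp only [gram, huw, mul_zero, sub_zero] at this
    exact (mul_eq_zero.1 this).resolve_left hu
  refine hw0 (hnd w fun s => ?_)
  have h1 := hc u (w + s)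
  have h2 := hc u s
  simp only [gram, map_add, add_apply, huw, hww, hh s w, zero_add] at h1 h2
  have : h u u * (2 * h w s) = 0 := by linarith
  simpa [hu] using this

lemma eq_smul_of_sq_eq {p q : V →L[ℝ] ℝ} (hq : q ≠ 0) {ρ : ℝ} (h : ∀ v, p v ^ 2 = ρ * q v ^ 2) :
    ∃ c, c ^ 2 = ρ ∧ ∀ v, p v = c * q v := by
  obtain ⟨v₀, hv₀⟩ : ∃ v, q v ≠ 0 := by
    by_contra! hc
    exact hq (ContinuousLinearMap.ext hc)
  have h0 := h v₀
  have hc2 : (p v₀ / q v₀) ^ 2 = ρ := by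
    rw [div_pow, h0, mul_div_cancel_right₀ _ (pow_ne_zero 2 hv₀)]
  refine ⟨p v₀ / q v₀, hc2, fun v => ?_⟩
  have h1 := h (v + v₀)
  have h2 := h v
  simp only [map_add] at h1
  have h3 : p v * p v₀ = ρ * (q v * q v₀) := by linarith
  by_cases hp : p v₀ = 0
  · have hρ : ρ = 0 := by rw [← hc2, hp]; simp
    rw [hρ, zero_mul] at h2
    rw [hp, zero_div, zero_mul, pow_eq_zero_iff two_ne_zero |>.1 h2]
  · apply mul_right_cancel₀ hp
    rw [h3, ← hc2]
    field_simp

/-- If the Gram determinants of `h` and `g` have a limiting ratio `ρ` along all pencils through a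
`g`-isotropic plane, then `h = c g` on this plane, with `c² = ρ`. -/
theorem exists_eq_smul_of_gram_ratio {g h : V →L[ℝ] V →L[ℝ] ℝ} (hg : ∀ x y, g x y = g y x)
    (hgnd : ∀ x, (∀ y, g x y = 0) → x = 0) (hh : ∀ x y, h x y = h y x)
    (hhnd : ∀ x, (∀ y, h x y = 0) → x = 0) {x y : V} (hxy : LinearIndependent ℝ ![x, y])
    (hxx : g x x = 0) (hgxy : g x y = 0) (hyy : g y y = 0) {ρ : ℝ}
    (H : ∀ u v, (∀ᶠ t : ℝ in 𝓝[≠] 0, gram g (x + t • u) (y + t • v) ≠ 0) →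
      (∀ᶠ t : ℝ in 𝓝[≠] 0, gram h (x + t • u) (y + t • v) ≠ 0) →
      Tendsto (fun t : ℝ => gram h (x + t • u) (y + t • v) / gram g (x + t • u) (y + t • v))
        (𝓝[≠] 0) (𝓝 ρ)) :
    ∃ c, c ^ 2 = ρ ∧ (∀ w, h x w = c * g x w) ∧ ∀ w, h y w = c * g y w := by
  have hpair := LinearIndependent.pair_iff.1 hxy
  have hx0 : x ≠ 0 := fun h => by simpa using hpair 1 0 (by simp [h])
  have hy0 : y ≠ 0 := fun h => by simpa using hpair 0 1 (by simp [h])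
  set δ : V × V → ℝ := fun p => 4 * g x p.1 * g y p.2 - (g x p.2 + g y p.1) ^ 2 with hδ
  have hδc : ContDiff ℝ ω δ := by fun_prop
  have hΔc : ContDiff ℝ ω (fun p : V × V => gram h p.1 p.2) := by
    unfold gram
    fun_prop
  have dense1 : Dense {p | δ p ≠ 0} := by
    obtain ⟨v, hv⟩ : ∃ v, g x v ≠ 0 := by
      by_contra! hc
      exact hx0 (hgnd x hc)
    exact dense_ne_zero_of_contDiff hδc (w := (0, v)) (by simp [hδ, hv])
  have dense2 : Dense {p : V × V | gram h p.1 p.2 ≠ 0} := by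
    obtain ⟨u, v, huv⟩ := exists_gram_ne_zero hh hhnd hxy
    exact dense_ne_zero_of_contDiff hΔc (w := (u, v)) huv
  have dense : Dense ({p | δ p ≠ 0} ∩ {p : V × V | gram h p.1 p.2 ≠ 0}) :=
    dense1.inter_of_isOpen_left dense2 (isOpen_ne_fun hδc.continuous continuous_const)
  set D1 : V × V → ℝ := fun p =>
    2 * h x p.1 * h y y + 2 * h x x * h y p.2 - 2 * h x y * (h x p.2 + h y p.1) with hD1
  set D2 : V × V → ℝ := fun p => 4 * h x p.1 * h y p.2 - (h x p.2 + h y p.1) ^ 2 +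
    h x x * h p.2 p.2 + h p.1 p.1 * h y y - 2 * h x y * h p.1 p.2 with hD2
  -- For generic (u, v) both Gram determinants are nonzero for small t ≠ 0, so the hypothesis
  -- applies. The denominator behaves like δ t², and the coefficients of the numerator can be read
  -- off; density extends the relations to all (u, v).
  have gen : ∀ p ∈ {p | δ p ≠ 0} ∩ {p : V × V | gram h p.1 p.2 ≠ 0},
      D1 p = 0 ∧ D2 p = ρ * δ p := by
    rintro ⟨u, v⟩ ⟨h1, h2⟩
    have h1' : δ (u, v) ≠ 0 := h1
    have h2' : gram h u v ≠ 0 := h2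
    have hlim : Tendsto (fun t : ℝ => gram g (x + t • u) (y + t • v) / t ^ 2) (𝓝[≠] 0)
        (𝓝 (δ (u, v))) := by
      have hc : Tendsto (fun t : ℝ => δ (u, v) +
          (2 * g x u * g v v + 2 * g u u * g y v - 2 * g u v * (g x v + g y u)) * t +
          gram g u v * t ^ 2) (𝓝 0) (𝓝 (δ (u, v) +
          (2 * g x u * g v v + 2 * g u u * g y v - 2 * g u v * (g x v + g y u)) * 0 +
          gram g u v * 0 ^ 2)) := Continuous.tendsto (by fun_prop) 0
      rw [mul_zero, zero_pow two_ne_zero, mul_zero, add_zero, add_zero] at hc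
      refine (tendsto_nhdsWithin_of_tendsto_nhds hc).congr' ?_
      filter_upwards [self_mem_nhdsWithin] with t ht
      have ht' : t ≠ 0 := ht
      rw [gram_pencil hg, eq_div_iff (pow_ne_zero 2 ht')]
      have : gram g x y = 0 := by simp [gram, hxx, hgxy]
      rw [this, hxx, hyy, hgxy]
      simp only [hδ]
      ring
    have hg0 : ∀ᶠ t : ℝ in 𝓝[≠] 0, gram g (x + t • u) (y + t • v) ≠ 0 := by
      filter_upwards [hlim.eventually_ne h1'] with t ht h0
      exact ht (by rw [h0, zero_div])
    have hh0 : ∀ᶠ t : ℝ in 𝓝[≠] 0, gram h (x + t • u) (y + t • v) ≠ 0 := by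
      simp only [gram_pencil hh]
      exact eventually_quartic_ne_zero h2'
    have hL : Tendsto (fun t : ℝ => gram h (x + t • u) (y + t • v) / t ^ 2) (𝓝[≠] 0)
        (𝓝 (ρ * δ (u, v))) := by
      refine ((H u v hg0 hh0).mul hlim).congr' ?_
      filter_upwards [hg0] with t ht
      rw [div_mul_div_cancel₀ ht]
    simp only [gram_pencil hh] at hL
    exact (quartic_coeff_of_tendsto hL).2
  have hD1c : Continuous D1 := by fun_prop
  have hD2c : Continuous D2 := by fun_prop
  have all1 : ∀ p, D1 p = 0 := fun p =>
    congrFun (Continuous.ext_on dense hD1c continuous_const fun p hp => (gen p hp).1) p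
  have all2 : ∀ p, D2 p = ρ * δ p := fun p =>
    congrFun (Continuous.ext_on dense hD2c (hδc.continuous.const_mul ρ)
      fun p hp => (gen p hp).2) p
  -- With v = 0 the first-order relation says that h(y,y) x - h(x,y) y lies in the radical of h.
  -- Independence of x and y kills both coefficients, and the plane is h-isotropic.
  have z1 := hpair (h y y) (-h x y) (hhnd _ fun u => by
    have := all1 (u, 0)
    simp only [hD1, map_zero] at this
    simp only [map_add, map_smul, add_apply, smul_apply, smul_eq_mul]
    linarith)
  have z2 := hpair (-h x y) (h x x) (hhnd _ fun u => by
    have := all1 (0, u)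
    simp only [hD1, map_zero] at this
    simp only [map_add, map_smul, add_apply, smul_apply, smul_eq_mul]
    linarith)
  have hhyy : h y y = 0 := z1.1
  have hhxy : h x y = 0 := by simpa using z1.2
  have hhxx : h x x = 0 := z2.2
  have rel : ∀ u v, 4 * h x u * h y v - (h x v + h y u) ^ 2 =
      ρ * (4 * g x u * g y v - (g x v + g y u) ^ 2) := fun u v => by
    have := all2 (u, v)
    simp only [hD2, hδ, hhyy, hhxy, hhxx] at this
    linarith
  have hgx : g x ≠ 0 := fun h0 => hx0 (hgnd x fun v => by rw [h0]; rfl)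
  have hgy : g y ≠ 0 := fun h0 => hy0 (hgnd y fun v => by rw [h0]; rfl)
  obtain ⟨c, hc, hcx⟩ := eq_smul_of_sq_eq (p := h x) hgx (ρ := ρ) fun v => by
    have := rel 0 v
    simp only [map_zero] at this
    linarith
  obtain ⟨c', hc', hcy⟩ := eq_smul_of_sq_eq (p := h y) hgy (ρ := ρ) fun v => by
    have := rel v 0
    simp only [map_zero] at this
    linarith
  obtain ⟨v₁, h11, h12⟩ := exists_dual_pair hgnd hxy
  obtain ⟨v₂, h22, h21⟩ := exists_dual_pair hgnd (x := y) (y := x) (by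
    rw [LinearIndependent.pair_iff]
    intro s t hst
    exact (hpair t s (by rw [add_comm]; exact hst)).symm)
  -- A direction pairing to 1 with both x and y makes the right side vanish: 4cc' = (c + c')². This
  -- excludes opposite signs of c and c'.
  have hcc : c * c' = ρ := by
    have := rel (v₁ + v₂) (v₁ + v₂)
    simp only [hcx, hcy, map_add, h11, h12, h21, h22] at this
    linarith
  have hc0 : c ≠ 0 := fun h0 => hx0 (hhnd x fun v => by rw [hcx, h0, zero_mul])
  have : c' = c := mul_left_cancel₀ hc0 (by rw [hcc, ← hc]; ring)
  exact ⟨c, hc, hcx, this ▸ hcy⟩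

/-- If all null vectors near `x` are eigenvectors of `h` relative to `g`, then `h = c g`. -/
theorem exists_eq_smul_of_null_eigen {g h : V →L[ℝ] V →L[ℝ] ℝ} (hg : ∀ x y, g x y = g y x)
    (hh : ∀ x y, h x y = h y x) {x z : V} (hxx : g x x = 0) (hzz : g z z = 0) (hxz : g x z = 1)
    (ha : ∃ a, g x a = 0 ∧ g a a ≠ 0)
    (H : ∀ w, g x w = 0 → g z w = 0 → ∀ᶠ t : ℝ in 𝓝[≠] 0, ∃ c, ∀ v,
      h (x + t • w - (t ^ 2 * g w w / 2) • z) v = c * g (x + t • w - (t ^ 2 * g w w / 2) • z) v)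
    {c : ℝ} (hc : ∀ v, h x v = c * g x v) (u v : V) : h u v = c * g u v := by
  have hzx : g z x = 1 := hg z x ▸ hxz
  have nonnull : ∀ w, g x w = 0 → g z w = 0 → g w w ≠ 0 →
      (∀ v, h w v = c * g w v) ∧ ∀ v, h z v = c * g z v := by
    intro w hxw hzw hww
    have hwx : g w x = 0 := hg w x ▸ hxw
    have hev : ∀ᶠ t : ℝ in 𝓝[≠] 0, ∀ v, h w v - c * g w v =
        t * (g w w / 2) * (h z v - c * g z v) := by
      filter_upwards [H w hxw hzw, self_mem_nhdsWithin] with t ⟨c', hc'⟩ ht v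
      have ht' : t ≠ 0 := ht
      -- Testing the eigenvector relation against x, itself an eigenvector with factor c, forces the
      -- factor at the nearby null vector to be c.
      have e1 := hc' x
      simp only [map_add, map_sub, map_smul, add_apply, sub_apply, smul_apply,
        smul_eq_mul, hh w x, hh z x, hc, hxx, hxw, hxz, hwx, hzx] at e1
      have hcc : c' = c := by
        have : t ^ 2 * g w w * (c' - c) = 0 := by linarith
        rcases mul_eq_zero.1 this with h1 | h1
        · exact absurd h1 (mul_ne_zero (pow_ne_zero 2 ht') hww)
        · linarith
      have e2 := hc' v
      simp only [map_add, map_sub, map_smul, add_apply, sub_apply, smul_apply,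
        smul_eq_mul, hc, hcc] at e2
      apply mul_left_cancel₀ ht'
      linarith
    have hz : ∀ v, h z v = c * g z v := by
      intro v
      -- The left side of `hev` does not depend on t while the right side tends to 0; so both
      -- vanish, and w and z are eigenvectors too.
      have hlim : Tendsto (fun t : ℝ => t * (g w w / 2) * (h z v - c * g z v)) (𝓝[≠] 0)
          (𝓝 (0 * (g w w / 2) * (h z v - c * g z v))) :=
        tendsto_nhdsWithin_of_tendsto_nhds (Continuous.tendsto (by fun_prop) 0)
      have h0 : h w v - c * g w v = 0 := by
        have := tendsto_nhds_unique (tendsto_const_nhds.congr' (hev.mono fun t ht => ht v)) hlim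
        rw [this]; ring
      obtain ⟨t, ht, ht0⟩ := (hev.and self_mem_nhdsWithin).exists
      have ht' : t ≠ 0 := ht0
      have := ht v
      rw [h0] at this
      have h3 := (mul_eq_zero.1 this.symm).resolve_left (by positivity)
      linarith
    refine ⟨fun v => ?_, hz⟩
    obtain ⟨t, ht⟩ := hev.exists
    have := ht v
    rw [hz v, sub_self, mul_zero] at this
    linarith
  obtain ⟨a, hxa, haa⟩ := ha
  set b := a - g z a • x
  have hb : g b b = g a a := by
    simp only [b, map_smul, map_sub, smul_apply, sub_apply, smul_eq_mul,
      hxx, hxa, hg a x]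
    ring
  have hxb : g x b = 0 := by
    simp only [b, map_smul, map_sub, smul_eq_mul, hxx, hxa]; ring
  have hzb : g z b = 0 := by
    simp only [b, map_smul, map_sub, smul_eq_mul, hzx]; ring
  rw [← hb] at haa
  obtain ⟨hB, hZ⟩ := nonnull b hxb hzb haa
  have perp : ∀ w, g x w = 0 → g z w = 0 → ∀ v, h w v = c * g w v := by
    intro w hxw hzw v
    -- The value of g on w + e b is a quadratic polynomial in e with leading coefficient g(b,b) ≠ 0,
    -- so it cannot vanish at all of 1, -1, 2.
    have split : ∀ e : ℝ, (e ≠ 0) → g (w + e • b) (w + e • b) ≠ 0 → h w v = c * g w v := by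
      intro e he hne
      have := (nonnull (w + e • b) (by simp [hxw, hxb]) (by simp [hzw, hzb]) hne).1 v
      simp only [map_add, map_smul, add_apply, smul_apply, smul_eq_mul,
        hB] at this
      linarith
    by_contra hcon
    have s1 := not_imp_comm.1 (split 1 one_ne_zero) hcon
    have s2 := not_imp_comm.1 (split (-1) (by norm_num)) hcon
    have s3 := not_imp_comm.1 (split 2 two_ne_zero) hcon
    simp only [map_add, map_smul, add_apply, smul_apply, smul_eq_mul,
      hg b w] at s1 s2 s3
    apply haa
    linarith
  set w := u - g x u • z - g z u • x with hw
  have hxw : g x w = 0 := by simp only [hw, map_smul, map_sub, smul_eq_mul, hxx, hxz]; ring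
  have hzw : g z w = 0 := by simp only [hw, map_smul, map_sub, smul_eq_mul, hzz, hzx]; ring
  have e : u = g x u • z + g z u • x + w := by rw [hw]; abel
  generalize g x u = α at e
  generalize g z u = β at e
  rw [e]
  simp only [map_add, map_smul, add_apply, smul_apply, smul_eq_mul,
    hc, hZ, perp w hxw hzw v]
  ring

end Pencil

/-! ### Levi-Civita connection and curvature of a metric on an open set of a vector space. -/

section LocalMetric

variable {E : Type*} [NormedAddCommGroup E] [NormedSpace ℝ E] [FiniteDimensional ℝ E]

lemma two_le_infty : (2 : WithTop ℕ∞) ≤ ∞ :=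
  WithTop.coe_le_coe.2 (le_top : (2 : ℕ∞) ≤ ⊤)

lemma one_add_one_le_infty : (1 + 1 : WithTop ℕ∞) ≤ ∞ :=
  WithTop.coe_le_coe.2 (le_top : (1 + 1 : ℕ∞) ≤ ⊤)

/-- The algebraic bilinear form underlying a continuous one. -/
def toBilin {V : Type*} [AddCommGroup V] [Module ℝ V] [TopologicalSpace V] [IsTopologicalAddGroup V]
    (B : V →L[ℝ] V →L[ℝ] ℝ) : LinearMap.BilinForm ℝ V :=
  LinearMap.mk₂ ℝ (fun x y => B x y) (by simp) (by simp) (by simp) (by simp)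

@[simp] lemma toBilin_apply (B : E →L[ℝ] E →L[ℝ] ℝ) (x y : E) : toBilin B x y = B x y := rfl

/-- `G` is a smooth pseudo-Riemannian metric on the open set `O` of a vector space. -/
structure IsMetricOn (G : E → E →L[ℝ] E →L[ℝ] ℝ) (O : Set E) : Prop where
  isOpen : IsOpen O
  contDiffOn : ContDiffOn ℝ ∞ G O
  symm : ∀ y ∈ O, ∀ u v, G y u v = G y v u
  nondeg : ∀ y ∈ O, ∀ u, (∀ v, G y u v = 0) → u = 0

/-- The equivalence with the dual space given by a nondegenerate form. -/
lemma exists_equiv_dual {B : E →L[ℝ] E →L[ℝ] ℝ} (hB : ∀ u, (∀ v, B u v = 0) → u = 0) :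
    ∃ e : E ≃L[ℝ] (E →L[ℝ] ℝ), (e : E →L[ℝ] E →L[ℝ] ℝ) = B := by
  have hinj : Function.Injective (B : E →ₗ[ℝ] E →L[ℝ] ℝ) := by
    rw [← LinearMap.ker_eq_bot, LinearMap.ker_eq_bot']
    intro u hu
    exact hB u fun v => by
      have := congrArg (fun f : E →L[ℝ] ℝ => f v) hu
      simpa using this
  have hdim : Module.finrank ℝ E = Module.finrank ℝ (E →L[ℝ] ℝ) := by
    rw [← LinearEquiv.finrank_eq (LinearMap.toContinuousLinearMap (𝕜 := ℝ) (E := E) (F' := ℝ))]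
    exact (Subspace.dual_finrank_eq (K := ℝ) (V := E)).symm
  refine ⟨(LinearEquiv.ofInjectiveOfFinrankEq _ hinj hdim).toContinuousLinearEquiv, ?_⟩
  ext u v
  rfl

/-- The Christoffel symbols as a field of bilinear maps. -/
def chr (G : E → E →L[ℝ] E →L[ℝ] ℝ) (y : E) : E →L[ℝ] E →L[ℝ] E :=
  (ContinuousLinearMap.compL ℝ E (E →L[ℝ] ℝ) E (G y).inverse).comp
    ((1 / 2 : ℝ) • (fderiv ℝ G y + (fderiv ℝ G y).flip -
      ((ContinuousLinearMap.flipₗᵢ ℝ E E ℝ).toContinuousLinearEquiv.toContinuousLinearMap.comp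
        (fderiv ℝ G y).flip)))

lemma christoffel_eq (G : E → E →L[ℝ] E →L[ℝ] ℝ) (y u v : E) : christoffel G y u v = chr G y u v :=
  rfl

namespace IsMetricOn

variable {G : E → E →L[ℝ] E →L[ℝ] ℝ} {O : Set E}

lemma apply_inverse (h : IsMetricOn G O) {y : E} (hy : y ∈ O) (l : E →L[ℝ] ℝ) :
    G y ((G y).inverse l) = l := by
  obtain ⟨e, he⟩ := exists_equiv_dual (h.nondeg y hy)
  rw [← he, ContinuousLinearMap.inverse_equiv]
  simp

lemma contDiffOn_inverse (h : IsMetricOn G O) : ContDiffOn ℝ ∞ (fun y => (G y).inverse) O := by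
  intro y hy
  obtain ⟨e, he⟩ := exists_equiv_dual (h.nondeg y hy)
  have h1 : ContDiffAt ℝ ∞ (ContinuousLinearMap.inverse : (E →L[ℝ] E →L[ℝ] ℝ) → _) (G y) := by
    rw [← he]; exact contDiffAt_map_inverse e
  exact h1.comp_contDiffWithinAt y (h.contDiffOn y hy)

lemma contDiffOn_fderiv (h : IsMetricOn G O) : ContDiffOn ℝ ∞ (fderiv ℝ G) O :=
  h.contDiffOn.fderiv_of_isOpen h.isOpen (by simp)

lemma contDiffOn_chr (h : IsMetricOn G O) : ContDiffOn ℝ ∞ (chr G) O := by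
  have hD := h.contDiffOn_fderiv
  have h1 : ContDiffOn ℝ ∞ (fun y => (fderiv ℝ G y).flip) O :=
    (ContinuousLinearMap.flipₗᵢ ℝ E E (E →L[ℝ] ℝ)).toContinuousLinearEquiv.contDiff.comp_contDiffOn
      hD
  have h2 : ContDiffOn ℝ ∞ (fun y => (1 / 2 : ℝ) • (fderiv ℝ G y + (fderiv ℝ G y).flip -
      ((ContinuousLinearMap.flipₗᵢ ℝ E E ℝ).toContinuousLinearEquiv.toContinuousLinearMap.comp
        (fderiv ℝ G y).flip))) O :=
    ((hD.add h1).sub (contDiffOn_const.clm_comp h1)).const_smul (1 / 2 : ℝ)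
  have h3 : ContDiffOn ℝ ∞ (fun y => ContinuousLinearMap.compL ℝ E (E →L[ℝ] ℝ) E (G y).inverse) O :=
    (ContinuousLinearMap.compL ℝ E (E →L[ℝ] ℝ) E).contDiff.comp_contDiffOn h.contDiffOn_inverse
  exact h3.clm_comp h2

lemma hasFDerivAt (h : IsMetricOn G O) {y : E} (hy : y ∈ O) : HasFDerivAt G (fderiv ℝ G y) y :=
  ((h.contDiffOn.differentiableOn (by simp)).differentiableAt (h.isOpen.mem_nhds hy)).hasFDerivAt

lemma hasFDerivAt_chr (h : IsMetricOn G O) {y : E} (hy : y ∈ O) :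
    HasFDerivAt (chr G) (fderiv ℝ (chr G) y) y :=
  ((h.contDiffOn_chr.differentiableOn (by simp)).differentiableAt
    (h.isOpen.mem_nhds hy)).hasFDerivAt

lemma fderiv_symm (h : IsMetricOn G O) {y : E} (hy : y ∈ O) (u v w : E) :
    fderiv ℝ G y u v w = fderiv ℝ G y u w v := by
  have h1 : (fun z => G z v w) =ᶠ[𝓝 y] fun z => G z w v := by
    filter_upwards [h.isOpen.mem_nhds hy] with z hz using h.symm z hz v w
  have e : ∀ v w, fderiv ℝ (fun z => G z v w) y u = fderiv ℝ G y u v w := fun v w => by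
    rw [(((h.hasFDerivAt hy).clm_apply (hasFDerivAt_const v y)).clm_apply
      (hasFDerivAt_const w y)).fderiv]
    simp
  rw [← e, ← e, h1.fderiv_eq]

lemma apply_chr (h : IsMetricOn G O) {y : E} (hy : y ∈ O) (u v w : E) :
    G y (chr G y u v) w =
      (1 / 2) * (fderiv ℝ G y u v w + fderiv ℝ G y v u w - fderiv ℝ G y w u v) := by
  rw [← christoffel_eq, christoffel, h.apply_inverse hy]
  simp

lemma eq_of_apply (h : IsMetricOn G O) {y : E} (hy : y ∈ O) {a b : E}
    (hab : ∀ w, G y a w = G y b w) : a = b := by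
  rw [← sub_eq_zero]
  refine h.nondeg y hy _ fun w => ?_
  rw [map_sub, sub_apply, hab, sub_self]

lemma chr_symm (h : IsMetricOn G O) {y : E} (hy : y ∈ O) (u v : E) : chr G y u v = chr G y v u := by
  refine h.eq_of_apply hy fun w => ?_
  rw [h.apply_chr hy, h.apply_chr hy, h.fderiv_symm hy w u v]
  ring

/-- The Levi-Civita connection is metric. -/
lemma fderiv_apply (h : IsMetricOn G O) {y : E} (hy : y ∈ O) (u v w : E) :
    fderiv ℝ G y u v w = G y (chr G y u v) w + G y v (chr G y u w) := by
  rw [h.symm y hy v, h.apply_chr hy, h.apply_chr hy, h.fderiv_symm hy u w v,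
    h.fderiv_symm hy w u v, h.fderiv_symm hy v u w]
  ring

lemma fderiv_chr_symm (h : IsMetricOn G O) {y : E} (hy : y ∈ O) (u v w : E) :
    fderiv ℝ (chr G) y u v w = fderiv ℝ (chr G) y u w v := by
  have h1 : (fun z => chr G z v w) =ᶠ[𝓝 y] fun z => chr G z w v := by
    filter_upwards [h.isOpen.mem_nhds hy] with z hz using h.chr_symm hz v w
  have e : ∀ v w, fderiv ℝ (fun z => chr G z v w) y u = fderiv ℝ (chr G) y u v w := fun v w => by
    rw [(((h.hasFDerivAt_chr hy).clm_apply (hasFDerivAt_const v y)).clm_apply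
      (hasFDerivAt_const w y)).fderiv]
    simp
  rw [← e, ← e, h1.fderiv_eq]

end IsMetricOn

/-- The curvature operator at a point as a trilinear map. -/
def curvL (G : E → E →L[ℝ] E →L[ℝ] ℝ) (y : E) : E →ₗ[ℝ] E →ₗ[ℝ] E →ₗ[ℝ] E :=
  LinearMap.mk₂ ℝ (fun u v => ((fderiv ℝ (chr G) y u v - fderiv ℝ (chr G) y v u +
      (chr G y u).comp (chr G y v) - (chr G y v).comp (chr G y u) : E →L[ℝ] E) : E →ₗ[ℝ] E))
    (fun u u' v => by ext w; simp; abel)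
    (fun c u v => by ext w; simp [smul_sub])
    (fun u v v' => by ext w; simp; abel)
    (fun c u v => by ext w; simp [smul_sub])

lemma curvL_apply (G : E → E →L[ℝ] E →L[ℝ] ℝ) (y u v w : E) :
    curvL G y u v w = fderiv ℝ (chr G) y u v w - fderiv ℝ (chr G) y v u w +
      chr G y u (chr G y v w) - chr G y v (chr G y u w) := rfl

namespace IsMetricOn

variable {G : E → E →L[ℝ] E →L[ℝ] ℝ} {O : Set E}

lemma localCurvature_eq (h : IsMetricOn G O) {y : E} (hy : y ∈ O) (u v w : E) :
    localCurvature G y u v w = curvL G y u v w := by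
  have e : ∀ u v, fderiv ℝ (fun z => christoffel G z v w) y u = fderiv ℝ (chr G) y u v w :=
    fun u v => by
      have := (((h.hasFDerivAt_chr hy).clm_apply (hasFDerivAt_const v y)).clm_apply
        (hasFDerivAt_const w y)).fderiv
      change fderiv ℝ (fun z => christoffel G z v w) y = _ at this
      rw [this]
      simp
  rw [localCurvature, e, e]
  rfl

/-- The second derivative of z ↦ G z w w is symmetric. Expanded with the metric property of the
connection, its antisymmetric part is 2 G(R(u,v)w, w). -/
lemma curv_skew (h : IsMetricOn G O) {y : E} (hy : y ∈ O) (u v w : E) :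
    G y (curvL G y u v w) w = 0 := by
  set φ : E → ℝ := fun z => G z w w
  have hφ : ContDiffAt ℝ ∞ φ y := (((h.contDiffOn.contDiffAt (h.isOpen.mem_nhds hy)).clm_apply
    contDiffAt_const).clm_apply contDiffAt_const)
  have hsym := (hφ.isSymmSndFDerivAt (by simpa using two_le_infty)) u v
  have hφ' : ∀ v, (fun z => fderiv ℝ φ z v) =ᶠ[𝓝 y] fun z => 2 * G z (chr G z v w) w := fun v => by
    filter_upwards [h.isOpen.mem_nhds hy] with z hz
    have := (((h.hasFDerivAt hz).clm_apply (hasFDerivAt_const w z)).clm_apply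
      (hasFDerivAt_const w z)).fderiv
    change fderiv ℝ φ z = _ at this
    rw [this]
    simp [h.fderiv_apply hz v w w, h.symm z hz w]
    ring
  have hd : ∀ u v, fderiv ℝ (fderiv ℝ φ) y u v =
      2 * (fderiv ℝ G y u (chr G y v w) w + G y (fderiv ℝ (chr G) y u v w) w) := by
    intro u v
    have h1 : DifferentiableAt ℝ (fderiv ℝ φ) y :=
      (hφ.fderiv_right (m := 1) one_add_one_le_infty).differentiableAt (by simp)
    have h2 := (h1.hasFDerivAt.clm_apply (hasFDerivAt_const v y)).fderiv
    rw [(hφ' v).fderiv_eq] at h2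
    have h3 := ((((h.hasFDerivAt hy).clm_apply (((h.hasFDerivAt_chr hy).clm_apply
      (hasFDerivAt_const v y)).clm_apply (hasFDerivAt_const w y))).clm_apply
      (hasFDerivAt_const w y)).const_mul 2).fderiv
    rw [h3] at h2
    have h4 := congrArg (fun L : E →L[ℝ] ℝ => L u) h2
    simp at h4
    linarith
  rw [hd, hd, h.fderiv_apply hy, h.fderiv_apply hy] at hsym
  rw [curvL_apply]
  simp only [map_add, map_sub, add_apply, sub_apply]
  rw [h.symm y hy (chr G y u w) (chr G y v w)] at hsym
  linarith

lemma isCurvatureLike (h : IsMetricOn G O) {y : E} (hy : y ∈ O) :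
    IsCurvatureLike (toBilin (G y)) (curvL G y) where
  antisymm u v w := by simp only [curvL_apply]; abel
  skew u v z w := by
    have := h.curv_skew hy u v (z + w)
    simp only [map_add, add_apply, h.curv_skew hy] at this
    simp only [toBilin_apply]
    linarith
  bianchi u v w := by
    simp only [curvL_apply, h.chr_symm hy u v, h.chr_symm hy u w, h.chr_symm hy v w,
      h.fderiv_chr_symm hy _ u v, h.fderiv_chr_symm hy _ u w, h.fderiv_chr_symm hy _ v w]
    abel

lemma fderiv_fderiv_chr_symm (h : IsMetricOn G O) {y : E} (hy : y ∈ O) (u v : E) :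
    fderiv ℝ (fderiv ℝ (chr G)) y u v = fderiv ℝ (fderiv ℝ (chr G)) y v u :=
  ((h.contDiffOn_chr.contDiffAt (h.isOpen.mem_nhds hy)).isSymmSndFDerivAt (by simpa using two_le_infty)) u v

lemma hasFDerivAt_fderiv_chr (h : IsMetricOn G O) {y : E} (hy : y ∈ O) :
    HasFDerivAt (fderiv ℝ (chr G)) (fderiv ℝ (fderiv ℝ (chr G)) y) y :=
  (((h.contDiffOn_chr.contDiffAt (h.isOpen.mem_nhds hy)).fderiv_right
    (m := 1) one_add_one_le_infty).differentiableAt (by simp)).hasFDerivAt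

lemma exists_hasFDerivAt_curvL (h : IsMetricOn G O) {y : E} (hy : y ∈ O) (x v z : E) :
    ∃ L : E →L[ℝ] E, HasFDerivAt (fun t => curvL G t x v z) L y ∧ ∀ u, L u =
      fderiv ℝ (fderiv ℝ (chr G)) y u x v z - fderiv ℝ (fderiv ℝ (chr G)) y u v x z +
      (fderiv ℝ (chr G) y u x (chr G y v z) + chr G y x (fderiv ℝ (chr G) y u v z)) -
      (fderiv ℝ (chr G) y u v (chr G y x z) + chr G y v (fderiv ℝ (chr G) y u x z)) := by
  have hΓ := h.hasFDerivAt_chr hy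
  have hD := h.hasFDerivAt_fderiv_chr hy
  have c : ∀ w : E, HasFDerivAt (fun _ : E => w) (0 : E →L[ℝ] E) y := fun w => hasFDerivAt_const w y
  have hΓ2 : ∀ a b, HasFDerivAt (fun t => chr G t a b) (((fderiv ℝ (chr G) y).flip a).flip b) y :=
    fun a b => ((hΓ.clm_apply (c a)).clm_apply (c b)).congr_fderiv (by ext; simp)
  have hD2 : ∀ a b, HasFDerivAt (fun t => fderiv ℝ (chr G) t a b z)
      ((((fderiv ℝ (fderiv ℝ (chr G)) y).flip a).flip b).flip z) y := fun a b =>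
    (((hD.clm_apply (c a)).clm_apply (c b)).clm_apply (c z)).congr_fderiv (by ext; simp)
  have hΓΓ : ∀ a b, HasFDerivAt (fun t => chr G t a (chr G t b z))
      (((fderiv ℝ (chr G) y).flip a).flip (chr G y b z) +
        (chr G y a).comp (((fderiv ℝ (chr G) y).flip b).flip z)) y := fun a b =>
    ((hΓ.clm_apply (c a)).clm_apply (hΓ2 b z)).congr_fderiv (by ext; simp [add_comm])
  exact ⟨_, (((hD2 x v).sub (hD2 v x)).add (hΓΓ x v)).sub (hΓΓ v x), fun u => by simp⟩

/-- The second Bianchi identity. -/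
lemma second_bianchi (h : IsMetricOn G O) {y : E} (hy : y ∈ O) (u x v z : E) :
    (fderiv ℝ (fun t => curvL G t x v z) y u + chr G y u (curvL G y x v z)
      - curvL G y x v (chr G y u z)) +
    (fderiv ℝ (fun t => curvL G t v u z) y x + chr G y x (curvL G y v u z)
      - curvL G y v u (chr G y x z)) +
    (fderiv ℝ (fun t => curvL G t u x z) y v + chr G y v (curvL G y u x z)
      - curvL G y u x (chr G y v z)) = 0 := by
  obtain ⟨L1, h1, e1⟩ := h.exists_hasFDerivAt_curvL hy x v z
  obtain ⟨L2, h2, e2⟩ := h.exists_hasFDerivAt_curvL hy v u z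
  obtain ⟨L3, h3, e3⟩ := h.exists_hasFDerivAt_curvL hy u x z
  -- Only the connection terms acting on z and on values occur: those of the form R(Γ(u,x), v)
  -- cancel in the cyclic sum because Γ is symmetric. The rest cancels by symmetry of second
  -- derivatives of Γ.
  rw [h1.fderiv, h2.fderiv, h3.fderiv, e1, e2, e3, h.fderiv_fderiv_chr_symm hy u x,
    h.fderiv_fderiv_chr_symm hy u v, h.fderiv_fderiv_chr_symm hy x v]
  simp only [curvL_apply, map_add, map_sub]
  abel

end IsMetricOn

end LocalMetric

/-! ### Curvature under conformal changes of the metric. -/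

section Conformal

variable {E : Type*} [NormedAddCommGroup E] [NormedSpace ℝ E] [FiniteDimensional ℝ E]
  {G G' : E → E →L[ℝ] E →L[ℝ] ℝ} {O : Set E}

namespace IsMetricOn

lemma hasFDerivAt_chr_apply (h : IsMetricOn G O) {y : E} (hy : y ∈ O) (v w : E) :
    HasFDerivAt (fun t => chr G t v w) (((fderiv ℝ (chr G) y).flip v).flip w) y :=
  (((h.hasFDerivAt_chr hy).clm_apply (hasFDerivAt_const v y)).clm_apply
    (hasFDerivAt_const w y)).congr_fderiv (by ext; simp)

/-- The curvature of a connection `Γ + ⟨·, a⟩ ⊗ id + id ⊗ ⟨·, a⟩ - ⟨·, ·⟩ ⊗ a`. -/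
lemma curvL_of_chr_eq (h : IsMetricOn G O) (h' : IsMetricOn G' O) {y : E} (hy : y ∈ O)
    {a : E → E} {a' : E →L[ℝ] E} (ha : HasFDerivAt a a' y)
    (hchr : ∀ t ∈ O, ∀ u v, chr G' t u v =
      chr G t u v + G t u (a t) • v + G t v (a t) • u - G t u v • a t)
    {H : E → E} (hH : ∀ u, H u = a' u + chr G y u (a y)) (u v w : E) :
    curvL G' y u v w = curvL G y u v w + (G y v (H u) - G y u (H v)) • w + G y w (H u) • v -
      G y w (H v) • u - G y v w • H u + G y u w • H v +
      (G y v (a y) * G y w (a y) - G y v w * G y (a y) (a y)) • u -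
      (G y u (a y) * G y w (a y) - G y u w * G y (a y) (a y)) • v +
      (G y u (a y) * G y v w - G y v (a y) * G y u w) • a y := by
  have hGa : ∀ v, HasFDerivAt (fun t => G t v (a t))
      ((G y v).comp a' + ((fderiv ℝ G y).flip v).flip (a y)) y := fun v =>
    (((h.hasFDerivAt hy).clm_apply (hasFDerivAt_const v y)).clm_apply ha).congr_fderiv
      (by ext; simp)
  have hGc : ∀ v w, HasFDerivAt (fun t => G t v w) (((fderiv ℝ G y).flip v).flip w) y :=
    fun v w => (((h.hasFDerivAt hy).clm_apply (hasFDerivAt_const v y)).clm_apply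
      (hasFDerivAt_const w y)).congr_fderiv (by ext; simp)
  have hd : ∀ u v w, fderiv ℝ (chr G') y u v w = fderiv ℝ (chr G) y u v w +
      (G y v (a' u) + fderiv ℝ G y u v (a y)) • w + (G y w (a' u) + fderiv ℝ G y u w (a y)) • v -
      (G y v w • a' u + fderiv ℝ G y u v w • a y) := by
    intro u v w
    have e1 := (h'.hasFDerivAt_chr_apply hy v w).fderiv
    have e2 : (fun t => chr G' t v w) =ᶠ[𝓝 y] fun t =>
        chr G t v w + G t v (a t) • w + G t w (a t) • v - G t v w • a t := by
      filter_upwards [h.isOpen.mem_nhds hy] with t ht using hchr t ht v w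
    have e3 := ((((h.hasFDerivAt_chr_apply hy v w).add ((hGa v).smul_const w)).add
      ((hGa w).smul_const v)).sub ((hGc v w).smul ha)).fderiv
    have e4 := e2.fderiv_eq (𝕜 := ℝ)
    rw [e1] at e4
    have e5 := congrArg (fun L : E →L[ℝ] E => L u) (e4.trans e3)
    simpa using e5
  simp only [curvL_apply, hd, hchr y hy, h.fderiv_apply hy, hH, map_add, map_sub, map_smul,
    add_apply, sub_apply, smul_apply, smul_eq_mul]
  simp only [h.symm y hy (a y) u, h.symm y hy (a y) v, h.symm y hy (a y) w, h.symm y hy w v,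
    h.symm y hy w u, h.symm y hy v u, h.chr_symm hy v u, h.symm y hy (chr G y u v),
    h.symm y hy (chr G y u w), h.symm y hy (chr G y v w)]
  module

lemma smul (h : IsMetricOn G O) {l : E → ℝ} (hl : ContDiffOn ℝ ∞ l O) (hl0 : ∀ y ∈ O, l y ≠ 0) :
    IsMetricOn (fun y => l y • G y) O where
  isOpen := h.isOpen
  contDiffOn := hl.smul h.contDiffOn
  symm y hy u v := by simp [h.symm y hy u v]
  nondeg y hy u hu := h.nondeg y hy u fun v => by
    have := hu v
    simpa [hl0 y hy] using this

/-- For l = e^{2σ} the field a is the gradient of σ. Only l ≠ 0 is required, because the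
proportionality factor between the two metrics has no sign a priori. -/
lemma chr_smul (h : IsMetricOn G O) {l : E → ℝ} (hl : ContDiffOn ℝ ∞ l O)
    (hl0 : ∀ y ∈ O, l y ≠ 0) {a : E → E}
    (ha : ∀ y ∈ O, ∀ u, 2 * l y * G y u (a y) = fderiv ℝ l y u) {t : E} (ht : t ∈ O) (u v : E) :
    chr (fun y => l y • G y) t u v =
      chr G t u v + G t u (a t) • v + G t v (a t) • u - G t u v • a t := by
  refine (h.smul hl hl0).eq_of_apply ht fun w => ?_
  rw [(h.smul hl hl0).apply_chr ht]
  have hd : fderiv ℝ (fun y => l y • G y) t = l t • fderiv ℝ G t + (fderiv ℝ l t).smulRight (G t) :=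
    (((hl.differentiableOn (by simp)).differentiableAt (h.isOpen.mem_nhds ht)).hasFDerivAt.smul
      (h.hasFDerivAt ht)).fderiv
  rw [hd]
  simp only [add_apply, smul_apply, ContinuousLinearMap.smulRight_apply, smul_eq_mul, map_add,
    map_sub, map_smul, sub_apply, ← ha t ht, h.apply_chr ht]
  rw [h.symm t ht (a t) w]
  ring

/-- The gradient field `∇l / (2 l)`. -/
lemma exists_half_log_gradient (h : IsMetricOn G O) {l : E → ℝ} (hl : ContDiffOn ℝ ∞ l O)
    (hl0 : ∀ y ∈ O, l y ≠ 0) : ∃ a : E → E, ContDiffOn ℝ ∞ a O ∧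
      ∀ y ∈ O, ∀ u, 2 * l y * G y u (a y) = fderiv ℝ l y u := by
  refine ⟨fun y => (G y).inverse ((2 * l y)⁻¹ • fderiv ℝ l y), ?_, fun y hy u => ?_⟩
  · exact h.contDiffOn_inverse.clm_apply (((contDiffOn_const.mul hl).inv fun y hy =>
      mul_ne_zero two_ne_zero (hl0 y hy)).smul (hl.fderiv_of_isOpen h.isOpen (by simp)))
  · rw [h.symm y hy, h.apply_inverse hy, smul_apply, smul_eq_mul, ← mul_assoc,
      mul_inv_cancel₀ (mul_ne_zero two_ne_zero (hl0 y hy)), one_mul]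

/-- On isotropic pairs the curvature form rescales like the metric under a conformal change. -/
lemma curv_smul_isotropic (h : IsMetricOn G O) {l : E → ℝ} (hl : ContDiffOn ℝ ∞ l O)
    (hl0 : ∀ y ∈ O, l y ≠ 0) {y : E} (hy : y ∈ O) {u v : E} (huu : G y u u = 0)
    (huv : G y u v = 0) (hvv : G y v v = 0) :
    G y (curvL (fun y => l y • G y) y u v v) u = G y (curvL G y u v v) u := by
  obtain ⟨a, ha, hal⟩ := h.exists_half_log_gradient hl hl0
  have hd := ((ha.differentiableOn (by simp)).differentiableAt (h.isOpen.mem_nhds hy)).hasFDerivAt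
  rw [h.curvL_of_chr_eq (h.smul hl hl0) hy hd (fun t ht u v => h.chr_smul hl hl0 hal ht u v)
    (fun u => rfl) u v v]
  simp only [add_apply, smul_apply, smul_eq_mul, map_add, map_sub, map_smul, sub_apply, huu, huv,
    hvv, h.symm y hy v u]
  ring

/-- A solution of the prolonged conformal-flatness system makes `τ⁻² G` flat. -/
lemma curvL_conformal_eq_zero (h : IsMetricOn G O) {τ : E → ℝ} (hτ : ContDiffOn ℝ ∞ τ O)
    (hτ0 : ∀ y ∈ O, τ y ≠ 0) {m : E → E} (hm : ∀ y ∈ O, ∀ u, fderiv ℝ τ y u = G y u (m y))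
    {y : E} (hy : y ∈ O) {S : E →ₗ[ℝ] E} (hS : ∀ u v, G y (S u) v = G y (S v) u)
    (hR : curvL G y = kulkarniNomizu (toBilin (G y)) S) {ρ : ℝ} {m' : E →L[ℝ] E}
    (hm' : HasFDerivAt m m' y) (hm'' : ∀ u, m' u = -chr G y u (m y) - τ y • S u - ρ • u)
    (hρ : 2 * ρ * τ y + G y (m y) (m y) = 0) (u v w : E) :
    curvL (fun y => (τ y ^ 2)⁻¹ • G y) y u v w = 0 := by
  have hl : ContDiffOn ℝ ∞ (fun y => (τ y ^ 2)⁻¹) O :=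
    (hτ.pow 2).inv fun y hy => pow_ne_zero 2 (hτ0 y hy)
  have hl0 : ∀ y ∈ O, (τ y ^ 2)⁻¹ ≠ 0 := fun y hy => inv_ne_zero (pow_ne_zero 2 (hτ0 y hy))
  have hτd : ∀ y ∈ O, HasFDerivAt τ (fderiv ℝ τ y) y := fun y hy =>
    ((hτ.differentiableOn (by simp)).differentiableAt (h.isOpen.mem_nhds hy)).hasFDerivAt
  have hd : HasFDerivAt (fun y => -((τ y)⁻¹ • m y))
      (-((τ y)⁻¹ • m' + (-(τ y ^ 2)⁻¹ • fderiv ℝ τ y).smulRight (m y))) y :=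
    (((hasDerivAt_inv (hτ0 y hy)).comp_hasFDerivAt y (hτd y hy)).smul hm').neg
  have hal : ∀ y ∈ O, ∀ u, 2 * (τ y ^ 2)⁻¹ * G y u (-((τ y)⁻¹ • m y)) =
      fderiv ℝ (fun y => (τ y ^ 2)⁻¹) y u := by
    intro z hz u
    have hz0 := hτ0 z hz
    have e := ((hasDerivAt_inv (pow_ne_zero 2 hz0)).comp_hasFDerivAt z ((hτd z hz).pow 2)).fderiv
    change fderiv ℝ (fun y => (τ y ^ 2)⁻¹) z = _ at e
    rw [e]
    simp only [smul_apply, smul_eq_mul, map_neg, map_smul, hm z hz]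
    simp
    field_simp
  have t0 := hτ0 y hy
  -- The first integral 2ρτ + |m|² = 0, rewritten for a = -m/τ.
  have hk : G y (-((τ y)⁻¹ • m y)) (-((τ y)⁻¹ • m y)) = -2 * (ρ / τ y) := by
    simp only [map_neg, map_smul, neg_apply, smul_apply, smul_eq_mul]
    field_simp
    linear_combination hρ
  -- H is the covariant derivative of a = -m/τ, the gradient of -log |τ|: the equation for m turns
  -- it into S + (ρ/τ) id + ⟨·, a⟩ a. The S terms then cancel the curvature of G.
  rw [h.curvL_of_chr_eq (h.smul hl hl0) hy hd (fun t ht u v => h.chr_smul hl hl0 hal ht u v)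
    (H := fun u => S u + (ρ / τ y) • u + G y u (-((τ y)⁻¹ • m y)) • (-((τ y)⁻¹ • m y))) (fun u => by
      simp only [neg_apply, add_apply, smul_apply, ContinuousLinearMap.smulRight_apply, hm'',
        hm y hy, map_neg, map_smul, smul_eq_mul, smul_sub, smul_neg, smul_smul, neg_smul]
      rw [inv_mul_cancel₀ t0, inv_mul_eq_div]
      have : (τ y ^ 2)⁻¹ * G y u (m y) = (τ y)⁻¹ * G y u (m y) * (τ y)⁻¹ := by
        field_simp
      rw [neg_mul, this]
      module) u v w, hR, hk]
  generalize ρ / τ y = k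
  generalize -((τ y)⁻¹ • m y) = A
  simp only [kulkarniNomizu_apply, toBilin_apply, map_add, map_smul, smul_eq_mul,
    h.symm y hy v (S u), h.symm y hy u (S v), hS v u, h.symm y hy w (S u), h.symm y hy w (S v),
    h.symm y hy w u, h.symm y hy w v, h.symm y hy v u]
  module

end IsMetricOn

end Conformal

/-! ### Invariance of the curvature under local isometries. -/

section Naturality

variable {E : Type*} [NormedAddCommGroup E] [NormedSpace ℝ E] [FiniteDimensional ℝ E]
  {G₁ G₂ : E → E →L[ℝ] E →L[ℝ] ℝ} {O₁ O₂ : Set E} {ψ : E → E}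

/-- `ψ` is a smooth map pulling the metric `G₂` on `O₂` back to the metric `G₁` on `O₁`. -/
structure IsLocalIsometryOn (G₁ G₂ : E → E →L[ℝ] E →L[ℝ] ℝ) (O₁ O₂ : Set E) (ψ : E → E) :
    Prop where
  left : IsMetricOn G₁ O₁
  right : IsMetricOn G₂ O₂
  contDiffOn : ContDiffOn ℝ ∞ ψ O₁
  mapsTo : Set.MapsTo ψ O₁ O₂
  pullback : ∀ t ∈ O₁, ∀ u v, G₁ t u v = G₂ (ψ t) (fderiv ℝ ψ t u) (fderiv ℝ ψ t v)

namespace IsLocalIsometryOn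

lemma hasFDerivAt (h : IsLocalIsometryOn G₁ G₂ O₁ O₂ ψ) {t : E} (ht : t ∈ O₁) :
    HasFDerivAt ψ (fderiv ℝ ψ t) t :=
  ((h.contDiffOn.differentiableOn (by simp)).differentiableAt
    (h.left.isOpen.mem_nhds ht)).hasFDerivAt

lemma contDiffOn_fderiv (h : IsLocalIsometryOn G₁ G₂ O₁ O₂ ψ) :
    ContDiffOn ℝ ∞ (fderiv ℝ ψ) O₁ :=
  h.contDiffOn.fderiv_of_isOpen h.left.isOpen (by simp)

lemma hasFDerivAt_fderiv (h : IsLocalIsometryOn G₁ G₂ O₁ O₂ ψ) {t : E} (ht : t ∈ O₁) :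
    HasFDerivAt (fderiv ℝ ψ) (fderiv ℝ (fderiv ℝ ψ) t) t :=
  ((h.contDiffOn_fderiv.differentiableOn (by simp)).differentiableAt
    (h.left.isOpen.mem_nhds ht)).hasFDerivAt

lemma hasFDerivAt_fderiv_fderiv (h : IsLocalIsometryOn G₁ G₂ O₁ O₂ ψ) {t : E} (ht : t ∈ O₁) :
    HasFDerivAt (fderiv ℝ (fderiv ℝ ψ)) (fderiv ℝ (fderiv ℝ (fderiv ℝ ψ)) t) t :=
  (((h.contDiffOn_fderiv.fderiv_of_isOpen h.left.isOpen (m := ∞) (by simp)).differentiableOn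
    (by simp)).differentiableAt (h.left.isOpen.mem_nhds ht)).hasFDerivAt

lemma fderiv_fderiv_symm (h : IsLocalIsometryOn G₁ G₂ O₁ O₂ ψ) {t : E} (ht : t ∈ O₁) (u v : E) :
    fderiv ℝ (fderiv ℝ ψ) t u v = fderiv ℝ (fderiv ℝ ψ) t v u :=
  ((h.contDiffOn.contDiffAt (h.left.isOpen.mem_nhds ht)).isSymmSndFDerivAt
    (by simpa using two_le_infty)) u v

lemma fderiv_fderiv_fderiv_symm (h : IsLocalIsometryOn G₁ G₂ O₁ O₂ ψ) {t : E} (ht : t ∈ O₁)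
    (u v : E) :
    fderiv ℝ (fderiv ℝ (fderiv ℝ ψ)) t u v = fderiv ℝ (fderiv ℝ (fderiv ℝ ψ)) t v u :=
  ((h.contDiffOn_fderiv.contDiffAt (h.left.isOpen.mem_nhds ht)).isSymmSndFDerivAt
    (by simpa using two_le_infty)) u v

lemma surjective_fderiv (h : IsLocalIsometryOn G₁ G₂ O₁ O₂ ψ) {t : E} (ht : t ∈ O₁) :
    Function.Surjective (fderiv ℝ ψ t) := by
  have hinj : Function.Injective (fderiv ℝ ψ t : E →ₗ[ℝ] E) := by
    rw [← LinearMap.ker_eq_bot, LinearMap.ker_eq_bot']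
    intro u hu
    refine h.left.nondeg t ht u fun v => ?_
    have hu' : fderiv ℝ ψ t u = 0 := hu
    rw [h.pullback t ht, hu', map_zero, zero_apply]
  exact LinearMap.surjective_of_injective hinj

lemma fderiv_pullback (h : IsLocalIsometryOn G₁ G₂ O₁ O₂ ψ) {t : E} (ht : t ∈ O₁) (u v w : E) :
    fderiv ℝ G₁ t u v w =
      fderiv ℝ G₂ (ψ t) (fderiv ℝ ψ t u) (fderiv ℝ ψ t v) (fderiv ℝ ψ t w) +
      G₂ (ψ t) (fderiv ℝ (fderiv ℝ ψ) t u v) (fderiv ℝ ψ t w) +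
      G₂ (ψ t) (fderiv ℝ ψ t v) (fderiv ℝ (fderiv ℝ ψ) t u w) := by
  have e1 := (((h.left.hasFDerivAt ht).clm_apply (hasFDerivAt_const v t)).clm_apply
    (hasFDerivAt_const w t)).fderiv
  have hψ2 := h.hasFDerivAt_fderiv ht
  have e2 := ((((h.right.hasFDerivAt (h.mapsTo ht)).comp t (h.hasFDerivAt ht)).clm_apply
    (hψ2.clm_apply (hasFDerivAt_const v t))).clm_apply
    (hψ2.clm_apply (hasFDerivAt_const w t))).fderiv
  have e3 : (fun z => G₁ z v w) =ᶠ[𝓝 t]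
      fun z => (G₂ ∘ ψ) z (fderiv ℝ ψ z v) (fderiv ℝ ψ z w) := by
    filter_upwards [h.left.isOpen.mem_nhds ht] with z hz using h.pullback z hz v w
  have e4 := e3.fderiv_eq (𝕜 := ℝ)
  rw [e1, e2] at e4
  have e5 := congrArg (fun L : E →L[ℝ] ℝ => L u) e4
  simp at e5
  rw [e5]
  ring

/-- The transformation law of Christoffel symbols: in the Koszul formula for the pullback, the
second derivatives of ψ combine into one term by symmetry. -/
lemma fderiv_chr_pullback (h : IsLocalIsometryOn G₁ G₂ O₁ O₂ ψ) {t : E} (ht : t ∈ O₁) (u v : E) :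
    fderiv ℝ ψ t (chr G₁ t u v) =
      chr G₂ (ψ t) (fderiv ℝ ψ t u) (fderiv ℝ ψ t v) + fderiv ℝ (fderiv ℝ ψ) t u v := by
  refine h.right.eq_of_apply (h.mapsTo ht) fun w' => ?_
  obtain ⟨w, rfl⟩ := h.surjective_fderiv ht w'
  rw [← h.pullback t ht, h.left.apply_chr ht, map_add, add_apply,
    h.right.apply_chr (h.mapsTo ht), h.fderiv_pullback ht, h.fderiv_pullback ht,
    h.fderiv_pullback ht, h.fderiv_fderiv_symm ht v u, h.fderiv_fderiv_symm ht w u,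
    h.fderiv_fderiv_symm ht w v]
  rw [h.right.symm _ (h.mapsTo ht) (fderiv ℝ ψ t v) (fderiv ℝ (fderiv ℝ ψ) t u w)]
  ring

/-- The curvature operator is natural under local isometries. -/
theorem map_curvL (h : IsLocalIsometryOn G₁ G₂ O₁ O₂ ψ) {t : E} (ht : t ∈ O₁) (u v w : E) :
    fderiv ℝ ψ t (curvL G₁ t u v w) =
      curvL G₂ (ψ t) (fderiv ℝ ψ t u) (fderiv ℝ ψ t v) (fderiv ℝ ψ t w) := by
  have hψ2 := h.hasFDerivAt_fderiv ht
  have hψ3 := h.hasFDerivAt_fderiv_fderiv ht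
  have hΓ2 := (h.right.hasFDerivAt_chr (h.mapsTo ht)).comp t (h.hasFDerivAt ht)
  -- Derivative of the transformation law. Antisymmetrization in u, v removes the third derivatives
  -- of ψ, and the terms with second derivatives cancel against the quadratic terms in Γ.
  have hd : ∀ u v w, fderiv ℝ ψ t (fderiv ℝ (chr G₁) t u v w) =
      fderiv ℝ (chr G₂) (ψ t) (fderiv ℝ ψ t u) (fderiv ℝ ψ t v) (fderiv ℝ ψ t w) +
      chr G₂ (ψ t) (fderiv ℝ (fderiv ℝ ψ) t u v) (fderiv ℝ ψ t w) +
      chr G₂ (ψ t) (fderiv ℝ ψ t v) (fderiv ℝ (fderiv ℝ ψ) t u w) +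
      fderiv ℝ (fderiv ℝ (fderiv ℝ ψ)) t u v w -
      fderiv ℝ (fderiv ℝ ψ) t u (chr G₁ t v w) := by
    intro u v w
    have e1 := (hψ2.clm_apply (h.left.hasFDerivAt_chr_apply ht v w)).fderiv
    have e2 := (((hΓ2.clm_apply (hψ2.clm_apply (hasFDerivAt_const v t))).clm_apply
      (hψ2.clm_apply (hasFDerivAt_const w t))).add
      ((hψ3.clm_apply (hasFDerivAt_const v t)).clm_apply (hasFDerivAt_const w t))).fderiv
    have e3 : (fun z => fderiv ℝ ψ z (chr G₁ z v w)) =ᶠ[𝓝 t] fun z =>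
        (chr G₂ ∘ ψ) z (fderiv ℝ ψ z v) (fderiv ℝ ψ z w) + fderiv ℝ (fderiv ℝ ψ) z v w := by
      filter_upwards [h.left.isOpen.mem_nhds ht] with z hz using h.fderiv_chr_pullback hz v w
    have e4 := e3.fderiv_eq (𝕜 := ℝ)
    rw [e1] at e4
    have e5 := congrArg (fun L : E →L[ℝ] E => L u) (e4.trans e2)
    simp at e5
    rw [eq_sub_iff_add_eq, e5]
    abel
  simp only [curvL_apply, map_add, map_sub, hd, h.fderiv_chr_pullback ht,
    h.fderiv_fderiv_symm ht v u, h.fderiv_fderiv_fderiv_symm ht v u]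
  abel

end IsLocalIsometryOn

end Naturality

/-! ### Ricci form, Schouten endomorphism and Cotton tensor. -/

section Schouten

variable {E : Type*} [NormedAddCommGroup E] [NormedSpace ℝ E] [FiniteDimensional ℝ E]
  {X : Type*} [NormedAddCommGroup X] [NormedSpace ℝ X] [FiniteDimensional ℝ X]
  {Y : Type*} [NormedAddCommGroup Y] [NormedSpace ℝ Y]

/-- A bilinear map between finite-dimensional spaces, as a continuous bilinear map. -/
def contBilin (B : E →ₗ[ℝ] X →ₗ[ℝ] Y) : E →L[ℝ] X →L[ℝ] Y :=
  LinearMap.toContinuousLinearMap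
    ((LinearMap.toContinuousLinearMap : (X →ₗ[ℝ] Y) ≃ₗ[ℝ] (X →L[ℝ] Y)).toLinearMap ∘ₗ B)

lemma contDiffOn_trace {O : Set E} {L : E → X →ₗ[ℝ] X}
    (hL : ∀ x, ContDiffOn ℝ ∞ (fun y => L y x) O) :
    ContDiffOn ℝ ∞ (fun y => LinearMap.trace ℝ X (L y)) O := by
  set b := Module.finBasis ℝ X
  have e : ∀ y, LinearMap.trace ℝ X (L y) =
      ∑ i, (LinearMap.toContinuousLinearMap (b.coord i)) (L y (b i)) := fun y => by
    rw [LinearMap.trace_eq_matrix_trace ℝ b, Matrix.trace]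
    simp [LinearMap.toMatrix_apply]
  simp only [e]
  exact ContDiffOn.sum fun i _ => (ContinuousLinearMap.contDiff _).comp_contDiffOn (hL (b i))

variable {G : E → E →L[ℝ] E →L[ℝ] ℝ} {O : Set E}

/-- The symmetrized Ricci form. -/
def ricciForm (G : E → E →L[ℝ] E →L[ℝ] ℝ) (y : E) : E →L[ℝ] E →L[ℝ] ℝ :=
  contBilin (LinearMap.mk₂ ℝ (fun v w =>
    (1 / 2 : ℝ) * (LinearMap.trace ℝ E (((curvL G y).flip v).flip w) +
      LinearMap.trace ℝ E (((curvL G y).flip w).flip v)))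
    (fun v v' w => by
      have e1 : ((curvL G y).flip (v + v')).flip w =
        ((curvL G y).flip v).flip w + ((curvL G y).flip v').flip w := by ext; simp
      have e2 : ((curvL G y).flip w).flip (v + v') =
        ((curvL G y).flip w).flip v + ((curvL G y).flip w).flip v' := by ext; simp
      rw [e1, e2, map_add, map_add]; ring)
    (fun c v w => by
      have e1 : ((curvL G y).flip (c • v)).flip w = c • ((curvL G y).flip v).flip w := by ext; simp
      have e2 : ((curvL G y).flip w).flip (c • v) = c • ((curvL G y).flip w).flip v := by ext; simp
      rw [e1, e2, map_smul, map_smul, smul_eq_mul, smul_eq_mul, smul_eq_mul]; ring)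
    (fun v w w' => by
      have e1 : ((curvL G y).flip (w + w')).flip v =
        ((curvL G y).flip w).flip v + ((curvL G y).flip w').flip v := by ext; simp
      have e2 : ((curvL G y).flip v).flip (w + w') =
        ((curvL G y).flip v).flip w + ((curvL G y).flip v).flip w' := by ext; simp
      rw [e1, e2, map_add, map_add]; ring)
    (fun c v w => by
      have e1 : ((curvL G y).flip (c • w)).flip v = c • ((curvL G y).flip w).flip v := by ext; simp
      have e2 : ((curvL G y).flip v).flip (c • w) = c • ((curvL G y).flip v).flip w := by ext; simp
      rw [e1, e2, map_smul, map_smul, smul_eq_mul, smul_eq_mul, smul_eq_mul]; ring))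

lemma ricciForm_apply (y v w : E) : ricciForm G y v w =
    (1 / 2 : ℝ) * (LinearMap.trace ℝ E (((curvL G y).flip v).flip w) +
      LinearMap.trace ℝ E (((curvL G y).flip w).flip v)) := rfl

/-- The Schouten endomorphism. -/
def schouten (G : E → E →L[ℝ] E →L[ℝ] ℝ) (y : E) : E →L[ℝ] E :=
  ((Module.finrank ℝ E : ℝ) - 2)⁻¹ • ((G y).inverse.comp (ricciForm G y) -
    (LinearMap.trace ℝ E ((G y).inverse.comp (ricciForm G y) : E →L[ℝ] E) /
      (2 * ((Module.finrank ℝ E : ℝ) - 1))) • ContinuousLinearMap.id ℝ E)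

namespace IsMetricOn

lemma contDiffOn_curvL (h : IsMetricOn G O) (u v w : E) :
    ContDiffOn ℝ ∞ (fun y => curvL G y u v w) O := by
  have hΓ := h.contDiffOn_chr
  have hD : ContDiffOn ℝ ∞ (fderiv ℝ (chr G)) O := hΓ.fderiv_of_isOpen h.isOpen (by simp)
  have c : ∀ z : E, ContDiffOn ℝ ∞ (fun _ : E => z) O := fun z => contDiffOn_const
  have hΓ2 : ∀ a b, ContDiffOn ℝ ∞ (fun y => chr G y a b) O := fun a b =>
    (hΓ.clm_apply (c a)).clm_apply (c b)
  have hD2 : ∀ a b, ContDiffOn ℝ ∞ (fun y => fderiv ℝ (chr G) y a b w) O := fun a b =>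
    ((hD.clm_apply (c a)).clm_apply (c b)).clm_apply (c w)
  exact (((hD2 u v).sub (hD2 v u)).add ((hΓ.clm_apply (c u)).clm_apply (hΓ2 v w))).sub
    ((hΓ.clm_apply (c v)).clm_apply (hΓ2 u w))

lemma contDiffOn_ricciForm (h : IsMetricOn G O) : ContDiffOn ℝ ∞ (ricciForm G) O := by
  rw [contDiffOn_clm_apply]
  intro v
  rw [contDiffOn_clm_apply]
  intro w
  simp only [ricciForm_apply]
  exact contDiffOn_const.mul ((contDiffOn_trace fun x => h.contDiffOn_curvL x v w).add
    (contDiffOn_trace fun x => h.contDiffOn_curvL x w v))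

lemma contDiffOn_schouten (h : IsMetricOn G O) : ContDiffOn ℝ ∞ (schouten G) O := by
  have h1 : ContDiffOn ℝ ∞ (fun y => (G y).inverse.comp (ricciForm G y)) O :=
    h.contDiffOn_inverse.clm_comp h.contDiffOn_ricciForm
  have h2 : ContDiffOn ℝ ∞ (fun y =>
      LinearMap.trace ℝ E ((G y).inverse.comp (ricciForm G y) : E →L[ℝ] E)) O :=
    contDiffOn_trace fun x => h1.clm_apply contDiffOn_const
  exact (h1.sub ((h2.div_const _).smul contDiffOn_const)).const_smul _

/-- Self-adjointness is built in, because `ricciForm` is symmetrized by definition. -/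
lemma schouten_symm (h : IsMetricOn G O) {y : E} (hy : y ∈ O) (u v : E) :
    G y (schouten G y u) v = G y (schouten G y v) u := by
  have e : ∀ u v, G y ((G y).inverse (ricciForm G y u)) v = ricciForm G y u v := fun u v => by
    rw [h.apply_inverse hy]
  simp only [schouten, smul_apply, sub_apply, ContinuousLinearMap.comp_apply, map_smul, map_sub,
    ContinuousLinearMap.id_apply, e, h.symm y hy u v]
  rw [ricciForm_apply, ricciForm_apply]
  ring_nf

/-- If the curvature vanishes on isotropic planes, it is the Kulkarni–Nomizu product of the metric
with the Schouten endomorphism. -/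
lemma curvL_eq_kulkarniNomizu (h : IsMetricOn G O) {y : E} (hy : y ∈ O)
    (hsi : StronglyIndefinite (toBilin (G y))) (hn : 2 < Module.finrank ℝ E)
    (h0 : ∀ x z, G y x x = 0 → G y x z = 0 → G y z z = 0 → G y (curvL G y x z z) x = 0) :
    curvL G y = kulkarniNomizu (toBilin (G y)) (schouten G y) := by
  refine (h.isCurvatureLike hy).eq_kulkarniNomizu (h.symm y hy) (h.nondeg y hy) hsi hn h0
    (h.schouten_symm hy) fun x => ?_
  have h3 : (2 : ℝ) < Module.finrank ℝ E := by exact_mod_cast hn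
  have h4 : (Module.finrank ℝ E : ℝ) - 2 ≠ 0 := by linarith
  have h5 : (Module.finrank ℝ E : ℝ) - 1 ≠ 0 := by linarith
  have e : G y ((G y).inverse (ricciForm G y x)) x =
      LinearMap.trace ℝ E (((curvL G y).flip x).flip x) := by
    rw [h.apply_inverse hy, ricciForm_apply]; ring
  -- The normalization of `schouten` is chosen so that its trace is scal/(2(n-1)), which inverts Ric
  -- = (n-2) S + (tr S) g.
  have t : LinearMap.trace ℝ E (schouten G y : E →L[ℝ] E) =
      LinearMap.trace ℝ E ((G y).inverse.comp (ricciForm G y) : E →L[ℝ] E) /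
        (2 * ((Module.finrank ℝ E : ℝ) - 1)) := by
    simp only [schouten, ContinuousLinearMap.toLinearMap_smul, ContinuousLinearMap.toLinearMap_sub,
      ContinuousLinearMap.coe_id, map_smul, map_sub, LinearMap.trace_id, smul_eq_mul]
    field_simp
    ring
  rw [t]
  simp only [toBilin_apply, ContinuousLinearMap.coe_coe]
  simp only [schouten, smul_apply, sub_apply, ContinuousLinearMap.comp_apply, map_smul, map_sub,
    ContinuousLinearMap.id_apply, e, smul_eq_mul]
  field_simp
  ring

lemma hasFDerivAt_schouten (h : IsMetricOn G O) {y : E} (hy : y ∈ O) :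
    HasFDerivAt (schouten G) (fderiv ℝ (schouten G) y) y :=
  ((h.contDiffOn_schouten.differentiableOn (by simp)).differentiableAt
    (h.isOpen.mem_nhds hy)).hasFDerivAt

/-- The Cotton tensor vanishes when the curvature is a Kulkarni–Nomizu product, in dimension at
least four. -/
lemma cotton (h : IsMetricOn G O) (hn : 3 < Module.finrank ℝ E)
    (hR : ∀ t ∈ O, curvL G t = kulkarniNomizu (toBilin (G t)) (schouten G t)) {y : E} (hy : y ∈ O)
    (u x : E) : fderiv ℝ (schouten G) y u x + chr G y u (schouten G y x) =
      fderiv ℝ (schouten G) y x u + chr G y x (schouten G y u) := by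
  set S := schouten G with hS
  let C : E →ₗ[ℝ] E →ₗ[ℝ] E := LinearMap.mk₂ ℝ
    (fun u x => fderiv ℝ S y u x + chr G y u (S y x) - fderiv ℝ S y x u - chr G y x (S y u))
    (fun u u' x => by simp only [map_add, add_apply]; abel)
    (fun c u x => by simp only [map_smul, smul_apply, smul_add, smul_sub])
    (fun u x x' => by simp only [map_add, add_apply]; abel)
    (fun c u x => by simp only [map_smul, smul_apply, smul_add, smul_sub])
  have hC : ∀ u x, C u x =
    fderiv ℝ S y u x + chr G y u (S y x) - fderiv ℝ S y x u - chr G y x (S y u) := fun _ _ => rfl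
  have hd : ∀ u x v z, fderiv ℝ (fun t => curvL G t x v z) y u =
      (fderiv ℝ G y u v z) • S y x + G y v z • fderiv ℝ S y u x +
      (fderiv ℝ G y u (S y v) z + G y (fderiv ℝ S y u v) z) • x -
      ((fderiv ℝ G y u x z) • S y v + G y x z • fderiv ℝ S y u v) -
      (fderiv ℝ G y u (S y x) z + G y (fderiv ℝ S y u x) z) • v := by
    intro u x v z
    have e1 : (fun t => curvL G t x v z) =ᶠ[𝓝 y] fun t =>
        G t v z • S t x + G t (S t v) z • x - G t x z • S t v - G t (S t x) z • v := by
      filter_upwards [h.isOpen.mem_nhds hy] with t ht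
      rw [hR t ht]; rfl
    have hSa : ∀ x, HasFDerivAt (fun t => S t x) ((fderiv ℝ S y).flip x) y := fun x =>
      ((h.hasFDerivAt_schouten hy).clm_apply (hasFDerivAt_const x y)).congr_fderiv (by ext; simp [hS])
    have hGa : ∀ v z, HasFDerivAt (fun t => G t v z) (((fderiv ℝ G y).flip v).flip z) y :=
      fun v z => (((h.hasFDerivAt hy).clm_apply (hasFDerivAt_const v y)).clm_apply
        (hasFDerivAt_const z y)).congr_fderiv (by ext; simp)
    have hGS : ∀ v, HasFDerivAt (fun t => G t (S t v) z)
        (((fderiv ℝ G y).flip (S y v)).flip z + ((G y).flip z).comp ((fderiv ℝ S y).flip v)) y :=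
      fun v => (((h.hasFDerivAt hy).clm_apply (hSa v)).clm_apply
        (hasFDerivAt_const z y)).congr_fderiv (by ext; simp [add_comm])
    have e2 := (((((hGa v z).smul (hSa x)).add ((hGS v).smul_const x)).sub
      ((hGa x z).smul (hSa v))).sub ((hGS x).smul_const v)).fderiv
    have e3 := congrArg (fun L : E →L[ℝ] E => L u) ((e1.fderiv_eq (𝕜 := ℝ)).trans e2)
    rw [show fderiv ℝ (fun t => curvL G t x v z) y u = _ from e3]
    simp
    abel
  -- Inserting the Kulkarni–Nomizu form into the second Bianchi identity leaves, up to sign, exactly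
  -- the cyclic relation for the Cotton tensor C.
  have key := cotton_eq_zero (g := toBilin (G y)) (h.symm y hy) (h.nondeg y hy) hn (C := C)
    (fun u x => by rw [hC, hC]; abel) (fun u x v z => by
      have hB := h.second_bianchi hy u x v z
      rw [hd, hd, hd, hR y hy] at hB
      rw [← neg_eq_zero, ← hB]
      simp only [hC, toBilin_apply, kulkarniNomizu_apply, h.fderiv_apply hy, map_add, map_sub,
        map_smul, add_apply, sub_apply, smul_apply, h.chr_symm hy x u, h.chr_symm hy v u,
        h.chr_symm hy v x, ContinuousLinearMap.coe_coe, LinearMap.add_apply, LinearMap.sub_apply]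
      module) u x
  rw [hC] at key
  rw [← sub_eq_zero, ← key]
  abel

end IsMetricOn

/-! ### The prolonged conformal-flatness system (the standard tractor connection) and its solutions.
-/

section Prolongation



/-- The linear system prolonging the equation for conformal factors of flat metrics, acting on
triples `(τ, m, ρ)`. -/
def prolongation (G : E → E →L[ℝ] E →L[ℝ] ℝ) (y : E) :
    E →L[ℝ] (ℝ × E × ℝ) →L[ℝ] (ℝ × E × ℝ) :=
  contBilin (X := ℝ × E × ℝ) (LinearMap.mk₂ ℝ (fun u F => (G y u F.2.1,
    -chr G y u F.2.1 - F.1 • schouten G y u - F.2.2 • u, G y (schouten G y u) F.2.1))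
    (fun u u' F => by
      ext1
      · simp
      ext1 <;> simp
      module)
    (fun c u F => by
      ext1
      · simp
      ext1 <;> simp
      module)
    (fun u F F' => by
      ext1
      · simp
      ext1 <;> simp
      module)
    (fun c u F => by
      ext1
      · simp
      ext1 <;> simp
      module))

lemma prolongation_apply (y u : E) (F : ℝ × E × ℝ) : prolongation G y u F = (G y u F.2.1,
    -chr G y u F.2.1 - F.1 • schouten G y u - F.2.2 • u, G y (schouten G y u) F.2.1) := rfl

namespace IsMetricOn

lemma contDiffOn_prolongation (h : IsMetricOn G O) : ContDiffOn ℝ ∞ (prolongation G) O := by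
  rw [contDiffOn_clm_apply]
  intro u
  rw [contDiffOn_clm_apply]
  intro F
  simp only [prolongation_apply]
  have hS : ContDiffOn ℝ ∞ (fun y => schouten G y u) O :=
    h.contDiffOn_schouten.clm_apply contDiffOn_const
  exact ((h.contDiffOn.clm_apply contDiffOn_const).clm_apply contDiffOn_const).prodMk
    ((((((h.contDiffOn_chr.clm_apply contDiffOn_const).clm_apply contDiffOn_const).neg).sub
      (contDiffOn_const.smul hS)).sub contDiffOn_const).prodMk
      ((h.contDiffOn.clm_apply hS).clm_apply contDiffOn_const))

lemma fderiv_prolongation (h : IsMetricOn G O) {y : E} (hy : y ∈ O) (u v : E) (F : ℝ × E × ℝ) :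
    fderiv ℝ (prolongation G) y u v F = (fderiv ℝ G y u v F.2.1,
      -fderiv ℝ (chr G) y u v F.2.1 - F.1 • fderiv ℝ (schouten G) y u v,
      fderiv ℝ G y u (schouten G y v) F.2.1 + G y (fderiv ℝ (schouten G) y u v) F.2.1) := by
  have hA : HasFDerivAt (prolongation G) (fderiv ℝ (prolongation G) y) y :=
    ((h.contDiffOn_prolongation.differentiableOn (by simp)).differentiableAt
      (h.isOpen.mem_nhds hy)).hasFDerivAt
  have e1 := ((hA.clm_apply (hasFDerivAt_const v y)).clm_apply (hasFDerivAt_const F y)).fderiv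
  have hS : HasFDerivAt (fun t => schouten G t v) ((fderiv ℝ (schouten G) y).flip v) y :=
    ((h.hasFDerivAt_schouten hy).clm_apply (hasFDerivAt_const v y)).congr_fderiv (by ext; simp)
  have hG1 : HasFDerivAt (fun t => G t v F.2.1) (((fderiv ℝ G y).flip v).flip F.2.1) y :=
    (((h.hasFDerivAt hy).clm_apply (hasFDerivAt_const v y)).clm_apply
      (hasFDerivAt_const F.2.1 y)).congr_fderiv (by ext; simp)
  have hGS : HasFDerivAt (fun t => G t (schouten G t v) F.2.1)
      (((fderiv ℝ G y).flip (schouten G y v)).flip F.2.1 +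
        ((G y).flip F.2.1).comp ((fderiv ℝ (schouten G) y).flip v)) y :=
    (((h.hasFDerivAt hy).clm_apply hS).clm_apply
      (hasFDerivAt_const F.2.1 y)).congr_fderiv (by ext; simp [add_comm])
  have e2 := (hG1.prodMk ((((h.hasFDerivAt_chr_apply hy v F.2.1).neg.sub
    (hS.const_smul F.1)).sub (hasFDerivAt_const (F.2.2 • v) y)).prodMk hGS)).fderiv
  have e3 : fderiv ℝ (fun t => prolongation G t v F) y = _ := e2
  rw [e1] at e3
  have e4 := congrArg (fun L : E →L[ℝ] ℝ × E × ℝ => L u) e3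
  simpa using e4

/-- The prolonged system is flat when the curvature is a Kulkarni–Nomizu product and the Cotton
tensor vanishes. -/
lemma prolongation_flat (h : IsMetricOn G O) (hn : 3 < Module.finrank ℝ E)
    (hR : ∀ t ∈ O, curvL G t = kulkarniNomizu (toBilin (G t)) (schouten G t)) {y : E} (hy : y ∈ O)
    (u v : E) (F : ℝ × E × ℝ) :
    fderiv ℝ (prolongation G) y u v F + prolongation G y v (prolongation G y u F) =
      fderiv ℝ (prolongation G) y v u F + prolongation G y u (prolongation G y v F) := by
  obtain ⟨τ, m, ρ⟩ := F
  have hC := h.cotton hn hR hy u v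
  have hK : curvL G y u v m = kulkarniNomizu (toBilin (G y)) (schouten G y) u v m := by
    rw [hR y hy]
  rw [curvL_apply, kulkarniNomizu_apply] at hK
  simp only [toBilin_apply, ContinuousLinearMap.coe_coe] at hK
  rw [h.fderiv_prolongation hy, h.fderiv_prolongation hy]
  -- The three components of the curvature of the system: symmetry of Γ and S for the first, R minus
  -- the Kulkarni–Nomizu product together with τ times the Cotton tensor for the second, the Cotton
  -- tensor paired with m for the third.
  simp only [prolongation_apply, Prod.mk_add_mk, Prod.mk.injEq]
  refine ⟨?_, ?_, ?_⟩
  · simp only [h.fderiv_apply hy, map_sub, map_neg, map_smul, smul_eq_mul, h.chr_symm hy v u,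
      h.symm y hy v (schouten G y u), h.schouten_symm hy v u, h.symm y hy v u,
      h.symm y hy u (schouten G y v)]
    ring
  · rw [← sub_eq_zero] at hK hC ⊢
    have e : -(fderiv ℝ (chr G) y u v m - fderiv ℝ (chr G) y v u m + chr G y u (chr G y v m) -
          chr G y v (chr G y u m) -
        (G y v m • schouten G y u + G y (schouten G y v) m • u - G y u m • schouten G y v -
          G y (schouten G y u) m • v)) -
        τ • (fderiv ℝ (schouten G) y u v + chr G y u (schouten G y v) -
        (fderiv ℝ (schouten G) y v u + chr G y v (schouten G y u))) = 0 := by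
      rw [hK, hC, smul_zero, neg_zero, sub_zero]
    rw [← e]
    simp only [map_sub, map_neg, map_smul, h.chr_symm hy v u]
    module
  · have e := congrArg (fun w => G y w m) hC
    simp only [map_add, add_apply] at e
    simp only [h.fderiv_apply hy, map_sub, map_neg, map_smul, smul_eq_mul,
      h.schouten_symm hy v u, h.symm y hy (schouten G y u) (schouten G y v)]
    linarith

/-- A metric in dimension at least four whose curvature vanishes on isotropic planes is locally
conformally flat. -/
theorem exists_conformal_factor (h : IsMetricOn G O) (hn : 3 < Module.finrank ℝ E)
    (hsi : ∀ y ∈ O, StronglyIndefinite (toBilin (G y)))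
    (h0 : ∀ y ∈ O, ∀ x z, G y x x = 0 → G y x z = 0 → G y z z = 0 → G y (curvL G y x z z) x = 0)
    {x₀ : E} (hx₀ : x₀ ∈ O) :
    ∃ U ⊆ O, IsOpen U ∧ x₀ ∈ U ∧ ∃ τ : E → ℝ, ContDiffOn ℝ ∞ τ U ∧ (∀ y ∈ U, 0 < τ y) ∧
      ∀ y ∈ U, ∀ u v w, curvL (fun y => (τ y ^ 2)⁻¹ • G y) y u v w = 0 := by
  have hR : ∀ t ∈ O, curvL G t = kulkarniNomizu (toBilin (G t)) (schouten G t) := fun t ht =>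
    h.curvL_eq_kulkarniNomizu ht (hsi t ht) (by omega) (h0 t ht)
  -- The initial value (1, 0, 0) makes τ positive near x₀ and gives the first integral 2ρτ + |m|²
  -- the value zero.
  obtain ⟨r, hr, hrO, F, hF0, hFs, hF⟩ := exists_parallel h.isOpen h.contDiffOn_prolongation
    (fun y hy u v w => h.prolongation_flat hn hR hy u v w) hx₀ (1, 0, 0)
  set B := Metric.ball x₀ r
  have hB : IsOpen B := Metric.isOpen_ball
  have hfst : ∀ y ∈ B, HasFDerivAt (fun y => (F y).1)
      ((ContinuousLinearMap.fst ℝ ℝ (E × ℝ)).comp ((prolongation G y).flip (F y))) y := fun y hy =>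
    (ContinuousLinearMap.fst ℝ ℝ (E × ℝ)).hasFDerivAt.comp y (hF y hy)
  have hm : ∀ y ∈ B, HasFDerivAt (fun y => (F y).2.1) (((ContinuousLinearMap.fst ℝ E ℝ).comp
      (ContinuousLinearMap.snd ℝ ℝ (E × ℝ))).comp ((prolongation G y).flip (F y))) y := fun y hy =>
    ((ContinuousLinearMap.fst ℝ E ℝ).comp
      (ContinuousLinearMap.snd ℝ ℝ (E × ℝ))).hasFDerivAt.comp y (hF y hy)
  have hρ : ∀ y ∈ B, HasFDerivAt (fun y => (F y).2.2) (((ContinuousLinearMap.snd ℝ E ℝ).comp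
      (ContinuousLinearMap.snd ℝ ℝ (E × ℝ))).comp ((prolongation G y).flip (F y))) y := fun y hy =>
    ((ContinuousLinearMap.snd ℝ E ℝ).comp
      (ContinuousLinearMap.snd ℝ ℝ (E × ℝ))).hasFDerivAt.comp y (hF y hy)
  have hconst : ∀ y ∈ B, 2 * (F y).2.2 * (F y).1 + G y (F y).2.1 (F y).2.1 = 0 := by
    intro y hy
    -- This quadratic expression is the tractor metric, which is parallel for the system.
    have hd : ∀ y ∈ B, HasFDerivAt
        (fun y => 2 * ((F y).2.2 * (F y).1) + G y (F y).2.1 (F y).2.1) (0 : E →L[ℝ] ℝ) y := by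
      intro y hy
      have hyO := hrO hy
      refine ((((hρ y hy).mul (hfst y hy)).const_mul 2).add
        (((h.hasFDerivAt hyO).clm_apply (hm y hy)).clm_apply (hm y hy))).congr_fderiv ?_
      ext u
      simp [prolongation_apply, h.fderiv_apply hyO]
      rw [h.symm y hyO (F y).2.1 (chr G y u _), h.symm y hyO (F y).2.1 (schouten G y u),
        h.symm y hyO (F y).2.1 u]
      ring
    have := (convex_ball x₀ r).is_const_of_fderivWithin_eq_zero (𝕜 := ℝ)
      (fun y hy => (hd y hy).differentiableAt.differentiableWithinAt)
      (fun y hy => by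
        rw [fderivWithin_of_isOpen hB hy, (hd y hy).fderiv]) hy (Metric.mem_ball_self hr)
    simp only [hF0] at this
    simp at this
    linarith
  have hτc : ContDiffOn ℝ ∞ (fun y => (F y).1) B := contDiff_fst.comp_contDiffOn hFs
  have hUo : IsOpen (B ∩ (fun y => (F y).1) ⁻¹' Set.Ioi 0) :=
    hτc.continuousOn.isOpen_inter_preimage hB isOpen_Ioi
  set U := B ∩ (fun y => (F y).1) ⁻¹' Set.Ioi 0
  have hUB : U ⊆ B := Set.inter_subset_left
  have hU : IsMetricOn G U :=
    ⟨hUo, h.contDiffOn.mono (hUB.trans hrO), fun y hy => h.symm y (hrO (hUB hy)),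
      fun y hy => h.nondeg y (hrO (hUB hy))⟩
  refine ⟨U, hUB.trans hrO, hUo, ⟨Metric.mem_ball_self hr, by simp [hF0]⟩, fun y => (F y).1,
    hτc.mono hUB, fun y hy => hy.2, fun y hy u v w => ?_⟩
  refine hU.curvL_conformal_eq_zero (hτc.mono hUB) (fun y hy => (Set.mem_Ioi.1 hy.2).ne')
    (m := fun y => (F y).2.1) (fun y hy u => ?_) hy (h.schouten_symm (hrO (hUB hy)))
    (hR y (hrO (hUB hy))) (ρ := (F y).2.2) (hm y (hUB hy)) (fun u => ?_) (hconst y (hUB hy)) u v w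
  · rw [(hfst y (hUB hy)).fderiv]
    simp [prolongation_apply]
  · simp [prolongation_apply]

end IsMetricOn
end Prolongation
end Schouten

/-! ### Metrics and curvature on a manifold read in charts. -/

section Charts

variable {E : Type*} [NormedAddCommGroup E] [NormedSpace ℝ E]
  {M : Type*} [TopologicalSpace M] [ChartedSpace E M] [IsManifold 𝓘(ℝ, E) ∞ M]

/-- The differential at `q` of the chart at `p`. -/
def dChart (p q : M) : TangentSpace 𝓘(ℝ, E) q →L[ℝ] E :=
  mfderiv 𝓘(ℝ, E) 𝓘(ℝ, E) (extChartAt 𝓘(ℝ, E) p) q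

/-- The differential at `y` of the inverse of the chart at `p`. -/
def dSymm (p : M) (y : E) : E →L[ℝ] TangentSpace 𝓘(ℝ, E) ((extChartAt 𝓘(ℝ, E) p).symm y) :=
  mfderiv 𝓘(ℝ, E) 𝓘(ℝ, E) (extChartAt 𝓘(ℝ, E) p).symm y

lemma inChart_apply (g : FormField E M) (p : M) (y u v : E) :
    inChart g p y u v = g ((extChartAt 𝓘(ℝ, E) p).symm y) (dSymm p y u) (dSymm p y v) := rfl

lemma mdifferentiableAt_extChartAt_symm {p : M} {y : E} (hy : y ∈ (extChartAt 𝓘(ℝ, E) p).target) :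
    MDifferentiableAt 𝓘(ℝ, E) 𝓘(ℝ, E) (extChartAt 𝓘(ℝ, E) p).symm y := by
  have := mdifferentiableWithinAt_extChartAt_symm (I := 𝓘(ℝ, E)) hy
  rwa [ModelWithCorners.range_eq_univ, mdifferentiableWithinAt_univ] at this

lemma mdifferentiableAt_extChartAt' {p q : M} (hq : q ∈ (extChartAt 𝓘(ℝ, E) p).source) :
    MDifferentiableAt 𝓘(ℝ, E) 𝓘(ℝ, E) (extChartAt 𝓘(ℝ, E) p) q :=
  mdifferentiableAt_extChartAt (by rwa [extChartAt_source] at hq)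

lemma dSymm_dChart {p : M} {y : E} (hy : y ∈ (extChartAt 𝓘(ℝ, E) p).target)
    (v : TangentSpace 𝓘(ℝ, E) ((extChartAt 𝓘(ℝ, E) p).symm y)) :
    dSymm p y (dChart p ((extChartAt 𝓘(ℝ, E) p).symm y) v) = v := by
  have := mfderivWithin_extChartAt_symm_comp_mfderiv_extChartAt (I := 𝓘(ℝ, E)) hy
  rw [ModelWithCorners.range_eq_univ, mfderivWithin_univ] at this
  exact DFunLike.congr_fun this v

lemma dChart_dSymm {p : M} {y : E} (hy : y ∈ (extChartAt 𝓘(ℝ, E) p).target) (v : E) :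
    dChart p ((extChartAt 𝓘(ℝ, E) p).symm y) (dSymm p y v) = v := by
  have := mfderiv_extChartAt_comp_mfderivWithin_extChartAt_symm (I := 𝓘(ℝ, E)) hy
  rw [ModelWithCorners.range_eq_univ, mfderivWithin_univ] at this
  exact DFunLike.congr_fun this v

/-- The tangent space at p is modelled on E through the chart at p, so the differential of the
inverse chart at the centre is the identity. -/
lemma inChart_self (g : FormField E M) (p : M) :
    inChart g p (extChartAt 𝓘(ℝ, E) p p) = g p := by
  have e : (mfderiv 𝓘(ℝ, E) 𝓘(ℝ, E) (extChartAt 𝓘(ℝ, E) p).symm (extChartAt 𝓘(ℝ, E) p p) : E →L[ℝ] E)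
      = ContinuousLinearMap.id ℝ E := by
    have := mfderivWithin_range_extChartAt_symm (I := 𝓘(ℝ, E)) (x := p)
    rw [ModelWithCorners.range_eq_univ, mfderivWithin_univ] at this
    exact this
  have e2 : (extChartAt 𝓘(ℝ, E) p).symm (extChartAt 𝓘(ℝ, E) p p) = p := extChartAt_to_inv p
  ext u v
  simp only [inChart]
  rw [e]
  have : ∀ q : M, q = p → (g q : E →L[ℝ] E →L[ℝ] ℝ) = g p := by rintro _ rfl; rfl
  exact congrArg (fun B : E →L[ℝ] E →L[ℝ] ℝ => B u v) (this _ e2)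

/-- The differential of the inverse chart is the inverse of the tangent-bundle trivialization at p,
so the chart coefficients are the values of g on smooth local frame fields. -/
lemma contDiffOn_inChart [FiniteDimensional ℝ E] (g : PseudoRiemannianMetric E M) (p : M) :
    ContDiffOn ℝ ∞ (inChart g.val p) (extChartAt 𝓘(ℝ, E) p).target := by
  rw [contDiffOn_clm_apply]
  intro u
  rw [contDiffOn_clm_apply]
  intro v
  let e := trivializationAt E (TangentSpace 𝓘(ℝ, E) : M → Type _) p
  have hs : ∀ w : E, ContMDiffOn 𝓘(ℝ, E) (𝓘(ℝ, E).prod 𝓘(ℝ, E)) ∞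
      (fun m : M => Bundle.TotalSpace.mk' E m (e.symmL ℝ m w)) e.baseSet := by
    intro w m hm
    have h1 := e.contMDiffAt_symmL (n := ∞) (IB := 𝓘(ℝ, E)) hm
    have h2 : ContMDiffAt 𝓘(ℝ, E) (𝓘(ℝ, E).prod 𝓘(ℝ, E)) ∞
      (fun m : M => Bundle.TotalSpace.mk' E (E := Bundle.Trivial M E) m w) m := by
      rw [Bundle.contMDiffAt_section]
      exact contMDiffAt_const
    exact (h1.clm_bundle_apply h2).contMDiffWithinAt
  have h3 : ContMDiffOn 𝓘(ℝ, E) (𝓘(ℝ, E).prod 𝓘(ℝ, ℝ)) ∞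
      (fun m : M => Bundle.TotalSpace.mk' ℝ (E := Bundle.Trivial M ℝ) m
        (g.val m (e.symmL ℝ m u) (e.symmL ℝ m v))) e.baseSet := by
    apply ContMDiffOn.clm_bundle_apply₂ (F₁ := E) (F₂ := E)
    · exact g.contMDiff.contMDiffOn
    · exact hs u
    · exact hs v
  have h4 : ContMDiffOn 𝓘(ℝ, E) 𝓘(ℝ, ℝ) ∞
      (fun m : M => g.val m (e.symmL ℝ m u) (e.symmL ℝ m v)) e.baseSet := by
    intro m hm
    have := h3 m hm
    simp only [Bundle.contMDiffWithinAt_totalSpace] at this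
    exact this.2
  have h5 := h4.comp (contMDiffOn_extChartAt_symm (I := 𝓘(ℝ, E)) (n := ∞) p) (t := e.baseSet) (by
    intro y hy
    have := (extChartAt 𝓘(ℝ, E) p).map_target hy
    simpa [e] using this)
  rw [contMDiffOn_iff_contDiffOn] at h5
  refine h5.congr fun y hy => ?_
  have hq := (extChartAt 𝓘(ℝ, E) p).map_target hy
  rw [extChartAt_source] at hq
  have := TangentBundle.symmL_trivializationAt (I := 𝓘(ℝ, E)) hq
  rw [ModelWithCorners.range_eq_univ, mfderivWithin_univ, (extChartAt 𝓘(ℝ, E) p).right_inv hy] at this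
  simp only [Function.comp_apply, e]
  rw [this]
  rfl

lemma inChart_extChartAt (g : FormField E M) {p q : M} (hq : q ∈ (extChartAt 𝓘(ℝ, E) p).source)
    (u v : TangentSpace 𝓘(ℝ, E) q) :
    inChart g p (extChartAt 𝓘(ℝ, E) p q) (dChart p q u) (dChart p q v) = g q u v := by
  obtain ⟨y, hy, rfl⟩ : ∃ y ∈ (extChartAt 𝓘(ℝ, E) p).target, (extChartAt 𝓘(ℝ, E) p).symm y = q :=
    ⟨_, (extChartAt 𝓘(ℝ, E) p).map_source hq, (extChartAt 𝓘(ℝ, E) p).left_inv hq⟩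
  rw [(extChartAt 𝓘(ℝ, E) p).right_inv hy, inChart_apply, dSymm_dChart hy, dSymm_dChart hy]

/-- The part of the chart at `p` that lies over `V`. -/
def chartSet (p : M) (V : Set M) : Set E :=
  (extChartAt 𝓘(ℝ, E) p).target ∩ (extChartAt 𝓘(ℝ, E) p).symm ⁻¹' V

lemma isOpen_chartSet (p : M) {V : Set M} (hV : IsOpen V) : IsOpen (chartSet (E := E) p V) :=
  (continuousOn_extChartAt_symm p).isOpen_inter_preimage (isOpen_extChartAt_target p) hV

lemma extChartAt_mem_chartSet {p q : M} {V : Set M} (hq : q ∈ (extChartAt 𝓘(ℝ, E) p).source)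
    (hV : q ∈ V) : extChartAt 𝓘(ℝ, E) p q ∈ chartSet (E := E) p V :=
  ⟨(extChartAt 𝓘(ℝ, E) p).map_source hq, by
    rwa [Set.mem_preimage, (extChartAt 𝓘(ℝ, E) p).left_inv hq]⟩

/-- `g` is a smooth pseudo-Riemannian metric on the open set `V`. -/
structure IsSmoothMetricOn (g : FormField E M) (V : Set M) : Prop where
  isOpen : IsOpen V
  isMetricOn (p : M) : IsMetricOn (inChart g p) (chartSet p V)

lemma IsMetricOn.mono {G : E → E →L[ℝ] E →L[ℝ] ℝ} {O O' : Set E} (h : IsMetricOn G O) (hO' : IsOpen O')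
    (hs : O' ⊆ O) : IsMetricOn G O' :=
  ⟨hO', h.contDiffOn.mono hs, fun y hy => h.symm y (hs hy), fun y hy => h.nondeg y (hs hy)⟩

namespace IsSmoothMetricOn

lemma mono {g : FormField E M} {V W : Set M} (h : IsSmoothMetricOn g V) (hW : IsOpen W)
    (hWV : W ⊆ V) : IsSmoothMetricOn g W :=
  ⟨hW, fun p => (h.isMetricOn p).mono (isOpen_chartSet p hW) fun _ hy => ⟨hy.1, hWV hy.2⟩⟩

end IsSmoothMetricOn

lemma isMetricOn_inChart {g : FormField E M} {p : M} {O : Set E} (hO : IsOpen O)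
    (hO' : O ⊆ (extChartAt 𝓘(ℝ, E) p).target) (hg : ContDiffOn ℝ ∞ (inChart g p) O)
    (hs : ∀ p x y, g p x y = g p y x) (hn : ∀ p x, (∀ y, g p x y = 0) → x = 0) :
    IsMetricOn (inChart g p) O := by
  refine ⟨hO, hg, fun y _ u v => hs _ _ _, fun y hy u hu => ?_⟩
  have h1 := hn _ (dSymm p y u) fun v => by
    have := hu (dChart p ((extChartAt 𝓘(ℝ, E) p).symm y) v)
    rwa [inChart_apply, dSymm_dChart (hO' hy)] at this
  have h2 := dChart_dSymm (hO' hy) u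
  rw [h1, map_zero] at h2
  exact h2.symm

lemma PseudoRiemannianMetric.isSmoothMetricOn [FiniteDimensional ℝ E]
    (g : PseudoRiemannianMetric E M) : IsSmoothMetricOn g.val Set.univ :=
  ⟨isOpen_univ, fun p => isMetricOn_inChart (isOpen_chartSet p isOpen_univ) Set.inter_subset_left
    ((contDiffOn_inChart g p).mono Set.inter_subset_left) g.symm g.nondegenerate⟩

lemma IsSmoothMetricOn.smul {g : FormField E M} {V : Set M} [FiniteDimensional ℝ E]
    (h : IsSmoothMetricOn g V) {l : M → ℝ}
    (hl : ContMDiffOn 𝓘(ℝ, E) 𝓘(ℝ, ℝ) ∞ l V) (hl0 : ∀ m ∈ V, l m ≠ 0) :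
    IsSmoothMetricOn (fun m => l m • g m) V := by
  refine ⟨h.isOpen, fun p => ?_⟩
  have h1 : ContDiffOn ℝ ∞ (fun y => l ((extChartAt 𝓘(ℝ, E) p).symm y)) (chartSet (E := E) p V) := by
    rw [← contMDiffOn_iff_contDiffOn]
    exact hl.comp ((contMDiffOn_extChartAt_symm p).mono Set.inter_subset_left) fun y hy => hy.2
  exact (h.isMetricOn p).smul h1 fun y hy => hl0 _ hy.2

lemma IsSmoothMetricOn.curvature_eq {g : FormField E M} {V : Set M} [FiniteDimensional ℝ E]
    (h : IsSmoothMetricOn g V) {p : M} (hp : p ∈ V) (x y z w : TangentSpace 𝓘(ℝ, E) p) :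
    curvature g p x y z w =
      g p (curvL (inChart g p) (extChartAt 𝓘(ℝ, E) p p) x y z : E) w := by
  have e : (mfderiv 𝓘(ℝ, E) 𝓘(ℝ, E) (extChartAt 𝓘(ℝ, E) p) p : E →L[ℝ] E) =
    ContinuousLinearMap.id ℝ E := mfderiv_extChartAt_self (I := 𝓘(ℝ, E))
  simp only [curvature]
  rw [inChart_self, (h.isMetricOn p).localCurvature_eq (extChartAt_mem_chartSet
    (mem_extChartAt_source p) hp), e]
  rfl

/-! ### Smooth maps read in charts and invariance of the curvature tensor. -/

section Transition

variable {M' : Type*} [TopologicalSpace M'] [ChartedSpace E M'] [IsManifold 𝓘(ℝ, E) ∞ M']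

lemma contDiffOn_transition {f : M → M'} {V : Set M} (hf : ContMDiffOn 𝓘(ℝ, E) 𝓘(ℝ, E) ∞ f V)
    {p : M} {p' : M'} (hV : Set.MapsTo f V (extChartAt 𝓘(ℝ, E) p').source) :
    ContDiffOn ℝ ∞ (fun t => extChartAt 𝓘(ℝ, E) p' (f ((extChartAt 𝓘(ℝ, E) p).symm t)))
      (chartSet (E := E) p V) := by
  rw [← contMDiffOn_iff_contDiffOn]
  have h0 : ContMDiffOn 𝓘(ℝ, E) 𝓘(ℝ, E) ∞ (extChartAt 𝓘(ℝ, E) p).symm (chartSet (E := E) p V) :=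
    (contMDiffOn_extChartAt_symm p).mono Set.inter_subset_left
  have h1 : ContMDiffOn 𝓘(ℝ, E) 𝓘(ℝ, E) ∞ (f ∘ (extChartAt 𝓘(ℝ, E) p).symm)
    (chartSet (E := E) p V) := hf.comp h0 fun y hy => hy.2
  have h2 : ContMDiffOn 𝓘(ℝ, E) 𝓘(ℝ, E) ∞ (extChartAt 𝓘(ℝ, E) p') (chartAt E p').source :=
    contMDiffOn_extChartAt
  refine h2.comp h1 fun y hy => ?_
  rw [← extChartAt_source 𝓘(ℝ, E)]
  exact hV hy.2

lemma fderiv_transition {f : M → M'} {p : M} {p' : M'} {t : E}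
    (ht : t ∈ (extChartAt 𝓘(ℝ, E) p).target)
    (hf : MDifferentiableAt 𝓘(ℝ, E) 𝓘(ℝ, E) f ((extChartAt 𝓘(ℝ, E) p).symm t))
    (hft : f ((extChartAt 𝓘(ℝ, E) p).symm t) ∈ (extChartAt 𝓘(ℝ, E) p').source) (u : E) :
    fderiv ℝ (fun t => extChartAt 𝓘(ℝ, E) p' (f ((extChartAt 𝓘(ℝ, E) p).symm t))) t u =
      dChart p' (f ((extChartAt 𝓘(ℝ, E) p).symm t))
        (mfderiv 𝓘(ℝ, E) 𝓘(ℝ, E) f ((extChartAt 𝓘(ℝ, E) p).symm t) (dSymm p t u)) := by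
  rw [← mfderiv_eq_fderiv]
  have h0 := HasMFDerivAt.comp t hf.hasMFDerivAt (mdifferentiableAt_extChartAt_symm ht).hasMFDerivAt
  have h1 := HasMFDerivAt.comp t (f := f ∘ (extChartAt 𝓘(ℝ, E) p).symm)
    (mdifferentiableAt_extChartAt' hft).hasMFDerivAt h0
  exact DFunLike.congr_fun h1.mfderiv u

/-- The condition that `f` pulls the form field `g'` back to `g` at the point `m`. -/
def PullsBackAt (g : FormField E M) (g' : FormField E M') (f : M → M') (m : M) : Prop :=
  ∀ u v, g m u v = g' (f m) (mfderiv 𝓘(ℝ, E) 𝓘(ℝ, E) f m u) (mfderiv 𝓘(ℝ, E) 𝓘(ℝ, E) f m v)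

lemma inChart_transition {g : FormField E M} {g' : FormField E M'} {f : M → M'} {p : M} {p' : M'}
    {t : E} (ht : t ∈ (extChartAt 𝓘(ℝ, E) p).target)
    (hf : MDifferentiableAt 𝓘(ℝ, E) 𝓘(ℝ, E) f ((extChartAt 𝓘(ℝ, E) p).symm t))
    (hft : f ((extChartAt 𝓘(ℝ, E) p).symm t) ∈ (extChartAt 𝓘(ℝ, E) p').source)
    (hg : PullsBackAt g g' f ((extChartAt 𝓘(ℝ, E) p).symm t)) (u v : E) :
    inChart g p t u v = inChart g' p'
      (extChartAt 𝓘(ℝ, E) p' (f ((extChartAt 𝓘(ℝ, E) p).symm t)))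
      (fderiv ℝ (fun t => extChartAt 𝓘(ℝ, E) p' (f ((extChartAt 𝓘(ℝ, E) p).symm t))) t u)
      (fderiv ℝ (fun t => extChartAt 𝓘(ℝ, E) p' (f ((extChartAt 𝓘(ℝ, E) p).symm t))) t v) := by
  rw [fderiv_transition ht hf hft, fderiv_transition ht hf hft, inChart_extChartAt g' hft,
    inChart_apply]
  exact hg _ _

lemma IsSmoothMetricOn.isLocalIsometryOn [FiniteDimensional ℝ E] {g : FormField E M}
    {g' : FormField E M'} {f : M → M'}
    {V : Set M} {V' : Set M'} (h : IsSmoothMetricOn g V) (h' : IsSmoothMetricOn g' V')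
    (hf : ContMDiffOn 𝓘(ℝ, E) 𝓘(ℝ, E) ∞ f V) (hV : Set.MapsTo f V V')
    (hg : ∀ m ∈ V, PullsBackAt g g' f m) (p : M) (p' : M')
    (hp' : Set.MapsTo f V (extChartAt 𝓘(ℝ, E) p').source) :
    IsLocalIsometryOn (inChart g p) (inChart g' p') (chartSet p V) (chartSet p' V')
      (fun t => extChartAt 𝓘(ℝ, E) p' (f ((extChartAt 𝓘(ℝ, E) p).symm t))) where
  left := h.isMetricOn p
  right := h'.isMetricOn p'
  contDiffOn := contDiffOn_transition hf hp'
  mapsTo := fun t ht => extChartAt_mem_chartSet (hp' ht.2) (hV ht.2)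
  pullback := fun t ht => inChart_transition ht.1 ((hf.contMDiffAt (h.isOpen.mem_nhds
    ht.2)).mdifferentiableAt (by simp)) (hp' ht.2) (hg _ ht.2)

/-- The differential at `p` of `f`, read in the chart at `p'` of the target. -/
def dRead (f : M → M') (p : M) (p' : M') : TangentSpace 𝓘(ℝ, E) p →L[ℝ] E :=
  (dChart p' (f p)).comp (mfderiv 𝓘(ℝ, E) 𝓘(ℝ, E) f p)

lemma fderiv_transition_self {f : M → M'} {p : M} {p' : M'}
    (hf : MDifferentiableAt 𝓘(ℝ, E) 𝓘(ℝ, E) f p)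
    (hp' : f p ∈ (extChartAt 𝓘(ℝ, E) p').source) :
    fderiv ℝ (fun t => extChartAt 𝓘(ℝ, E) p' (f ((extChartAt 𝓘(ℝ, E) p).symm t)))
      (extChartAt 𝓘(ℝ, E) p p) = dRead f p p' := by
  rw [← mfderiv_eq_fderiv]
  have e0 : (extChartAt 𝓘(ℝ, E) p).symm (extChartAt 𝓘(ℝ, E) p p) = p := extChartAt_to_inv p
  have e := mfderivWithin_range_extChartAt_symm (I := 𝓘(ℝ, E)) (x := p)
  rw [ModelWithCorners.range_eq_univ, mfderivWithin_univ] at e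
  have h0 : HasMFDerivAt 𝓘(ℝ, E) 𝓘(ℝ, E) (extChartAt 𝓘(ℝ, E) p).symm (extChartAt 𝓘(ℝ, E) p p)
      (ContinuousLinearMap.id ℝ E) := by
    have h := (mdifferentiableAt_extChartAt_symm (E := E)
      (mem_extChartAt_target (I := 𝓘(ℝ, E)) p)).hasMFDerivAt
    rw [e] at h
    exact h
  have h1 : HasMFDerivAt 𝓘(ℝ, E) 𝓘(ℝ, E) (extChartAt 𝓘(ℝ, E) p' ∘ f) p (dRead f p p') :=
    HasMFDerivAt.comp p (mdifferentiableAt_extChartAt' hp').hasMFDerivAt hf.hasMFDerivAt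
  have h2 : HasMFDerivAt 𝓘(ℝ, E) 𝓘(ℝ, E) (extChartAt 𝓘(ℝ, E) p' ∘ f)
      ((extChartAt 𝓘(ℝ, E) p).symm (extChartAt 𝓘(ℝ, E) p p)) (dRead f p p' : E →L[ℝ] E) := by
    have : ∀ q, q = p → HasMFDerivAt 𝓘(ℝ, E) 𝓘(ℝ, E) (extChartAt 𝓘(ℝ, E) p' ∘ f) q
      (dRead f p p' : E →L[ℝ] E) := by rintro _ rfl; exact h1
    exact this _ e0
  exact (HasMFDerivAt.comp _ h2 h0).mfderiv

/-- Invariance of the curvature tensor under local isometries, with the curvature of the target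
computed in an arbitrary chart. -/
lemma IsSmoothMetricOn.curvature_eq_inChart [FiniteDimensional ℝ E] {g : FormField E M}
    {g' : FormField E M'} {f : M → M'}
    {V : Set M} {V' : Set M'} (h : IsSmoothMetricOn g V) (h' : IsSmoothMetricOn g' V')
    (hf : ContMDiffOn 𝓘(ℝ, E) 𝓘(ℝ, E) ∞ f V) (hV : Set.MapsTo f V V')
    (hg : ∀ m ∈ V, PullsBackAt g g' f m) {p : M} (hp : p ∈ V) {p' : M'}
    (hp' : f p ∈ (extChartAt 𝓘(ℝ, E) p').source) (x y z w : TangentSpace 𝓘(ℝ, E) p) :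
    curvature g p x y z w = inChart g' p' (extChartAt 𝓘(ℝ, E) p' (f p))
      (curvL (inChart g' p') (extChartAt 𝓘(ℝ, E) p' (f p))
        (dRead f p p' x) (dRead f p p' y) (dRead f p p' z)) (dRead f p p' w) := by
  -- Shrinking to the points sent into the domain of the target chart makes f a local isometry
  -- between open sets of E.
  set W := V ∩ f ⁻¹' (extChartAt 𝓘(ℝ, E) p').source with hW
  have hWo : IsOpen W := hf.continuousOn.isOpen_inter_preimage h.isOpen (isOpen_extChartAt_source p')
  have hWV : W ⊆ V := Set.inter_subset_left
  have hpW : p ∈ W := ⟨hp, hp'⟩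
  have hiso := (h.mono hWo hWV).isLocalIsometryOn h' (hf.mono hWV) (hV.mono hWV subset_rfl)
    (fun m hm => hg m (hWV hm)) p p' fun m hm => hm.2
  have ht : extChartAt 𝓘(ℝ, E) p p ∈ chartSet (E := E) p W :=
    extChartAt_mem_chartSet (mem_extChartAt_source p) hpW
  have hd := fderiv_transition_self (p := p) (p' := p')
    ((hf.contMDiffAt (h.isOpen.mem_nhds hp)).mdifferentiableAt (by simp)) hp'
  refine (h.curvature_eq hp x y z w).trans ?_
  have h1 := hiso.map_curvL ht x y z
  have h2 := hiso.pullback _ ht (curvL (inChart g p) (extChartAt 𝓘(ℝ, E) p p) x y z) w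
  rw [inChart_self, h1] at h2
  refine h2.trans ?_
  simp only [extChartAt_to_inv, hd]
  rfl

end Transition

end Charts

/-! ### From the curvature ratio to proportionality of the metrics at a point. -/

section Pointwise

open Filter

variable {V : Type*} [NormedAddCommGroup V] [NormedSpace ℝ V]
  {g h : V →L[ℝ] V →L[ℝ] ℝ} {R R' : V →ₗ[ℝ] V →ₗ[ℝ] V →ₗ[ℝ] V}

/-- The operator R(·,·) sees only x ∧ y, so each of the two pairs of slots contributes a
determinant. -/
lemma IsCurvatureLike.sect_change_basis {g : LinearMap.BilinForm ℝ V} (hR : IsCurvatureLike g R)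
    (x y : V) (a b c d : ℝ) :
    g (R (a • x + b • y) (c • x + d • y) (c • x + d • y)) (a • x + b • y) =
      (a * d - b * c) ^ 2 * g (R x y y) x := by
  have e : ∀ z, R (a • x + b • y) (c • x + d • y) z = (a * d - b * c) • R x y z := by
    intro z
    have hs : ∀ x, R x x z = 0 := fun x => by
      have h2 : (2 : ℝ) • R x x z = 0 := by
        rw [two_smul]
        nth_rewrite 1 [hR.antisymm x x z]
        exact neg_add_cancel _
      exact (smul_eq_zero.1 h2).resolve_left two_ne_zero
    simp only [map_add, map_smul, LinearMap.add_apply, LinearMap.smul_apply, hs,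
      hR.antisymm y x z, smul_zero, zero_add, add_zero, smul_neg, smul_smul, sub_smul]
    module
  rw [e]
  simp only [map_add, map_smul, LinearMap.add_apply, LinearMap.smul_apply, smul_eq_mul]
  linear_combination (a * d - b * c) * (d * b * hR.self_right x y y + c * a * hR.self_right x y x +
    c * b * hR.skew x y x y)

lemma linearIndependent_of_curv_ne_zero {B : V →ₗ[ℝ] V →ₗ[ℝ] ℝ} (hR : IsCurvatureLike B R) {x y : V}
    (hr : B (R x y y) x ≠ 0) : LinearIndependent ℝ ![x, y] := by
  have hx : x ≠ 0 := by rintro rfl; simp at hr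
  rw [LinearIndependent.pair_iff' hx]
  rintro a rfl
  apply hr
  simp [hR.self_left]

lemma linearIndependent_of_gram_ne_zero {x y : V} (hr : gram g x y ≠ 0) :
    LinearIndependent ℝ ![x, y] := by
  have hx : x ≠ 0 := by rintro rfl; simp [gram] at hr
  rw [LinearIndependent.pair_iff' hx]
  rintro a rfl
  apply hr
  simp [gram]
  ring

/-- The quadratic term t² u' is there for curves that stay in the null cone. -/
lemma continuous_sect (g : V →L[ℝ] V →L[ℝ] ℝ) (R : V →ₗ[ℝ] V →ₗ[ℝ] V →ₗ[ℝ] V) (x y u v u' : V) :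
    Continuous fun t : ℝ => g (R (x + t • u + t ^ 2 • u') (y + t • v) (y + t • v))
      (x + t • u + t ^ 2 • u') := by
  simp only [map_add, map_smul, LinearMap.add_apply, LinearMap.smul_apply,
    add_apply, smul_apply, smul_add, smul_eq_mul]
  fun_prop

/-- The Gram quotient is the quotient of the curvature numerators, which converges because
g(R(x,y)y,x) ≠ 0, divided by the quotient of sectional curvatures, which tends to 1. -/
lemma tendsto_gram_ratio (x y u v : V) (hr : g (R x y y) x ≠ 0)
    (hG : ∀ᶠ t in 𝓝[≠] (0 : ℝ), gram g (x + t • u) (y + t • v) ≠ 0)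
    (hH : ∀ᶠ t in 𝓝[≠] (0 : ℝ), gram h (x + t • u) (y + t • v) ≠ 0)
    (H : Tendsto (fun t : ℝ =>
      (h (R' (x + t • u) (y + t • v) (y + t • v)) (x + t • u) / gram h (x + t • u) (y + t • v)) /
      (g (R (x + t • u) (y + t • v) (y + t • v)) (x + t • u) / gram g (x + t • u) (y + t • v)))
      (𝓝[≠] 0) (𝓝 1)) :
    Tendsto (fun t : ℝ => gram h (x + t • u) (y + t • v) / gram g (x + t • u) (y + t • v)) (𝓝[≠] 0)
      (𝓝 (h (R' x y y) x / g (R x y y) x)) := by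
  have hc := (continuous_sect g R x y u v 0).tendsto 0
  have hc' := (continuous_sect h R' x y u v 0).tendsto 0
  simp only [smul_zero, add_zero, zero_smul] at hc hc'
  have hne := (hc.mono_left (nhdsWithin_le_nhds (s := {0}ᶜ))).eventually_ne hr
  have h1 := ((hc'.div hc hr).mono_left (nhdsWithin_le_nhds (s := {0}ᶜ))).div H one_ne_zero
  rw [div_one] at h1
  refine h1.congr' ?_
  filter_upwards [hG, hH, hne, H.eventually_ne one_ne_zero] with t h1 h2 h3 h4
  -- If this numerator vanished, the quotient of sectional curvatures would be 0, contrary to its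
  -- being close to 1.
  have h5 : h (R' (x + t • u) (y + t • v) (y + t • v)) (x + t • u) ≠ 0 := by
    intro h0
    rw [h0] at h4
    simp at h4
  simp only [Pi.div_apply]
  field_simp

/-- If the sectional curvatures of two metrics are asymptotically equal near every strongly
degenerate plane with nonzero curvature, the metrics are proportional at the point. -/
theorem exists_eq_smul_of_curvature_ratio [FiniteDimensional ℝ V]
    (hg : ∀ x y, g x y = g y x) (hgn : ∀ x, (∀ y, g x y = 0) → x = 0)
    (hh : ∀ x y, h x y = h y x) (hhn : ∀ x, (∀ y, h x y = 0) → x = 0)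
    (hsi : StronglyIndefinite (toBilin g)) (hR : IsCurvatureLike (toBilin g) R)
    (H : ∀ x y, g x x = 0 → g x y = 0 → g y y = 0 → g (R x y y) x ≠ 0 → ∀ u v,
      (∀ᶠ t in 𝓝[≠] (0 : ℝ), gram g (x + t • u) (y + t • v) ≠ 0) →
      (∀ᶠ t in 𝓝[≠] (0 : ℝ), gram h (x + t • u) (y + t • v) ≠ 0) →
      Tendsto (fun t : ℝ =>
      (h (R' (x + t • u) (y + t • v) (y + t • v)) (x + t • u) / gram h (x + t • u) (y + t • v)) /
      (g (R (x + t • u) (y + t • v) (y + t • v)) (x + t • u) / gram g (x + t • u) (y + t • v)))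
      (𝓝[≠] 0) (𝓝 1))
    {x y : V} (hxx : g x x = 0) (hxy : g x y = 0) (hyy : g y y = 0) (hr : g (R x y y) x ≠ 0) :
    ∃ c : ℝ, c ≠ 0 ∧ (∀ u v, h u v = c * g u v) ∧ h (R' x y y) x = c ^ 2 * g (R x y y) x := by
  have key : ∀ x y, g x x = 0 → g x y = 0 → g y y = 0 → g (R x y y) x ≠ 0 →
      ∃ c : ℝ, c ^ 2 = h (R' x y y) x / g (R x y y) x ∧ (∀ w, h x w = c * g x w) ∧
        ∀ w, h y w = c * g y w := fun x y hxx hxy hyy hr =>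
    exists_eq_smul_of_gram_ratio hg hgn hh hhn (linearIndependent_of_curv_ne_zero hR hr) hxx hxy hyy
      fun u v h1 h2 => tendsto_gram_ratio x y u v hr h1 h2 (H x y hxx hxy hyy hr u v h1 h2)
  obtain ⟨c, hc, hcx, -⟩ := key x y hxx hxy hyy hr
  have hli := linearIndependent_of_curv_ne_zero hR hr
  have hx0 : x ≠ 0 := hli.ne_zero 0
  obtain ⟨v, hv1, hv2⟩ := exists_dual_pair hgn hli
  -- A null vector pairing to 1 with x and orthogonal to y.
  set z := v - (g v v / 2) • x with hz
  have hzz : g z z = 0 := by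
    simp only [hz, map_sub, map_smul, sub_apply, smul_apply,
      smul_eq_mul, hg v x, hv1, hxx]
    ring
  have hxz : g x z = 1 := by simp [hz, hv1, hxx]
  have hyz : g y z = 0 := by simp [hz, hv2, hg y x, hxy]
  obtain ⟨⟨a, ha, haa⟩, -⟩ := hsi x
  refine ⟨c, ?_, ?_, ?_⟩
  · rintro rfl
    exact hx0 (hhn x fun w => by simp [hcx w])
  · refine exists_eq_smul_of_null_eigen hg hh hxx hzz hxz ⟨a, ha, haa.ne'⟩ ?_ hcx
    intro w hxw hzw
    have hc0 := (continuous_sect g R x y w (-(g w y) • z) (-(g w w / 2) • z)).tendsto 0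
    simp only [zero_smul, add_zero, ne_eq, OfNat.ofNat_ne_zero, not_false_eq_true, zero_pow] at hc0
    filter_upwards [(hc0.mono_left (nhdsWithin_le_nhds (s := {0}ᶜ))).eventually_ne hr] with t ht
    have e : x + t • w - (t ^ 2 * g w w / 2) • z = x + t • w + t ^ 2 • -(g w w / 2) • z := by
      module
    rw [e]
    -- When x moves along the null cone, y is corrected by a multiple of z so that the plane remains
    -- isotropic. Its curvature stays nonzero for small t, so `key` applies to it.
    set x' := x + t • w + t ^ 2 • -(g w w / 2) • z with hx'
    set y' := y + t • -(g w y) • z with hy'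
    have e1 : g x' x' = 0 := by
      simp only [hx', map_add, map_smul, add_apply, smul_apply, smul_eq_mul, hg w x, hg z x, hg w z,
        hxx, hxz, hzz, hxw, hzw]
      ring
    have e2 : g x' y' = 0 := by
      simp only [hx', hy', map_add, map_smul, add_apply, smul_apply, smul_eq_mul, hg z y, hg w z,
        hxy, hxz, hyz, hzz, hzw]
      ring
    have e3 : g y' y' = 0 := by
      simp only [hy', map_add, map_smul, add_apply, smul_apply, smul_eq_mul, hg z y, hyy, hyz, hzz]
      ring
    obtain ⟨c', -, hc', -⟩ := key x' y' e1 e2 e3 ht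
    exact ⟨c', hc'⟩
  · rw [hc]
    field_simp

end Pointwise

/-! ### Planes, their bases and convergence in the Grassmannian. -/

section PlaneLemmas

variable {V W : Type*} [AddCommGroup V] [Module ℝ V] [AddCommGroup W] [Module ℝ W]

lemma Plane.ofFrame_toSubmodule {x y : V} (h : LinearIndependent ℝ ![x, y]) :
    (Plane.ofFrame ⟨![x, y], h⟩).toSubmodule = Submodule.span ℝ {x, y} := by
  simp [Plane.ofFrame, Matrix.range_cons, Matrix.range_empty, Set.pair_comm]

lemma Plane.map_toSubmodule {x y : V} {α : Plane V} (hα : α.toSubmodule = Submodule.span ℝ {x, y})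
    (L : V ≃ₗ[ℝ] W) : (α.map L).toSubmodule = Submodule.span ℝ {L x, L y} := by
  simp [Plane.map, hα, Submodule.map_span, Set.image_pair]

lemma Plane.exists_basis_eq {x y : V} {α : Plane V} (hα : α.toSubmodule = Submodule.span ℝ {x, y}) :
    ∃ a b c d : ℝ, a * d - b * c ≠ 0 ∧ (α.basis 0 : V) = a • x + b • y ∧
      (α.basis 1 : V) = c • x + d • y := by
  have h0 : (α.basis 0 : V) ∈ Submodule.span ℝ {x, y} := hα ▸ (α.basis 0).2
  have h1 : (α.basis 1 : V) ∈ Submodule.span ℝ {x, y} := hα ▸ (α.basis 1).2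
  obtain ⟨a, b, hab⟩ := Submodule.mem_span_pair.1 h0
  obtain ⟨c, d, hcd⟩ := Submodule.mem_span_pair.1 h1
  refine ⟨a, b, c, d, fun hdet => ?_, hab.symm, hcd.symm⟩
  have hli := Fintype.linearIndependent_iff.1 α.basis.linearIndependent
  have key : ∀ r s : ℝ, r • (α.basis 0 : V) + s • (α.basis 1 : V) = 0 → r = 0 ∧ s = 0 := by
    intro r s hrs
    have h := hli ![r, s] (by
      rw [Fin.sum_univ_two]
      exact Subtype.ext (by simpa using hrs))
    exact ⟨h 0, h 1⟩
  have e1 : d • (α.basis 0 : V) + (-b) • (α.basis 1 : V) = 0 := by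
    rw [← hab, ← hcd]
    trans (a * d - b * c) • x
    · module
    · rw [hdet, zero_smul]
  have e2 : (-c) • (α.basis 0 : V) + a • (α.basis 1 : V) = 0 := by
    rw [← hab, ← hcd]
    trans (a * d - b * c) • y
    · module
    · rw [hdet, zero_smul]
  obtain ⟨hd, hb⟩ := key _ _ e1
  obtain ⟨hc, ha⟩ := key _ _ e2
  have h0' : (α.basis 0 : V) = 0 := by rw [← hab, ha, neg_eq_zero.1 hb]; simp
  exact α.basis.ne_zero 0 (Subtype.ext h0')

lemma Plane.isNondegenerate_of {B : LinearMap.BilinForm ℝ V} {x y : V} {α : Plane V}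
    (hα : α.toSubmodule = Submodule.span ℝ {x, y}) (hB : B x x * B y y - B x y * B y x ≠ 0) :
    α.IsNondegenerate B := by
  have hx : x ∈ α.toSubmodule := hα ▸ Submodule.subset_span (by simp)
  have hy : y ∈ α.toSubmodule := hα ▸ Submodule.subset_span (by simp)
  have hinj : Function.Injective (B.restrict α.toSubmodule) := by
    rw [← LinearMap.ker_eq_bot, LinearMap.ker_eq_bot']
    rintro ⟨w, hw⟩ h0
    have hw' := hw
    rw [hα] at hw'
    obtain ⟨a, b, rfl⟩ := Submodule.mem_span_pair.1 hw'
    have e1 : B (a • x + b • y) x = 0 := congrArg (fun l => l ⟨x, hx⟩) h0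
    have e2 : B (a • x + b • y) y = 0 := congrArg (fun l => l ⟨y, hy⟩) h0
    simp only [map_add, map_smul, LinearMap.add_apply, LinearMap.smul_apply, smul_eq_mul] at e1 e2
    have ha : a * (B x x * B y y - B x y * B y x) = 0 := by linear_combination B y y * e1 - B y x * e2
    have hb : b * (B x x * B y y - B x y * B y x) = 0 := by linear_combination B x x * e2 - B x y * e1
    have ha' := (mul_eq_zero.1 ha).resolve_right hB
    have hb' := (mul_eq_zero.1 hb).resolve_right hB
    simp [ha', hb']
  rw [Plane.IsNondegenerate, Plane.formRank, LinearMap.finrank_range_of_inj hinj, α.finrank_eq]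

lemma Plane.isStronglyDegenerate_of {B : LinearMap.BilinForm ℝ V} {x y : V} {α : Plane V}
    (hα : α.toSubmodule = Submodule.span ℝ {x, y}) (hxx : B x x = 0) (hxy : B x y = 0)
    (hyx : B y x = 0) (hyy : B y y = 0) : α.IsStronglyDegenerate B := by
  have h0 : B.restrict α.toSubmodule = 0 := by
    ext ⟨w, hw⟩ ⟨w', hw'⟩
    rw [hα] at hw hw'
    obtain ⟨a, b, rfl⟩ := Submodule.mem_span_pair.1 hw
    obtain ⟨c, d, rfl⟩ := Submodule.mem_span_pair.1 hw'
    change B (a • x + b • y) (c • x + d • y) = 0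
    simp [hxx, hxy, hyx, hyy]
  rw [Plane.IsStronglyDegenerate, Plane.formRank, h0, LinearMap.range_zero, finrank_bot]

open Filter in
lemma Plane.exists_tendsto_pencil [TopologicalSpace V] [IsTopologicalAddGroup V] [ContinuousSMul ℝ V]
    {x y u v : V} (hxy : LinearIndependent ℝ ![x, y])
    (hl : ∀ᶠ t in 𝓝[≠] (0 : ℝ), LinearIndependent ℝ ![x + t • u, y + t • v]) :
    ∃ (α₀ : Plane V) (α : ℝ → Plane V), α₀.toSubmodule = Submodule.span ℝ {x, y} ∧
      (∀ᶠ t in 𝓝[≠] (0 : ℝ), (α t).toSubmodule = Submodule.span ℝ {x + t • u, y + t • v}) ∧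
      Tendsto α (𝓝[≠] 0) (𝓝 α₀) := by
  classical
  -- The constant default frame occurs only where the pencil degenerates and does not affect the
  -- limit at 0.
  let F : ℝ → {v : Fin 2 → V // LinearIndependent ℝ v} := fun t =>
    if h : LinearIndependent ℝ ![x + t • u, y + t • v] then ⟨_, h⟩ else ⟨_, hxy⟩
  refine ⟨Plane.ofFrame ⟨_, hxy⟩, fun t => Plane.ofFrame (F t), Plane.ofFrame_toSubmodule hxy, ?_, ?_⟩
  · filter_upwards [hl] with t ht
    simp only [F, dif_pos ht]
    exact Plane.ofFrame_toSubmodule ht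
  · have hF : Tendsto F (𝓝[≠] 0) (𝓝 ⟨_, hxy⟩) := by
      rw [tendsto_subtype_rng]
      have h1 : Tendsto (fun t : ℝ => ![x + t • u, y + t • v]) (𝓝[≠] 0) (𝓝 ![x, y]) := by
        have hc : Continuous (fun t : ℝ => ![x + t • u, y + t • v]) := by fun_prop
        have := hc.tendsto 0
        simp only [zero_smul, add_zero] at this
        exact this.mono_left nhdsWithin_le_nhds
      refine h1.congr' ?_
      filter_upwards [hl] with t ht
      simp only [F, dif_pos ht]
    exact (continuous_coinduced_rng.tendsto _).comp hF

end PlaneLemmas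

/-! ### Strong indefiniteness from the signature. -/

section Signature

variable {V : Type*} [AddCommGroup V] [Module ℝ V] [FiniteDimensional ℝ V]

/-- A positive definite subspace of dimension at least two meets every hyperplane nontrivially. -/
lemma exists_orthogonal_pos {Q : QuadraticForm ℝ V} (hQ : 2 ≤ sigPos Q) (l : V →ₗ[ℝ] ℝ) :
    ∃ a, l a = 0 ∧ 0 < Q a := by
  obtain ⟨W, hW, hpos⟩ := exists_finrank_eq_sigPos_and_posDef Q
  have hker : LinearMap.ker (l.comp W.subtype) ≠ ⊥ :=
    LinearMap.ker_ne_bot_of_finrank_lt (by rw [Module.finrank_self]; omega)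
  obtain ⟨a, ha, ha0⟩ := Submodule.exists_mem_ne_zero_of_ne_bot hker
  exact ⟨a, ha, hpos a ha0⟩

lemma stronglyIndefinite_of_signature {B : LinearMap.BilinForm ℝ V}
    (hp : 2 ≤ sigPos B.toQuadraticMap) (hn : 2 ≤ sigNeg B.toQuadraticMap) :
    StronglyIndefinite B := by
  intro x
  refine ⟨exists_orthogonal_pos hp (B x), ?_⟩
  obtain ⟨b, hb, hbb⟩ := exists_orthogonal_pos (Q := -B.toQuadraticMap) (by rwa [sigPos_neg]) (B x)
  exact ⟨b, hb, by simpa using hbb⟩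

end Signature

/-! ### Two proportional metrics near a point of nonzero curvature. -/

section LocalComparison

variable {E : Type*} [NormedAddCommGroup E] [NormedSpace ℝ E] [FiniteDimensional ℝ E]
  {G H : E → E →L[ℝ] E →L[ℝ] ℝ} {O : Set E}

/-- The identity is a local isometry, so equality on the open set suffices. -/
lemma IsMetricOn.curvL_congr (hG : IsMetricOn G O) (hH : IsMetricOn H O) (e : Set.EqOn G H O) {y : E}
    (hy : y ∈ O) : curvL G y = curvL H y := by
  have h : IsLocalIsometryOn G H O O id :=
    ⟨hG, hH, contDiffOn_id, Set.mapsTo_id O, fun t ht u v => by simp [e ht]⟩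
  ext u v w
  have := h.map_curvL hy u v w
  simpa using this

open Filter in
/-- A proportional metric whose curvature on isotropic planes scales by the square of the
proportionality factor is equal to the given one, where the curvature does not vanish. -/
lemma IsMetricOn.eq_of_proportional (hG : IsMetricOn G O) (hH : IsMetricOn H O)
    (hn : 2 < Module.finrank ℝ E) (hsi : ∀ y ∈ O, StronglyIndefinite (toBilin (G y)))
    (hp : ∀ y ∈ O, ∀ x z, G y x x = 0 → G y x z = 0 → G y z z = 0 →
      G y (curvL G y x z z) x ≠ 0 → ∃ c : ℝ, c ≠ 0 ∧ ∀ u v, H y u v = c * G y u v)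
    {p : E} (hpO : p ∈ O) {x z : E} (hxx : G p x x = 0) (hxz : G p x z = 0) (hzz : G p z z = 0)
    (hr : G p (curvL G p x z z) x ≠ 0)
    (hc : ∃ c : ℝ, (∀ u v, H p u v = c * G p u v) ∧
      H p (curvL H p x z z) x = c ^ 2 * G p (curvL G p x z z) x) : H p = G p := by
  obtain ⟨c, hc, e2⟩ := hc
  -- The Weyl part is nonzero at p, hence near p by continuity. This yields an isotropic plane of
  -- nonzero curvature at every nearby point without following the given plane.
  have hne : ∃ u v w, curvL G p u v w -
      kulkarniNomizu (toBilin (G p)) (schouten G p) u v w ≠ 0 := by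
    by_contra! h
    apply hr
    rw [sub_eq_zero.1 (h x z z), kulkarniNomizu_apply]
    simp [hzz, hxz, hG.symm p hpO z x, hxx]
  obtain ⟨u, v, w, huvw⟩ := hne
  have hS : ∀ u, ContDiffOn ℝ ∞ (fun y => schouten G y u) O := fun u =>
    hG.contDiffOn_schouten.clm_apply contDiffOn_const
  have hGa : ∀ u v : E, ContDiffOn ℝ ∞ (fun y => G y u v) O := fun u v =>
    (hG.contDiffOn.clm_apply contDiffOn_const).clm_apply contDiffOn_const
  have hHa : ∀ u v : E, ContDiffOn ℝ ∞ (fun y => H y u v) O := fun u v =>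
    (hH.contDiffOn.clm_apply contDiffOn_const).clm_apply contDiffOn_const
  have hGS : ∀ u v : E, ContDiffOn ℝ ∞ (fun y => G y (schouten G y u) v) O := fun u v =>
    (hG.contDiffOn.clm_apply (hS u)).clm_apply contDiffOn_const
  have hcont : ContDiffOn ℝ ∞ (fun y => curvL G y u v w -
      kulkarniNomizu (toBilin (G y)) (schouten G y) u v w) O :=
    (hG.contDiffOn_curvL u v w).sub (((((hGa v w).smul (hS u)).add ((hGS v w).smul
      contDiffOn_const)).sub ((hGa u w).smul (hS v))).sub ((hGS u w).smul contDiffOn_const))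
  have hO := hG.isOpen.mem_nhds hpO
  obtain ⟨⟨a, -, haa⟩, -⟩ := hsi p hpO x
  have ev1 := (hcont.continuousOn.continuousAt hO).eventually_ne huvw
  have ev2 := ((hGa a a).continuousOn.continuousAt hO).eventually_ne
    (show G p a a ≠ 0 from haa.ne')
  obtain ⟨O', hO's, hO'o, hpO'⟩ := eventually_nhds_iff.1 (ev1.and (ev2.and (eventually_mem_nhds_iff.2 hO)))
  have hsub : O' ⊆ O := fun y hy => mem_of_mem_nhds (hO's y hy).2.2
  -- Dividing values on a fixed nonnull vector a makes the factor visibly smooth.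
  set l : E → ℝ := fun y => H y a a / G y a a with hl
  have hprop : ∀ y ∈ O', l y ≠ 0 ∧ H y = l y • G y := by
    intro y hy
    have hyO := hsub hy
    have : ∃ x z, G y x x = 0 ∧ G y x z = 0 ∧ G y z z = 0 ∧ G y (curvL G y x z z) x ≠ 0 := by
      by_contra! h0
      refine (hO's y hy).1 ?_
      rw [hG.curvL_eq_kulkarniNomizu hyO (hsi y hyO) hn h0, sub_self]
    obtain ⟨x, z, h1, h2, h3, h4⟩ := this
    obtain ⟨c, hc0, hc⟩ := hp y hyO x z h1 h2 h3 h4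
    have hlc : l y = c := by
      rw [hl]
      simp only [hc a a]
      rw [mul_div_assoc, div_self (hO's y hy).2.1, mul_one]
    refine ⟨hlc ▸ hc0, ?_⟩
    ext u v
    rw [hlc, hc]
    simp
  have hG' : IsMetricOn G O' := hG.mono hO'o hsub
  have hlc : ContDiffOn ℝ ∞ l O' :=
    ((hHa a a).mono hsub).div ((hGa a a).mono hsub) fun y hy => (hO's y hy).2.1
  have e1 := hG'.curv_smul_isotropic hlc (fun y hy => (hprop y hy).1) hpO' hxx hxz hzz
  rw [← (hH.mono hO'o hsub).curvL_congr (hG'.smul hlc fun y hy => (hprop y hy).1)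
    (fun y hy => (hprop y hy).2) hpO'] at e1
  obtain ⟨hl0, hlp⟩ := hprop p hpO'
  have hlc : l p = c := by
    simp only [hl, hc a a]
    rw [mul_div_assoc, div_self (hO's p hpO').2.1, mul_one]
  -- On the isotropic pair the conformal change gives the factor l for the curvature of H, the limit
  -- gives l²; hence l = 1.
  rw [← hlc, hlp] at e2
  simp only [smul_apply, smul_eq_mul, e1] at e2
  have e3 : l p = 1 := by
    have : l p * G p (curvL G p x z z) x * (l p - 1) = 0 := by linear_combination -e2
    rcases mul_eq_zero.1 this with h | h
    · exact absurd h (mul_ne_zero hl0 hr)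
    · linarith
  rw [hlp, e3, one_smul]

end LocalComparison

/-! ### Pullback metrics and conformal flatness on the manifold. -/

section Glue

variable {E : Type*} [NormedAddCommGroup E] [NormedSpace ℝ E] [FiniteDimensional ℝ E]
  {M : Type*} [TopologicalSpace M] [ChartedSpace E M] [IsManifold 𝓘(ℝ, E) ∞ M]
  {M' : Type*} [TopologicalSpace M'] [ChartedSpace E M'] [IsManifold 𝓘(ℝ, E) ∞ M']

lemma IsSmoothMetricOn.curvature_chart {g : FormField E M} {V : Set M} (h : IsSmoothMetricOn g V)
    {p q : M} (hq : q ∈ V) (hqp : q ∈ (extChartAt 𝓘(ℝ, E) p).source)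
    (x y z w : TangentSpace 𝓘(ℝ, E) q) :
    curvature g q x y z w = inChart g p (extChartAt 𝓘(ℝ, E) p q)
      (curvL (inChart g p) (extChartAt 𝓘(ℝ, E) p q)
        (dChart p q x) (dChart p q y) (dChart p q z)) (dChart p q w) := by
  have e := h.curvature_eq_inChart h (f := id) contMDiffOn_id (Set.mapsTo_id V)
    (fun m _ u v => by rw [mfderiv_id]; rfl) hq (p' := p) hqp x y z w
  have e2 : dRead (E := E) (id : M → M) q p = dChart p q := by
    ext u
    change dChart p q (mfderiv 𝓘(ℝ, E) 𝓘(ℝ, E) (id : M → M) q u) = _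
    rw [mfderiv_id]
    rfl
  rw [e2] at e
  exact e

/-- The pullback of a field of bilinear forms. -/
def pullback (g' : FormField E M') (f : M → M') : FormField E M := fun p =>
  let A : E →L[ℝ] E := mfderiv 𝓘(ℝ, E) 𝓘(ℝ, E) f p
  let B : E →L[ℝ] E →L[ℝ] ℝ := g' (f p)
  let C : E →L[ℝ] E →L[ℝ] ℝ := B.bilinearComp A A
  C

lemma pullsBackAt_pullback (g' : FormField E M') (f : M → M') (m : M) :
    PullsBackAt (pullback g' f) g' f m := fun _ _ => rfl

/-- Smoothness is checked near each point t using the target chart centred at the image of t;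
nondegeneracy holds because the differential of f is invertible. -/
lemma isSmoothMetricOn_pullback (g' : PseudoRiemannianMetric E M')
    (f : M ≃ₘ⟮𝓘(ℝ, E), 𝓘(ℝ, E)⟯ M') : IsSmoothMetricOn (pullback g'.val f) Set.univ := by
  refine ⟨isOpen_univ, fun p => isMetricOn_inChart (isOpen_chartSet p isOpen_univ)
    Set.inter_subset_left ?_ (fun p x y => g'.symm _ _ _) ?_⟩
  · intro t ht
    set p' := f ((extChartAt 𝓘(ℝ, E) p).symm t) with hp'
    set W : Set M := f ⁻¹' (extChartAt 𝓘(ℝ, E) p').source with hW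
    have hWo : IsOpen W := (isOpen_extChartAt_source p').preimage f.continuous
    have hWt : t ∈ chartSet (E := E) p W := ⟨ht.1, mem_extChartAt_source p'⟩
    have hψ : ContDiffOn ℝ ∞ (fun t => extChartAt 𝓘(ℝ, E) p' (f ((extChartAt 𝓘(ℝ, E) p).symm t)))
      (chartSet (E := E) p W) := contDiffOn_transition f.contMDiff.contMDiffOn fun m hm => hm
    have hO := isOpen_chartSet (E := E) p hWo
    have hψ' := hψ.fderiv_of_isOpen (m := ∞) hO (by simp)
    have hG := (contDiffOn_inChart g' p').comp hψ fun s hs =>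
      (extChartAt 𝓘(ℝ, E) p').map_source hs.2
    have key : ContDiffOn ℝ ∞ (inChart (pullback g'.val f) p) (chartSet (E := E) p W) := by
      rw [contDiffOn_clm_apply]
      intro u
      rw [contDiffOn_clm_apply]
      intro v
      refine ((hG.clm_apply (hψ'.clm_apply (contDiffOn_const (c := u)))).clm_apply
        (hψ'.clm_apply (contDiffOn_const (c := v)))).congr fun s hs => ?_
      exact inChart_transition hs.1 (f.contMDiff.mdifferentiable (by simp) _) hs.2
        (pullsBackAt_pullback _ _ _) u v
    exact (key.contDiffAt (hO.mem_nhds hWt)).contDiffWithinAt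
  · intro p x hx
    let L := f.mfderivToContinuousLinearEquiv (by simp) p
    have h1 : L x = 0 := g'.nondegenerate _ _ fun y => by
      have := hx (L.symm y)
      have e : g'.val (f p) (L x) (L (L.symm y)) = 0 := this
      rwa [L.apply_symm_apply] at e
    simpa using h1

lemma curvature_pullback (g' : PseudoRiemannianMetric E M') (f : M ≃ₘ⟮𝓘(ℝ, E), 𝓘(ℝ, E)⟯ M')
    (p : M) (x y z w : TangentSpace 𝓘(ℝ, E) p) :
    curvature (pullback g'.val f) p x y z w = curvature g'.val (f p)
      (mfderiv 𝓘(ℝ, E) 𝓘(ℝ, E) f p x) (mfderiv 𝓘(ℝ, E) 𝓘(ℝ, E) f p y)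
      (mfderiv 𝓘(ℝ, E) 𝓘(ℝ, E) f p z) (mfderiv 𝓘(ℝ, E) 𝓘(ℝ, E) f p w) := by
  rw [(isSmoothMetricOn_pullback g' f).curvature_eq_inChart g'.isSmoothMetricOn
    f.contMDiff.contMDiffOn (Set.mapsTo_univ _ _) (fun m _ => pullsBackAt_pullback _ _ _)
    (Set.mem_univ p) (mem_extChartAt_source (f p)),
    g'.isSmoothMetricOn.curvature_chart (Set.mem_univ (f p)) (mem_extChartAt_source (f p))]
  rfl

lemma stronglyIndefinite_inChart {g : FormField E M} {p : M} {y : E}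
    (hy : y ∈ (extChartAt 𝓘(ℝ, E) p).target)
    (hg : StronglyIndefinite (formAt g ((extChartAt 𝓘(ℝ, E) p).symm y))) :
    StronglyIndefinite (toBilin (inChart g p y)) := by
  intro x
  obtain ⟨⟨a, ha, haa⟩, b, hb, hbb⟩ := hg (dSymm p y x)
  refine ⟨⟨dChart p _ a, ?_, ?_⟩, dChart p _ b, ?_, ?_⟩
  all_goals
    rw [toBilin_apply, inChart_apply]
    simp only [dSymm_dChart hy]
    assumption

lemma IsSmoothMetricOn.isConformallyFlatOn {g : FormField E M} {W : Set M}
    (h : IsSmoothMetricOn g W) (hn : 3 < Module.finrank ℝ E)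
    (hsi : ∀ q ∈ W, StronglyIndefinite (formAt g q))
    (h0 : ∀ q ∈ W, ∀ x z : TangentSpace 𝓘(ℝ, E) q, g q x x = 0 → g q x z = 0 → g q z z = 0 →
      curvature g q x z z x = 0) : IsConformallyFlatOn g W := by
  intro p hp
  have hpO : extChartAt 𝓘(ℝ, E) p p ∈ chartSet (E := E) p W :=
    extChartAt_mem_chartSet (mem_extChartAt_source p) hp
  obtain ⟨U, hUO, hU, hpU, τ, hτ, hτ0, hflat⟩ := (h.isMetricOn p).exists_conformal_factor hn
    (fun y hy => stronglyIndefinite_inChart hy.1 (hsi _ hy.2)) (fun y hy x z hxx hxz hzz => by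
      have hq : (extChartAt 𝓘(ℝ, E) p).symm y ∈ (extChartAt 𝓘(ℝ, E) p).source :=
        (extChartAt 𝓘(ℝ, E) p).map_target hy.1
      have e := h.curvature_chart hy.2 hq (dSymm p y x) (dSymm p y z) (dSymm p y z) (dSymm p y x)
      rw [(extChartAt 𝓘(ℝ, E) p).right_inv hy.1, dChart_dSymm hy.1, dChart_dSymm hy.1] at e
      rw [← e]
      exact h0 _ hy.2 _ _ hxx hxz hzz) hpO
  set V : Set M := (extChartAt 𝓘(ℝ, E) p).source ∩ (extChartAt 𝓘(ℝ, E) p) ⁻¹' U with hV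
  have hVo : IsOpen V :=
    (continuousOn_extChartAt p).isOpen_inter_preimage (isOpen_extChartAt_source p) hU
  have hVW : V ⊆ W := fun q hq => by
    have := (hUO hq.2).2
    rwa [Set.mem_preimage, (extChartAt 𝓘(ℝ, E) p).left_inv hq.1] at this
  -- With σ = -log τ the factor e^{2σ} equals τ⁻².
  set σ : M → ℝ := fun m => -Real.log (τ (extChartAt 𝓘(ℝ, E) p m)) with hσ
  have hσs : ContMDiffOn 𝓘(ℝ, E) 𝓘(ℝ, ℝ) ∞ σ V := by
    have h1 : ContDiffOn ℝ ∞ (fun y => -Real.log (τ y)) U :=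
      (hτ.log fun y hy => (hτ0 y hy).ne').neg
    have h2 : ContMDiffOn 𝓘(ℝ, E) 𝓘(ℝ, E) ∞ (extChartAt 𝓘(ℝ, E) p) V :=
      (contMDiffOn_extChartAt (I := 𝓘(ℝ, E)) (n := ∞) (x := p)).mono fun q hq => by
        rw [← extChartAt_source 𝓘(ℝ, E)]; exact hq.1
    exact (contMDiffOn_iff_contDiffOn.2 h1).comp h2 fun q hq => hq.2
  refine ⟨V, hVo, ⟨mem_extChartAt_source p, hpU⟩, hVW, σ, hσs, fun q hq x y z w => ?_⟩
  have hexp : ContMDiffOn 𝓘(ℝ, E) 𝓘(ℝ, ℝ) ∞ (fun m => Real.exp (2 * σ m)) V := by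
    have h1 : ContDiff ℝ ∞ (fun s : ℝ => Real.exp (2 * s)) := by fun_prop
    exact h1.contMDiff.comp_contMDiffOn hσs
  have hnew := (h.mono hVo hVW).smul hexp fun m _ => (Real.exp_pos _).ne'
  have hUt : U ⊆ chartSet (E := E) p V := fun y hy => ⟨(hUO hy).1, by
    refine ⟨(extChartAt 𝓘(ℝ, E) p).map_target (hUO hy).1, ?_⟩
    rwa [Set.mem_preimage, (extChartAt 𝓘(ℝ, E) p).right_inv (hUO hy).1]⟩
  have hmet := (hnew.isMetricOn p).mono hU hUt
  have heq : Set.EqOn (inChart (fun m => Real.exp (2 * σ m) • g m) p)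
      (fun y => (τ y ^ 2)⁻¹ • inChart g p y) U := by
    intro y hy
    have e : Real.exp (2 * σ ((extChartAt 𝓘(ℝ, E) p).symm y)) = (τ y ^ 2)⁻¹ := by
      simp only [hσ]
      rw [(extChartAt 𝓘(ℝ, E) p).right_inv (hUO hy).1, mul_neg, Real.exp_neg, two_mul, Real.exp_add,
        Real.exp_log (hτ0 y hy), sq]
    change Real.exp (2 * σ ((extChartAt 𝓘(ℝ, E) p).symm y)) • inChart g p y = _
    rw [e]
  have hmet2 : IsMetricOn (fun y => (τ y ^ 2)⁻¹ • inChart g p y) U :=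
    ((h.isMetricOn p).mono hU hUO).smul ((hτ.pow 2).inv fun y hy => (pow_pos (hτ0 y hy) 2).ne')
      fun y hy => inv_ne_zero (pow_pos (hτ0 y hy) 2).ne'
  rw [hnew.curvature_chart hq hq.1, hmet.curvL_congr hmet2 heq hq.2, hflat _ hq.2, map_zero]
  rfl

end Glue

/-! ### Sectional curvature in an arbitrary basis. -/

section SectionalCurvature

variable {E : Type*} [NormedAddCommGroup E] [NormedSpace ℝ E] [FiniteDimensional ℝ E]
  {M : Type*} [TopologicalSpace M] [ChartedSpace E M] [IsManifold 𝓘(ℝ, E) ∞ M]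

/-- Numerator and denominator both scale by the squared determinant, so the basis chosen in the
definition is immaterial. -/
lemma sectionalCurvature_eq (g : PseudoRiemannianMetric E M) (p : M)
    {α : Plane (TangentSpace 𝓘(ℝ, E) p)} {x y : TangentSpace 𝓘(ℝ, E) p}
    (hα : α.toSubmodule = Submodule.span ℝ {x, y}) :
    sectionalCurvature g.val p α =
      curvature g.val p x y y x / (g.val p x x * g.val p y y - g.val p x y * g.val p x y) := by
  obtain ⟨a, b, c, d, hdet, h0, h1⟩ := Plane.exists_basis_eq hα
  have hs := g.isSmoothMetricOn
  have hc := (hs.isMetricOn p).isCurvatureLike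
    (extChartAt_mem_chartSet (mem_extChartAt_source p) (Set.mem_univ p))
  have e := hc.sect_change_basis x y a b c d
  simp only [toBilin_apply] at e
  rw [inChart_self] at e
  have e1 : curvature g.val p (a • x + b • y) (c • x + d • y) (c • x + d • y) (a • x + b • y) =
      (a * d - b * c) ^ 2 * curvature g.val p x y y x := by
    refine (hs.curvature_eq (Set.mem_univ p) _ _ _ _).trans (e.trans ?_)
    exact congrArg _ (hs.curvature_eq (Set.mem_univ p) x y y x).symm
  have e2 : piOne g.val p (a • x + b • y) (c • x + d • y) (c • x + d • y) (a • x + b • y) =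
      (a * d - b * c) ^ 2 * (g.val p x x * g.val p y y - g.val p x y * g.val p x y) := by
    simp only [piOne, map_add, map_smul, add_apply, smul_apply, smul_eq_mul, g.symm p y x]
    ring
  simp only [sectionalCurvature]
  rw [h0, h1, e1, e2, mul_div_mul_left _ _ (pow_ne_zero 2 hdet)]

end SectionalCurvature

/-! ### Rigidity of the diffeomorphism. -/

section Main

open Filter

variable {E : Type*} [NormedAddCommGroup E] [NormedSpace ℝ E] [FiniteDimensional ℝ E]
  {M : Type*} [TopologicalSpace M] [ChartedSpace E M] [IsManifold 𝓘(ℝ, E) ∞ M]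
  {M' : Type*} [TopologicalSpace M'] [ChartedSpace E M'] [IsManifold 𝓘(ℝ, E) ∞ M']
  (g : PseudoRiemannianMetric E M) (g' : PseudoRiemannianMetric E M')
  (f : M ≃ₘ⟮𝓘(ℝ, E), 𝓘(ℝ, E)⟯ M')

/-- The form at `p` as a form on the model space. -/
def formE (g : FormField E M) (p : M) : E →L[ℝ] E →L[ℝ] ℝ := g p

/-- The curvature operator at `p` on the model space. -/
def curvAt (g : FormField E M) (p : M) : E →ₗ[ℝ] E →ₗ[ℝ] E →ₗ[ℝ] E :=
  curvL (inChart g p) (extChartAt 𝓘(ℝ, E) p p)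

lemma IsSmoothMetricOn.curvature_eq_curvAt {g : FormField E M} (h : IsSmoothMetricOn g Set.univ)
    (p : M) (x y z w : E) : curvature g p x y z w = formE g p (curvAt g p x y z) w :=
  h.curvature_eq (Set.mem_univ p) x y z w

/-- The limit over the Grassmannian, restricted to a pencil. The three nonvanishing conditions keep
the pencil in the set of planes over which the limit is taken. -/
lemma tendsto_ratio_pencil {p : M}
    (hf : ∀ α₀ : Plane (TangentSpace 𝓘(ℝ, E) p), α₀.IsStronglyDegenerate (formAt g.val p) →
      CurvatureRatioTendsToOne g.val g'.val f p α₀)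
    {x y u v : TangentSpace 𝓘(ℝ, E) p} (hxy : LinearIndependent ℝ ![x, y])
    (hxx : g.val p x x = 0) (hgxy : g.val p x y = 0) (hyy : g.val p y y = 0)
    (hr : ∀ᶠ t in 𝓝[≠] (0 : ℝ),
      curvature g.val p (x + t • u) (y + t • v) (y + t • v) (x + t • u) ≠ 0)
    (hG : ∀ᶠ t in 𝓝[≠] (0 : ℝ), gram (formE g.val p) (x + t • u) (y + t • v) ≠ 0)
    (hH : ∀ᶠ t in 𝓝[≠] (0 : ℝ), gram (formE (pullback g'.val f) p) (x + t • u) (y + t • v) ≠ 0) :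
    Tendsto (fun t : ℝ =>
      (curvature (pullback g'.val f) p (x + t • u) (y + t • v) (y + t • v) (x + t • u) /
        gram (formE (pullback g'.val f) p) (x + t • u) (y + t • v)) /
      (curvature g.val p (x + t • u) (y + t • v) (y + t • v) (x + t • u) /
        gram (formE g.val p) (x + t • u) (y + t • v))) (𝓝[≠] 0) (𝓝 1) := by
  obtain ⟨α₀, α, hα₀, hα, hlim⟩ := Plane.exists_tendsto_pencil (u := u) (v := v) hxy
    (hG.mono fun t ht => linearIndependent_of_gram_ne_zero (V := E) ht)
  have h0 := hf α₀ (Plane.isStronglyDegenerate_of hα₀ hxx hgxy ((g.symm p y x).trans hgxy) hyy)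
  have hpush : ∀ t, (α t).toSubmodule = Submodule.span ℝ {x + t • u, y + t • v} →
      (pushPlane f p (α t)).toSubmodule = Submodule.span ℝ
        {mfderiv 𝓘(ℝ, E) 𝓘(ℝ, E) f p (x + t • u), mfderiv 𝓘(ℝ, E) 𝓘(ℝ, E) f p (y + t • v)} :=
    fun t ht => Plane.map_toSubmodule ht _
  have hK : ∀ t, (α t).toSubmodule = Submodule.span ℝ {x + t • u, y + t • v} →
      sectionalCurvature g.val p (α t) =
        curvature g.val p (x + t • u) (y + t • v) (y + t • v) (x + t • u) /
        gram (formE g.val p) (x + t • u) (y + t • v) := fun t ht => sectionalCurvature_eq g p ht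
  have hK' : ∀ t, (α t).toSubmodule = Submodule.span ℝ {x + t • u, y + t • v} →
      sectionalCurvature g'.val (f p) (pushPlane f p (α t)) =
        curvature (pullback g'.val f) p (x + t • u) (y + t • v) (y + t • v) (x + t • u) /
        gram (formE (pullback g'.val f) p) (x + t • u) (y + t • v) := fun t ht => by
    rw [sectionalCurvature_eq g' (f p) (hpush t ht), curvature_pullback]
    rfl
  have hlim' : Tendsto α (𝓝[≠] 0) (𝓝[{α | α.IsNondegenerate (formAt g.val p) ∧
        (pushPlane f p α).IsNondegenerate (formAt g'.val (f p)) ∧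
        sectionalCurvature g.val p α ≠ 0}] α₀) := by
    rw [tendsto_nhdsWithin_iff]
    refine ⟨hlim, ?_⟩
    filter_upwards [hα, hr, hG, hH] with t h1 h2 h3 h4
    refine ⟨Plane.isNondegenerate_of h1 fun h => h3 ?_,
      Plane.isNondegenerate_of (hpush t h1) fun h => h4 ?_, ?_⟩
    · rw [← h]
      exact congrArg (fun s => g.val p (x + t • u) (x + t • u) * g.val p (y + t • v) (y + t • v) -
        g.val p (x + t • u) (y + t • v) * s) (g.symm p _ _)
    · rw [← h]
      exact congrArg (fun s => g'.val (f p) (mfderiv 𝓘(ℝ, E) 𝓘(ℝ, E) f p (x + t • u))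
        (mfderiv 𝓘(ℝ, E) 𝓘(ℝ, E) f p (x + t • u)) * g'.val (f p)
        (mfderiv 𝓘(ℝ, E) 𝓘(ℝ, E) f p (y + t • v)) (mfderiv 𝓘(ℝ, E) 𝓘(ℝ, E) f p (y + t • v)) -
        g'.val (f p) (mfderiv 𝓘(ℝ, E) 𝓘(ℝ, E) f p (x + t • u))
        (mfderiv 𝓘(ℝ, E) 𝓘(ℝ, E) f p (y + t • v)) * s) (g'.symm (f p) _ _)
    · rw [hK t h1]
      exact div_ne_zero h2 h3
  refine (h0.comp hlim').congr' ?_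
  filter_upwards [hα] with t ht
  simp only [Function.comp_apply]
  rw [hK t ht, hK' t ht]

variable {g g' f} in
lemma exists_eq_smul_at {p : M} (hsi : StronglyIndefinite (formAt g.val p))
    (hf : ∀ α₀ : Plane (TangentSpace 𝓘(ℝ, E) p), α₀.IsStronglyDegenerate (formAt g.val p) →
      CurvatureRatioTendsToOne g.val g'.val f p α₀)
    {x y : E} (hxx : formE g.val p x x = 0) (hxy : formE g.val p x y = 0)
    (hyy : formE g.val p y y = 0) (hr : formE g.val p (curvAt g.val p x y y) x ≠ 0) :
    ∃ c : ℝ, c ≠ 0 ∧ (∀ u v, formE (pullback g'.val f) p u v = c * formE g.val p u v) ∧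
      formE (pullback g'.val f) p (curvAt (pullback g'.val f) p x y y) x =
        c ^ 2 * formE g.val p (curvAt g.val p x y y) x := by
  have hs := g.isSmoothMetricOn
  have hs' := isSmoothMetricOn_pullback g' f
  have hp : extChartAt 𝓘(ℝ, E) p p ∈ chartSet (E := E) p (Set.univ : Set M) :=
    extChartAt_mem_chartSet (mem_extChartAt_source p) (Set.mem_univ p)
  set R := curvAt g.val p with hR
  set R' := curvAt (pullback g'.val f) p with hR'
  have eR : ∀ x y z w : E, curvature g.val p x y z w = formE g.val p (R x y z) w :=
    hs.curvature_eq_curvAt p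
  have eR' : ∀ x y z w : E, curvature (pullback g'.val f) p x y z w =
    formE (pullback g'.val f) p (R' x y z) w := hs'.curvature_eq_curvAt p
  have hc : IsCurvatureLike (toBilin (formE g.val p)) R := by
    have := (hs.isMetricOn p).isCurvatureLike hp
    rwa [inChart_self] at this
  have hm := (hs'.isMetricOn p).nondeg _ hp
  have hm' := (hs'.isMetricOn p).symm _ hp
  rw [inChart_self] at hm hm'
  exact exists_eq_smul_of_curvature_ratio (g := formE g.val p)
    (h := formE (pullback g'.val f) p) (R := R) (R' := R') (g.symm p) (g.nondegenerate p) hm' hm hsi hc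
    (fun x y hxx hxy hyy hr u v h1 h2 => by
      have hcont := ((continuous_sect (formE g.val p) R x y u v 0).tendsto 0).mono_left
        (nhdsWithin_le_nhds (s := {0}ᶜ))
      simp only [smul_zero, add_zero, zero_smul] at hcont
      have h := tendsto_ratio_pencil g g' f hf (x := x) (y := y) (u := u) (v := v)
        (linearIndependent_of_curv_ne_zero hc hr) hxx hxy hyy
        ((hcont.eventually_ne hr).mono fun t ht => by rw [← eR] at ht; exact ht) h1 h2
      refine h.congr fun t => ?_
      exact congrArg₂ (· / ·) (congrArg₂ (· / ·) (eR' _ _ _ _) rfl) (congrArg₂ (· / ·) (eR _ _ _ _) rfl))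
    hxx hxy hyy hr

/-- A diffeomorphism asymptotically preserving the sectional curvature near strongly degenerate
planes preserves the metric wherever the curvature does not vanish on strongly degenerate planes. -/
lemma pullback_eq_of_curvature_ne_zero (hn : 2 < Module.finrank ℝ E)
    (hsi : ∀ p, StronglyIndefinite (formAt g.val p))
    (hf : ∀ (p : M) (α₀ : Plane (TangentSpace 𝓘(ℝ, E) p)),
      α₀.IsStronglyDegenerate (formAt g.val p) → CurvatureRatioTendsToOne g.val g'.val f p α₀)
    {p : M} {x z : E} (hxx : formE g.val p x x = 0) (hxz : formE g.val p x z = 0)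
    (hzz : formE g.val p z z = 0) (hr : formE g.val p (curvAt g.val p x z z) x ≠ 0) :
    formE (pullback g'.val f) p = formE g.val p := by
  obtain ⟨c, -, hc1, hc2⟩ := exists_eq_smul_at (hsi p) (hf p) hxx hxz hzz hr
  have hs := g.isSmoothMetricOn
  have hs' := isSmoothMetricOn_pullback g' f
  have hp : extChartAt 𝓘(ℝ, E) p p ∈ chartSet (E := E) p (Set.univ : Set M) :=
    extChartAt_mem_chartSet (mem_extChartAt_source p) (Set.mem_univ p)
  have e : inChart g.val p (extChartAt 𝓘(ℝ, E) p p) = formE g.val p := inChart_self _ _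
  have e' : inChart (pullback g'.val f) p (extChartAt 𝓘(ℝ, E) p p) = formE (pullback g'.val f) p :=
    inChart_self _ _
  have hsi' : ∀ y ∈ chartSet (E := E) p (Set.univ : Set M),
      StronglyIndefinite (toBilin (inChart g.val p y)) := fun y hy =>
    stronglyIndefinite_inChart hy.1 (hsi ((extChartAt 𝓘(ℝ, E) p).symm y))
  set G := inChart g.val p with hG
  set H := inChart (pullback g'.val f) p with hH
  -- The pointwise proportionality is applied at each point of the chart around p, with the vectors
  -- carried over by the differential of the inverse chart.
  have hprop : ∀ y ∈ chartSet (E := E) p (Set.univ : Set M), ∀ x z, G y x x = 0 → G y x z = 0 →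
      G y z z = 0 → G y (curvL G y x z z) x ≠ 0 →
      ∃ c : ℝ, c ≠ 0 ∧ ∀ u v, H y u v = c * G y u v := by
    intro y hy x z hxx hxz hzz hr
    have hq : (extChartAt 𝓘(ℝ, E) p).symm y ∈ (extChartAt 𝓘(ℝ, E) p).source :=
      (extChartAt 𝓘(ℝ, E) p).map_target hy.1
    have e := hs.curvature_chart (Set.mem_univ _) hq (dSymm p y x) (dSymm p y z) (dSymm p y z)
      (dSymm p y x)
    rw [(extChartAt 𝓘(ℝ, E) p).right_inv hy.1, dChart_dSymm hy.1, dChart_dSymm hy.1] at e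
    have hr' : formE g.val ((extChartAt 𝓘(ℝ, E) p).symm y)
        (curvAt g.val ((extChartAt 𝓘(ℝ, E) p).symm y) (dSymm p y x) (dSymm p y z) (dSymm p y z))
        (dSymm p y x) ≠ 0 := by
      intro h
      exact hr (e.symm.trans ((hs.curvature_eq_curvAt _ _ _ _ _).trans h))
    obtain ⟨c, hc0, hc, -⟩ := exists_eq_smul_at (p := (extChartAt 𝓘(ℝ, E) p).symm y)
      (x := dSymm p y x) (y := dSymm p y z) (hsi _) (hf _) hxx hxz hzz hr'
    exact ⟨c, hc0, fun u v => hc (dSymm p y u) (dSymm p y v)⟩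
  rw [← e] at hc1 hc2 hr hxx hxz hzz
  rw [← e'] at hc1 hc2
  have key := (hs.isMetricOn p).eq_of_proportional (hs'.isMetricOn p) hn
    hsi' hprop hp hxx hxz hzz hr ⟨c, hc1, hc2⟩
  exact e'.symm.trans (key.trans e)

/-- The points where the two metrics agree form a dense set, because off their closure the metric
would be conformally flat; continuity does the rest. -/
lemma isIsometry_of_curvature_ratio (hn : 3 < Module.finrank ℝ E)
    (hsi : ∀ p, StronglyIndefinite (formAt g.val p)) (hflat : NowhereConformallyFlat g.val)
    (hf : ∀ (p : M) (α₀ : Plane (TangentSpace 𝓘(ℝ, E) p)),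
      α₀.IsStronglyDegenerate (formAt g.val p) → CurvatureRatioTendsToOne g.val g'.val f p α₀) :
    IsIsometry g.val g'.val f := by
  have hs := g.isSmoothMetricOn
  have hs' := isSmoothMetricOn_pullback g' f
  -- On an open set W where the metrics differ at every point, the curvature must vanish on all
  -- isotropic planes, so W would be conformally flat.
  have hfreq : ∀ p, ∃ᶠ q in 𝓝 p, pullback g'.val f q = g.val q := by
    intro p hp
    obtain ⟨W, hWs, hW, hpW⟩ := eventually_nhds_iff.1 hp
    refine hflat W hW ⟨p, hpW⟩ ((hs.mono hW (Set.subset_univ W)).isConformallyFlatOn hn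
      (fun q _ => hsi q) fun q hq x z hxx hxz hzz => ?_)
    by_contra hr
    exact hWs q hq (pullback_eq_of_curvature_ne_zero g g' f (by omega) hsi hf hxx hxz hzz
      fun h0 => hr ((hs.curvature_eq_curvAt q x z z x).trans h0))
  have heq : ∀ p, pullback g'.val f p = g.val p := by
    intro p
    have hp : extChartAt 𝓘(ℝ, E) p p ∈ chartSet (E := E) p (Set.univ : Set M) :=
      extChartAt_mem_chartSet (mem_extChartAt_source p) (Set.mem_univ p)
    have hc : ∀ k : FormField E M, IsSmoothMetricOn k Set.univ → ContinuousAt (fun q =>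
        inChart k p (extChartAt 𝓘(ℝ, E) p q)) p := fun k hk =>
      ContinuousAt.comp (f := extChartAt 𝓘(ℝ, E) p) ((hk.isMetricOn p).contDiffOn.continuousOn.continuousAt
        ((hk.isMetricOn p).isOpen.mem_nhds hp)) (continuousAt_extChartAt p)
    have hsub := (hc _ hs').sub (hc _ hs)
    have key : inChart (pullback g'.val f) p (extChartAt 𝓘(ℝ, E) p p) -
        inChart g.val p (extChartAt 𝓘(ℝ, E) p p) = 0 := by
      by_contra hne
      refine hfreq p ?_
      filter_upwards [hsub.eventually_ne hne, extChartAt_source_mem_nhds (I := 𝓘(ℝ, E)) p]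
        with q hq hqs hqe
      apply hq
      refine sub_eq_zero.2 ?_
      have e : pullback g'.val f ((extChartAt 𝓘(ℝ, E) p).symm (extChartAt 𝓘(ℝ, E) p q)) =
          g.val ((extChartAt 𝓘(ℝ, E) p).symm (extChartAt 𝓘(ℝ, E) p q)) := by
        rw [(extChartAt 𝓘(ℝ, E) p).left_inv hqs]; exact hqe
      ext u v
      rw [inChart_apply, inChart_apply, e]
    rw [sub_eq_zero, inChart_self, inChart_self] at key
    exact key
  intro p x y
  exact congrArg (fun B : E →L[ℝ] E →L[ℝ] ℝ => B x y) (heq p)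

end Main

end PseudoRiem

end

theorem theorem3 (n s : ℕ) (hs : 2 ≤ s) (hns : 2 ≤ n - s)
    (M : Type*) [TopologicalSpace M] [ChartedSpace (EuclideanSpace ℝ (Fin n)) M]
    [IsManifold 𝓘(ℝ, EuclideanSpace ℝ (Fin n)) ∞ M]
    (M' : Type*) [TopologicalSpace M'] [ChartedSpace (EuclideanSpace ℝ (Fin n)) M']
    [IsManifold 𝓘(ℝ, EuclideanSpace ℝ (Fin n)) ∞ M']
    (g : PseudoRiem.PseudoRiemannianMetric (EuclideanSpace ℝ (Fin n)) M)
    (g' : PseudoRiem.PseudoRiemannianMetric (EuclideanSpace ℝ (Fin n)) M')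
    (hsig : PseudoRiem.HasSignature g.val s (n - s))
    (hflat : PseudoRiem.NowhereConformallyFlat g.val)
    (f : M ≃ₘ⟮𝓘(ℝ, EuclideanSpace ℝ (Fin n)), 𝓘(ℝ, EuclideanSpace ℝ (Fin n))⟯ M')
    (hf : ∀ (p : M)
      (α₀ : PseudoRiem.Plane (TangentSpace 𝓘(ℝ, EuclideanSpace ℝ (Fin n)) p)),
      α₀.IsStronglyDegenerate (PseudoRiem.formAt g.val p) →
      PseudoRiem.CurvatureRatioTendsToOne g.val g'.val f p α₀) :
    PseudoRiem.IsIsometry g.val g'.val f := by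
  have hfin : ∀ p : M, FiniteDimensional ℝ (TangentSpace 𝓘(ℝ, EuclideanSpace ℝ (Fin n)) p) :=
    fun p => inferInstanceAs (FiniteDimensional ℝ (EuclideanSpace ℝ (Fin n)))
  -- With truncated subtraction, 2 ≤ n - s still forces s ≤ n, hence n = s + (n - s) ≥ 4.
  refine PseudoRiem.isIsometry_of_curvature_ratio g g' f (by rw [finrank_euclideanSpace_fin]; omega)
    (fun p => ?_) hflat hf
  obtain ⟨h1, h2⟩ := hsig p
  have := hfin p
  exact PseudoRiem.stronglyIndefinite_of_signature (by omega) (by omega)
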